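/- **Setting.** All ZX-diagrams are finite and Clifford (phases in $\tfrac{\pi}{2}\mathbb Z$), and all Pauli strings are taken up to phase. A *ZX rewrite* replaces a subdiagram by a diagram with the same open legs that represents the same linear map up to a nonzero scalar. A *Pauli web* labels every edge with a Pauli operator so that around every node the labels form, up to sign, a stabilizer of the node. A Pauli string on the open legs is a *stabilizer* of the diagram if it is the restriction of a Pauli web. A *spacetime stabilizer* of a diagram is a Pauli web that is trivial on the open legs; these form an $\mathbb F_2$-vector space whose dimension is the number of independent spacetime stabilizers. Two diagrams are *ZX-equivalent* if they are connected by ZX rewrites, and *spacetime equivalent* if they are connected by ZX rewrites none of which changes the number of independent spacetime stabilizers. Let $\mathcal S,\overline{\mathcal S}$ be Pauli stabilizer codes on the same finite set $Q$ of data qubits, with the same number of logical qubits, each given by a set of commuting checks that generates it, and let every data qubit be assigned to one of finitely many locations $i\in I$. A *Clifford dynamical code* between $\mathcal S$ and $\overline{\mathcal S}$ is a ZX-diagram with incoming legs $Q$ and outgoing legs $Q$ whose linear map $\mathcal M\neq 0$ satisfies: $\mathcal M s=c_s\mathcal M$ for $s\in\mathcal S$; $\overline s\mathcal M=c_{\overline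 s}\mathcal M$ for $\overline s\in\overline{\mathcal S}$, with phases $c_s,c_{\overline s}$; and for every incoming logical operator $L$ (a Pauli string commuting with $\mathcal S$) there is an outgoing logical operator $\overline L$ with $\mathcal M L=\overline L\mathcal M$ up to a phase. A *gadget layout* consists of a number $\ell_{ij}=\ell_{ji}\ge 0$ of internal legs for every pair $i\ne j$ (the *internal-leg layout*; these legs form the *bond* $ij$) and a ZX-diagram (gadget) $\mathcal M_i$ for every $i$, whose legs are the incoming and outgoing legs of the data qubits at $i$ and the $\ell_{ij}$ internal legs of each bond $ij$. Joining the internal legs along the bonds gives the diagram of the layout. The layout satisfies the *strict-$k$-locality-preservation condition* if for every check of $\mathcal S$ on the incoming legs, and every check of $\overline{\mathcal S}$ on the outgoing legs, there are Pauli operators on the internal legs, nontrivial only on bonds $ij$ for which both $i$ and $j$ contain a data qubit in the support of the check, which together with the check restrict to a stabilizer of every gadget. A *gadget layout of a dynamical code* is a layout that satisfies this condition and whose diagram is obtained from the diagram of the code by ZX rewrites none of which changes the number of independent spacetime stabilizers. The code is *SLP* if it has such a layout. A layout is *minimal* if no gadget has a nontrivial stabilizer supported on the internal legs of a single bond. Two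 layouts with the same internal-leg layout are *bond-local unitary equivalent* if there is a unitary change of basis of every bond, i.e. a unitary $U$ on the internal legs at one end of the bond and its complex conjugate $U^*$ at the other end (so that the two cancel when the bond is contracted), which turns each gadget of the first layout into the gadget of the second layout at the same location. Here two gadgets are identified if their tensors agree up to a nonzero scalar and the numbers of independent spacetime stabilizers inside them agree. **Theorem.** Two SLP Clifford dynamical codes between the same pair of incoming and outgoing stabilizer codes are spacetime equivalent if and only if there exist minimal gadget layouts of the two codes that have the same internal-leg layout and are bond-local unitary equivalent. -/

import Mathlib

noncomputable section

/-! ### Clifford ZX-diagrams -/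

/-- A one-qubit Pauli operator up to phase: `(x, z)` stands for `X ^ x * Z ^ z`. -/
abbrev Pauli : Type := ZMod 2 × ZMod 2

/-- The two species of nodes of a ZX-diagram. -/
inductive SpiderColor : Type
  | Z
  | X

/-- A Clifford ZX-diagram with open legs indexed by `L`. It is a finite graph, possibly with
multiple edges and self-loops; every node has a color and a phase `k * π / 2` with `k : ZMod 4`.
Every edge `e` has the two ends `(e, false)` and `(e, true)`, each of which lies at a node or is an
open leg, and every open leg is exactly one edge end. -/
structure ZXDiagram (L : Type) : Type 1 where
  V : Type
  E : Type
  [fintypeV : Fintype V]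
  [fintypeE : Fintype E]
  color : V → SpiderColor
  phase : V → ZMod 4
  endpoint : E × Bool → V ⊕ L
  leg_unique : ∀ l : L, ∃! h : E × Bool, endpoint h = Sum.inr l

attribute [instance] ZXDiagram.fintypeV ZXDiagram.fintypeE

/-- The amplitude of a node whose legs carry the basis values `y`.
`Z` node: `|0⋯0⟩ + e^{iα} |1⋯1⟩`.  `X` node: `|+⋯+⟩ + e^{iα} |-⋯-⟩`.  Here `α = k * π / 2`. -/
def spiderAmplitude (c : SpiderColor) (k : ZMod 4) {H : Type} [Fintype H] (y : H → ZMod 2) : ℂ :=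
  match c with
  | SpiderColor.Z =>
      (if ∀ h, y h = 0 then 1 else 0) + (if ∀ h, y h = 1 then Complex.I ^ k.val else 0)
  | SpiderColor.X =>
      ((Real.sqrt 2 : ℝ) : ℂ)⁻¹ ^ Fintype.card H *
        (1 + Complex.I ^ k.val * (-1) ^ (∑ h, (y h).val))

namespace ZXDiagram

variable {L : Type}

/-- The edge ends at the node `v`. -/
abbrev HalfEdge (D : ZXDiagram L) (v : D.V) : Type := {h : D.E × Bool // D.endpoint h = Sum.inl v}

open scoped Classical in
/-- The tensor (linear map with all legs bent to one side) represented by a ZX-diagram. -/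
def eval (D : ZXDiagram L) (x : L → ZMod 2) : ℂ :=
  ∑ y : D.E → ZMod 2,
    if ∀ h l, D.endpoint h = Sum.inr l → y h.1 = x l then
      ∏ v, spiderAmplitude (D.color v) (D.phase v) (fun h : D.HalfEdge v => y h.1.1)
    else 0

/-- Two diagrams with the same open legs represent the same linear map up to a nonzero scalar. -/
def SameMap (D D' : ZXDiagram L) : Prop :=
  ∃ c : ℂ, c ≠ 0 ∧ D'.eval = c • D.eval

open scoped Classical in
/-- A Pauli web: a Pauli label on every edge which, around every node, is up to sign a stabilizer
of that node. The stabilizers of a `Z` node of phase `k * π / 2` are generated by the products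
`Z Z` over two of its legs and by `X ⋯ X` (for even `k`) or `Y X ⋯ X` (for odd `k`); for an
`X` node the roles of `X` and `Z` are exchanged. -/
def IsPauliWeb (D : ZXDiagram L) (w : D.E → Pauli) : Prop :=
  ∀ v, match D.color v with
    | SpiderColor.Z => ∃ c : ZMod 2, (∀ h : D.HalfEdge v, (w h.1.1).1 = c) ∧
        ∑ h : D.HalfEdge v, (w h.1.1).2 = c * ((D.phase v).val : ZMod 2)
    | SpiderColor.X => ∃ c : ZMod 2, (∀ h : D.HalfEdge v, (w h.1.1).2 = c) ∧
        ∑ h : D.HalfEdge v, (w h.1.1).1 = c * ((D.phase v).val : ZMod 2)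

/-- The spacetime stabilizers inside a diagram: the closed Pauli webs, i.e. those that do not
reach any open leg. They form a vector space over `𝔽₂`. -/
def spacetimeStabilizers (D : ZXDiagram L) : Submodule (ZMod 2) (D.E → Pauli) where
  carrier := {w | D.IsPauliWeb w ∧ ∀ h l, D.endpoint h = Sum.inr l → w h.1 = 0}
  zero_mem' := by
    refine ⟨fun v => ?_, fun _ _ _ => rfl⟩
    cases D.color v <;> exact ⟨0, by simp⟩
  add_mem' := by
    rintro a b ⟨ha, ha'⟩ ⟨hb, hb'⟩
    refine ⟨fun v => ?_, fun h l e => by simp [ha' h l e, hb' h l e]⟩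
    have h1 := ha v
    have h2 := hb v
    cases hc : D.color v <;> simp only [hc] at h1 h2 <;>
      obtain ⟨c, hc1, hc2⟩ := h1 <;> obtain ⟨d, hd1, hd2⟩ := h2 <;>
      refine ⟨c + d, fun h => by simp [hc1 h, hd1 h], ?_⟩ <;>
      simp [Finset.sum_add_distrib, hc2, hd2, add_mul]
  smul_mem' := by
    rintro r a ⟨ha, ha'⟩
    refine ⟨fun v => ?_, fun h l e => by simp [ha' h l e]⟩
    have h1 := ha v
    cases hc : D.color v <;> simp only [hc] at h1 <;>
      obtain ⟨c, hc1, hc2⟩ := h1 <;>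
      refine ⟨r * c, fun h => by simp [hc1 h], ?_⟩ <;>
      simp [← Finset.mul_sum, hc2, mul_assoc]

/-- The number of independent spacetime stabilizers inside a diagram. -/
def numSpacetimeStabilizers (D : ZXDiagram L) : ℕ :=
  Module.finrank (ZMod 2) D.spacetimeStabilizers

/-- The Pauli string `p` on the open legs is a stabilizer of the diagram (up to sign): it is the
restriction of a Pauli web to the open legs. -/
def IsStabilizer (D : ZXDiagram L) (p : L → Pauli) : Prop :=
  ∃ w, D.IsPauliWeb w ∧ ∀ h l, D.endpoint h = Sum.inr l → w h.1 = p l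

/-- Two diagrams are the same up to renaming nodes, renaming edges and reversing edges. -/
def Iso (D D' : ZXDiagram L) : Prop :=
  ∃ (eV : D.V ≃ D'.V) (eE : D.E ≃ D'.E) (flip : D.E → Bool),
    (∀ v, D'.color (eV v) = D.color v) ∧ (∀ v, D'.phase (eV v) = D.phase v) ∧
    ∀ e b, D'.endpoint (eE e, xor b (flip e)) = Sum.map eV id (D.endpoint (e, b))

end ZXDiagram

/-! ### Connecting diagrams, rewriting, spacetime equivalence -/

/-- A wiring of the legs `A`: every leg either becomes one of the open legs `L` (each of them once)
or is joined to exactly one other leg, the pairs of joined legs being indexed by `B`. -/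
structure Wiring (A L B : Type) where
  toFun : A → L ⊕ B
  open_unique : ∀ l, ∃! a, toFun a = Sum.inl l
  joined_pair : ∀ b, ∃ a a', a ≠ a' ∧ ∀ a'', toFun a'' = Sum.inr b ↔ a'' = a ∨ a'' = a'

namespace ZXDiagram

/-- Disjoint union of two diagrams. -/
def union {A A' : Type} (D : ZXDiagram A) (D' : ZXDiagram A') : ZXDiagram (A ⊕ A') where
  V := D.V ⊕ D'.V
  E := D.E ⊕ D'.E
  color := Sum.elim D.color D'.color
  phase := Sum.elim D.phase D'.phase
  endpoint h := match h with
    | (Sum.inl e, b) => Sum.map Sum.inl Sum.inl (D.endpoint (e, b))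
    | (Sum.inr e, b) => Sum.map Sum.inr Sum.inr (D'.endpoint (e, b))
  leg_unique := by
    rintro (l | l)
    · obtain ⟨⟨e, b⟩, h, hu⟩ := D.leg_unique l
      refine ⟨(Sum.inl e, b), by simp [h], ?_⟩
      rintro ⟨e' | e', b'⟩ h'
      · have : D.endpoint (e', b') = Sum.inr l := by
          cases h2 : D.endpoint (e', b') <;> simp_all
        have := hu _ this
        simp_all
      · cases h2 : D'.endpoint (e', b') <;> simp_all
    · obtain ⟨⟨e, b⟩, h, hu⟩ := D'.leg_unique l
      refine ⟨(Sum.inr e, b), by simp [h], ?_⟩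
      rintro ⟨e' | e', b'⟩ h'
      · cases h2 : D.endpoint (e', b') <;> simp_all
      · have : D'.endpoint (e', b') = Sum.inr l := by
          cases h2 : D'.endpoint (e', b') <;> simp_all
        have := hu _ this
        simp_all

/-- Disjoint union of a finite family of diagrams. -/
def sigma {I : Type} [Fintype I] {A : I → Type} (G : ∀ i, ZXDiagram (A i)) :
    ZXDiagram (Σ i, A i) where
  V := Σ i, (G i).V
  E := Σ i, (G i).E
  color v := (G v.1).color v.2
  phase v := (G v.1).phase v.2
  endpoint h := Sum.map (Sigma.mk h.1.1) (Sigma.mk h.1.1) ((G h.1.1).endpoint (h.1.2, h.2))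
  leg_unique := by
    rintro ⟨i, l⟩
    obtain ⟨⟨e, b⟩, h, hu⟩ := (G i).leg_unique l
    refine ⟨(⟨i, e⟩, b), by simp [h], ?_⟩
    rintro ⟨⟨i', e'⟩, b'⟩ h'
    cases h2 : (G i').endpoint (e', b') with
    | inl v => simp [h2] at h'
    | inr l' =>
      simp only [h2, Sum.map_inr, Sum.inr.injEq] at h'
      cases h'
      have := hu _ h2
      simp_all

/-- Join the legs of a diagram according to a wiring. Joined legs meet at a phaseless two-leg node,
which is the identity wire. -/
def connect {A L B : Type} [Fintype B] (D : ZXDiagram A) (f : Wiring A L B) : ZXDiagram L where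
  V := D.V ⊕ B
  E := D.E
  color := Sum.elim D.color fun _ => SpiderColor.Z
  phase := Sum.elim D.phase fun _ => 0
  endpoint h := match D.endpoint h with
    | Sum.inl v => Sum.inl (Sum.inl v)
    | Sum.inr a => match f.toFun a with
      | Sum.inl l => Sum.inr l
      | Sum.inr b => Sum.inl (Sum.inr b)
  leg_unique := by
    intro l
    obtain ⟨a, ha, hau⟩ := f.open_unique l
    obtain ⟨h, hh, hhu⟩ := D.leg_unique a
    refine ⟨h, by simp [hh, ha], ?_⟩
    intro h' h1
    apply hhu
    cases h2 : D.endpoint h' with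
    | inl v => simp [h2] at h1
    | inr a' =>
      cases h3 : f.toFun a' with
      | inr b => simp [h2, h3] at h1
      | inl l' =>
        simp only [h2, h3, Sum.inr.injEq] at h1
        subst h1
        rw [hau a' h3]

/-- A ZX rewrite: some subdiagram `P` is replaced by a diagram `P'` with the same legs that
represents the same linear map up to a nonzero scalar, the rest `C` of the diagram and the way in
which it is connected to the subdiagram being unchanged. -/
inductive Rewrite {L : Type} : ZXDiagram L → ZXDiagram L → Prop
  | replace {A A' B : Type} [Fintype B] (P P' : ZXDiagram A) (C : ZXDiagram A')
      (f : Wiring (A ⊕ A') L B) (D D' : ZXDiagram L) (hP : P.SameMap P')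
      (hD : D.Iso ((P.union C).connect f)) (hD' : D'.Iso ((P'.union C).connect f)) :
      Rewrite D D'

/-- ZX-equivalence: connected by a sequence of ZX rewrites. -/
def ZXEquiv {L : Type} (D D' : ZXDiagram L) : Prop :=
  Relation.ReflTransGen Rewrite D D'

/-- Connected by a sequence of ZX rewrites none of which creates or destroys independent spacetime
stabilizers. -/
def StabilizerPreservingRewrites {L : Type} (D D' : ZXDiagram L) : Prop :=
  Relation.ReflTransGen (fun D₁ D₂ : ZXDiagram L =>
    Rewrite D₁ D₂ ∧ D₁.numSpacetimeStabilizers = D₂.numSpacetimeStabilizers) D D'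

/-- Spacetime equivalence of ZX-diagrams. -/
def SpacetimeEquiv {L : Type} (D D' : ZXDiagram L) : Prop :=
  ZXEquiv D D' ∧ StabilizerPreservingRewrites D D'

end ZXDiagram

/-! ### Stabilizer codes and dynamical codes -/

/-- The symplectic form on Pauli strings; it vanishes exactly when the two strings commute. -/
def pauliSymplectic {Q : Type} [Fintype Q] (p p' : Q → Pauli) : ZMod 2 :=
  ∑ q, ((p q).1 * (p' q).2 + (p q).2 * (p' q).1)

open scoped Classical in
/-- The operator `∏ q, X_q ^ x_q * Z_q ^ z_q` in the computational basis. -/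
def pauliOp {Q : Type} [Fintype Q] (p : Q → Pauli) : Matrix (Q → ZMod 2) (Q → ZMod 2) ℂ :=
  fun a b => if a = b + (fun q => (p q).1) then (-1) ^ (∑ q, ((p q).2 * b q).val) else 0

/-- A Pauli stabilizer code on the qubits `Q`, presented by a set of pairwise commuting checks (the
generators given by its Tanner graph). Signs play no role and are left out. -/
structure StabilizerCode (Q : Type) [Fintype Q] where
  checks : Set (Q → Pauli)
  commute : ∀ s ∈ checks, ∀ s' ∈ checks, pauliSymplectic s s' = 0

namespace StabilizerCode

variable {Q : Type} [Fintype Q]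

/-- The stabilizer group, generated by the checks. -/
def stabilizerGroup (S : StabilizerCode Q) : Submodule (ZMod 2) (Q → Pauli) :=
  Submodule.span (ZMod 2) S.checks

/-- The Pauli strings that commute with all stabilizers: the representatives of the logical
operators. -/
def logicalOperators (S : StabilizerCode Q) : Set (Q → Pauli) :=
  {p | ∀ s ∈ S.stabilizerGroup, pauliSymplectic p s = 0}

end StabilizerCode

/-- The linear map `ℂ^{2^n} → ℂ^{2^n}` of a diagram with incoming legs `Q` (the first summand) and
outgoing legs `Q` (the second summand). -/
def ZXDiagram.linearMap {Q : Type} (D : ZXDiagram (Q ⊕ Q)) :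
    Matrix (Q → ZMod 2) (Q → ZMod 2) ℂ :=
  fun b a => D.eval (Sum.elim a b)

open scoped Classical in
/-- `D` is (the ZX-diagram of) a Clifford dynamical code with incoming stabilizer code `S` and
outgoing stabilizer code `S'`. -/
structure IsDynamicalCode {Q : Type} [Fintype Q] (S S' : StabilizerCode Q)
    (D : ZXDiagram (Q ⊕ Q)) : Prop where
  same_k : Module.finrank (ZMod 2) S.stabilizerGroup = Module.finrank (ZMod 2) S'.stabilizerGroup
  ne_zero : D.linearMap ≠ 0
  measures : ∀ s ∈ S.stabilizerGroup, ∃ c : ℂ, ‖c‖ = 1 ∧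
    D.linearMap * pauliOp s = c • D.linearMap
  generates : ∀ s ∈ S'.stabilizerGroup, ∃ c : ℂ, ‖c‖ = 1 ∧
    pauliOp s * D.linearMap = c • D.linearMap
  logical : ∀ p ∈ S.logicalOperators, ∃ p' ∈ S'.logicalOperators, ∃ c : ℂ, ‖c‖ = 1 ∧
    D.linearMap * pauliOp p = c • (pauliOp p' * D.linearMap)

/-! ### Gadget layouts -/

/-- The legs of the gadget at the location `i`: the incoming and the outgoing legs of the data
qubits at `i`, and for every other location `j` the `ℓ s(i, j)` internal legs of the bond between
`i` and `j`. -/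
inductive GadgetLeg {Q I : Type} (site : Q → I) (ℓ : Sym2 I → ℕ) (i : I) : Type
  | incoming (q : Q) (hq : site q = i) : GadgetLeg site ℓ i
  | outgoing (q : Q) (hq : site q = i) : GadgetLeg site ℓ i
  | internal (j : I) (hj : i ≠ j) (a : Fin (ℓ s(i, j))) : GadgetLeg site ℓ i

/-- A gadget layout with internal-leg layout `ℓ`: a ZX-diagram (gadget) at every location. -/
abbrev GadgetLayout {Q I : Type} (site : Q → I) (ℓ : Sym2 I → ℕ) : Type 1 :=
  ∀ i, ZXDiagram (GadgetLeg site ℓ i)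

/-- The wires of all bonds. -/
abbrev BondWire {I : Type} (ℓ : Sym2 I → ℕ) : Type := Σ e : {e : Sym2 I // ¬ e.IsDiag}, Fin (ℓ e)

/-- The contraction of the bonds: the internal leg `a` of the gadget at `i` towards `j` is joined to
the internal leg `a` of the gadget at `j` towards `i`. -/
def bondWiring {Q I : Type} (site : Q → I) (ℓ : Sym2 I → ℕ) :
    Wiring (Σ i, GadgetLeg site ℓ i) (Q ⊕ Q) (BondWire ℓ) where
  toFun l := match l with
    | ⟨_, .incoming q _⟩ => Sum.inl (Sum.inl q)
    | ⟨_, .outgoing q _⟩ => Sum.inl (Sum.inr q)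
    | ⟨i, .internal j hj a⟩ => Sum.inr ⟨⟨s(i, j), by simpa using hj⟩, a⟩
  open_unique := by
    rintro (q | q)
    · refine ⟨⟨site q, .incoming q rfl⟩, rfl, ?_⟩
      rintro ⟨i, (⟨q', hq⟩ | ⟨q', hq⟩ | ⟨j, hj, a⟩)⟩ h <;> simp_all
      subst h hq
      exact ⟨rfl, HEq.rfl⟩
    · refine ⟨⟨site q, .outgoing q rfl⟩, rfl, ?_⟩
      rintro ⟨i, (⟨q', hq⟩ | ⟨q', hq⟩ | ⟨j, hj, a⟩)⟩ h <;> simp_all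
      subst h hq
      exact ⟨rfl, HEq.rfl⟩
  joined_pair := by
    rintro ⟨⟨e, he⟩, a⟩
    induction e using Sym2.ind with
    | _ i j =>
      have hij : i ≠ j := by simpa using he
      refine ⟨⟨i, .internal j hij a⟩, ⟨j, .internal i hij.symm (a.cast (congrArg ℓ Sym2.eq_swap))⟩,
        by simp [hij], ?_⟩
      rintro ⟨k, (⟨q', hq⟩ | ⟨q', hq⟩ | ⟨m, hm, b⟩)⟩
      · refine iff_of_false (by simp) ?_
        rintro (h | h) <;> cases h
      · refine iff_of_false (by simp) ?_
        rintro (h | h) <;> cases h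
      · constructor
        · intro h
          simp only [Sum.inr.injEq, Sigma.mk.injEq, Subtype.mk.injEq] at h
          obtain ⟨h1, h2⟩ := h
          rcases Sym2.eq_iff.1 h1 with ⟨rfl, rfl⟩ | ⟨rfl, rfl⟩
          · left; simpa using h2
          · right
            congr
            apply Fin.ext
            have h3 : ℓ s(k, m) = ℓ s(m, k) := by rw [Sym2.eq_swap]
            have := (Fin.heq_ext_iff h3).1 h2
            simpa using this
        · rintro (h | h)
          · cases h; rfl
          · cases h
            simp only [Sum.inr.injEq, Sigma.mk.injEq, Subtype.mk.injEq]
            refine ⟨Sym2.eq_swap, ?_⟩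
            exact (Fin.heq_ext_iff (by rw [Sym2.eq_swap])).2 (by simp)

namespace GadgetLayout

variable {Q I : Type} {site : Q → I} {ℓ : Sym2 I → ℕ}

open scoped Classical in
/-- The diagram obtained from a gadget layout by connecting the gadgets along the bonds. -/
def diagram [Fintype I] (G : GadgetLayout site ℓ) : ZXDiagram (Q ⊕ Q) :=
  (ZXDiagram.sigma G).connect (bondWiring site ℓ)

/-- The Pauli string on the legs of the gadget at `i` given by the Pauli strings `s` and `s'` on the
incoming and the outgoing legs and by the bond operators `β`. -/
def legPauli (s s' : Q → Pauli) (β : ∀ e, Fin (ℓ e) → Pauli) (i : I) :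
    GadgetLeg site ℓ i → Pauli
  | .incoming q _ => s q
  | .outgoing q _ => s' q
  | .internal j _ a => β s(i, j) a

/-- There is a Pauli web that enters through the open legs as `s` (incoming) and `s'` (outgoing)
and whose bond operators live only on bonds between two gadgets of locations with a data qubit in
the support of `s` or `s'`. -/
def HasLocalWeb (G : GadgetLayout site ℓ) (s s' : Q → Pauli) : Prop :=
  ∃ β : ∀ e, Fin (ℓ e) → Pauli,
    (∀ i, (G i).IsStabilizer (legPauli s s' β i)) ∧
    ∀ e a, β e a ≠ 0 → ∀ i ∈ e, ∃ q, site q = i ∧ (s q ≠ 0 ∨ s' q ≠ 0)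

/-- The strict locality-preservation condition: every incoming check and every outgoing check has
a Pauli web that stays on the bonds between the gadgets of the data qubits in the check. -/
def IsSLPC [Fintype Q] (S S' : StabilizerCode Q) (G : GadgetLayout site ℓ) : Prop :=
  (∀ s ∈ S.checks, HasLocalWeb G s 0) ∧ (∀ s ∈ S'.checks, HasLocalWeb G 0 s)

/-- `G` is a gadget layout of the code with diagram `D`: it satisfies the strict
locality-preservation condition and `D` can be brought to it by ZX rewrites that create or destroy
no spacetime stabilizers. -/
def IsLayoutOf [Fintype Q] [Fintype I] (S S' : StabilizerCode Q) (G : GadgetLayout site ℓ)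
    (D : ZXDiagram (Q ⊕ Q)) : Prop :=
  D.StabilizerPreservingRewrites (diagram G) ∧ IsSLPC S S' G

/-- Every gadget is minimal: it has no nontrivial stabilizer that is supported on the internal legs
of a single bond. -/
def IsMinimal (G : GadgetLayout site ℓ) : Prop :=
  ∀ i j, i ≠ j → ∀ p : GadgetLeg site ℓ i → Pauli, (G i).IsStabilizer p →
    (∀ q hq, p (.incoming q hq) = 0) → (∀ q hq, p (.outgoing q hq) = 0) →
    (∀ k hk a, k ≠ j → p (.internal k hk a) = 0) → p = 0

/-- Replace the values on the internal legs. -/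
def setInternal {i : I} (x : GadgetLeg site ℓ i → ZMod 2)
    (y : ∀ j : {j // i ≠ j}, Fin (ℓ s(i, j.1)) → ZMod 2) : GadgetLeg site ℓ i → ZMod 2
  | .incoming q hq => x (.incoming q hq)
  | .outgoing q hq => x (.outgoing q hq)
  | .internal j hj a => y ⟨j, hj⟩ a

open scoped Classical in
/-- Apply to the tensor `T` of a gadget, on every bond `e`, the matrix `U e` acting on the internal
legs of that bond. -/
def applyBondMatrices [Fintype I] {i : I}
    (U : ∀ e, Matrix (Fin (ℓ e) → ZMod 2) (Fin (ℓ e) → ZMod 2) ℂ)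
    (T : (GadgetLeg site ℓ i → ZMod 2) → ℂ) : (GadgetLeg site ℓ i → ZMod 2) → ℂ :=
  fun x => ∑ y : (∀ j : {j // i ≠ j}, Fin (ℓ s(i, j.1)) → ZMod 2),
    (∏ j : {j // i ≠ j}, U s(i, j.1) (fun a => x (.internal j.1 j.2 a)) (y j)) * T (setInternal x y)

/-- Bond-local unitary equivalence of two layouts with the same internal-leg layout. There is a
unitary change of basis of every bond, given by a unitary `U i e` on the internal legs at the end
`i` of the bond `e` and by its complex conjugate at the other end (so that the two cancel in the
contraction of the bond), which turns every gadget of `G` into the gadget of `G'` at the same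
location; here gadgets are ZX-diagrams, which may be rewritten without creating or destroying
spacetime stabilizers, so besides the tensors (up to a nonzero scalar) the numbers of independent
spacetime stabilizers inside the two gadgets agree. -/
def BondLocalUnitaryEquiv [Fintype I] (G G' : GadgetLayout site ℓ) : Prop :=
  ∃ U : I → ∀ e, Matrix (Fin (ℓ e) → ZMod 2) (Fin (ℓ e) → ZMod 2) ℂ,
    (∀ i e, U i e ∈ Matrix.unitaryGroup (Fin (ℓ e) → ZMod 2) ℂ) ∧
    (∀ i j, i ≠ j → U j s(i, j) = (U i s(i, j)).map star) ∧
    ∀ i, (∃ c : ℂ, c ≠ 0 ∧ (G' i).eval = c • applyBondMatrices (U i) (G i).eval) ∧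
      (G' i).numSpacetimeStabilizers = (G i).numSpacetimeStabilizers

end GadgetLayout

/-- A dynamical code between `S` and `S'` with diagram `D` is strict-`k`-locality-preserving. -/
def IsSLP {Q I : Type} [Fintype Q] [Fintype I] (site : Q → I) (S S' : StabilizerCode Q)
    (D : ZXDiagram (Q ⊕ Q)) : Prop :=
  ∃ (ℓ : Sym2 I → ℕ) (G : GadgetLayout site ℓ), GadgetLayout.IsLayoutOf S S' G D

end

/-! A whole diagram counts as a subdiagram of itself, so a chain of rewrites can be replaced by a
single one. ZX-equivalence therefore means equality of the maps up to a nonzero scalar, and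
spacetime equivalence means in addition equality of the numbers of spacetime stabilizers
(`zxEquiv_iff`, `stabilizerPreservingRewrites_iff`). Hence a layout of one code is a layout of every
spacetime equivalent code. Two claims remain: every SLP code has a minimal layout, which then serves
both codes with trivial unitaries; and bond-local unitaries change neither the contracted map up to
scalar nor the number of spacetime stabilizers.

Both claims rest on a dictionary between webs and tensors. The restriction of a web to the open legs
is a Pauli symmetry of the tensor, and by duality over 𝔽₂ these restrictions contain every Pauli
string that commutes with all of them. Symmetries of a nonzero tensor commute, so for such a tensor
stabilizers and symmetries coincide (`isStabilizer_iff_isSymm`). Conversely, every nonzero tensor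
with a maximal isotropic space of symmetries is represented by a diagram without spacetime
stabilizers (`exists_diagram_of_isClifford`). Adding closed components then makes the number of
spacetime stabilizers arbitrary (`exists_sameMap_num`).

Unitaries: a unitary and its conjugate cancel across a bond, so the map is kept. The spacetime
stabilizers of a layout number those inside the gadgets plus the dimension d of the space of bond
operators that extend to webs trivial on the open legs. Norms determine d: expanding Bell pairs in
Pauli operators gives 2^|B| ‖contraction‖² = 2^d ‖product of gadgets‖² (`braket_eval_connect`).
Unitaries preserve the norms, hence d.

Minimality: if a gadget has a stabilizer q on a single bond, then the bond only carries an
eigenspace of q and one of its wires is superfluous. Suitable Clifford tensors at the two ends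
remove this wire without changing the map (`exists_isBondReduction`,
`IsLayoutReduction.contract_eq`). Local webs survive (`IsLayoutReduction.hasLocalWeb`), and d does
not grow (`IsLayoutReduction.finrank_joinedStabilizers_le`), so the missing spacetime stabilizers
can be put back inside a gadget. Induction on the number of internal legs finishes the argument. -/

noncomputable section

open scoped Classical

/-! ### Signs and amplitudes -/

/-- The sign character of `ZMod 2`. -/
def sgn (a : ZMod 2) : ℂ := (-1) ^ a.val

@[simp] theorem sgn_zero : sgn 0 = 1 := by simp [sgn]

@[simp] theorem sgn_one : sgn 1 = -1 := by simp [sgn, ZMod.val_one]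

theorem ZMod.two_cases (a : ZMod 2) : a = 0 ∨ a = 1 := by
  fin_cases a
  · exact Or.inl rfl
  · exact Or.inr rfl

theorem ZMod.two_add_self (a : ZMod 2) : a + a = 0 := CharTwo.add_self_eq_zero a

theorem sgn_add (a b : ZMod 2) : sgn (a + b) = sgn a * sgn b := by
  rcases a.two_cases with rfl | rfl <;> rcases b.two_cases with rfl | rfl <;>
    simp [ZMod.two_add_self]

theorem sgn_sum {ι : Type*} (s : Finset ι) (g : ι → ZMod 2) :
    sgn (∑ i ∈ s, g i) = ∏ i ∈ s, sgn (g i) := by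
  induction s using Finset.induction_on with
  | empty => simp
  | insert a s ha ih => rw [Finset.sum_insert ha, Finset.prod_insert ha, sgn_add, ih]

@[simp] theorem sgn_mul_self (a : ZMod 2) : sgn a * sgn a = 1 := by
  rw [← sgn_add, ZMod.two_add_self, sgn_zero]

theorem sgn_ne_zero (a : ZMod 2) : sgn a ≠ 0 := fun h => by simpa [h] using sgn_mul_self a

theorem sgn_eq_one_iff (a : ZMod 2) : sgn a = 1 ↔ a = 0 := by
  rcases a.two_cases with rfl | rfl
  · simp
  · simp only [sgn_one, one_ne_zero, iff_false]; norm_num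

/-- The two decidability instances are arbitrary, so that conditions can be exchanged without
comparing classical with derived instances. -/
theorem ite_congr_iff {α : Type*} {p q : Prop} {dp : Decidable p} {dq : Decidable q} {a b c : α}
    (h : p ↔ q) (h' : a = b) : @ite _ p dp a c = @ite _ q dq b c := by
  subst h'
  obtain rfl : p = q := propext h
  congr

theorem spiderAmplitude_congr {H H' : Type} [Fintype H] [Fintype H'] (e : H ≃ H') (c : SpiderColor)
    (k : ZMod 4) (y : H' → ZMod 2) :
    spiderAmplitude c k (fun h => y (e h)) = spiderAmplitude c k y := by
  cases c
  · simp only [spiderAmplitude]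
    congr 2
    · exact propext e.forall_congr_left |>.trans (by simp)
    · exact propext e.forall_congr_left |>.trans (by simp)
  · simp only [spiderAmplitude]
    rw [Fintype.card_congr e, Equiv.sum_comp e (fun h => (y h).val)]

/-- As a sum over the common bit `t`, a product of `Z` nodes can be expanded into a sum over bit
assignments. Without legs both values of `t` contribute, in agreement with the amplitude. -/
theorem spiderAmplitude_Z_eq_sum {H : Type} [Fintype H] (k : ZMod 4) (y : H → ZMod 2) :
    spiderAmplitude SpiderColor.Z k y =
      ∑ t : ZMod 2, if ∀ h, y h = t then Complex.I ^ (k.val * t.val) else 0 := by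
  have h2 : (Finset.univ : Finset (ZMod 2)) = {0, 1} := rfl
  rw [h2, Finset.sum_pair (by decide)]
  simp [spiderAmplitude, ZMod.val_one]

/-! ### Tensors of composite diagrams -/

namespace ZXDiagram

variable {L : Type}

/-- The edge end at an open leg. -/
def legEnd (D : ZXDiagram L) (l : L) : D.E × Bool := (D.leg_unique l).choose

theorem endpoint_eq_inr (D : ZXDiagram L) (h : D.E × Bool) (l : L) :
    D.endpoint h = Sum.inr l ↔ h = D.legEnd l :=
  ⟨(D.leg_unique l).choose_spec.2 h, fun e => e ▸ (D.leg_unique l).choose_spec.1⟩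

@[simp] theorem endpoint_legEnd (D : ZXDiagram L) (l : L) :
    D.endpoint (D.legEnd l) = Sum.inr l := (D.endpoint_eq_inr _ l).2 rfl

theorem legEnd_injective (D : ZXDiagram L) : Function.Injective D.legEnd := fun a b h => by
  have := D.endpoint_legEnd a
  rw [h, endpoint_legEnd] at this
  exact (Sum.inr.inj this).symm

theorem finite_legs (D : ZXDiagram L) : Finite L := Finite.of_injective _ D.legEnd_injective

/-- Every edge end lies at a node or is an open leg. -/
def halfEdgeEquiv (D : ZXDiagram L) : (Σ v, D.HalfEdge v) ⊕ L ≃ D.E × Bool where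
  toFun := Sum.elim (fun h => h.2.1) D.legEnd
  invFun h := match hh : D.endpoint h with
    | Sum.inl v => Sum.inl ⟨v, h, hh⟩
    | Sum.inr l => Sum.inr l
  left_inv := by
    rintro (⟨v, h, hh⟩ | l)
    · simp only [Sum.elim_inl]
      split
      · rename_i w hw
        obtain rfl : v = w := Sum.inl.inj (hh.symm.trans hw)
        rfl
      · rename_i w hw
        rw [hh] at hw; cases hw
    · simp only [Sum.elim_inr]
      split
      · rename_i w hw
        rw [endpoint_legEnd] at hw; cases hw
      · rename_i w hw
        rw [endpoint_legEnd] at hw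
        rw [Sum.inr.inj hw]
  right_inv h := by
    dsimp only
    split
    · rfl
    · rename_i l hl
      exact ((D.endpoint_eq_inr _ _).1 hl).symm

theorem sum_halfEdge (D : ZXDiagram L) [Fintype L] {M : Type*} [AddCommMonoid M]
    (g : D.E × Bool → M) :
    ∑ h, g h = (∑ v, ∑ h : D.HalfEdge v, g h.1) + ∑ l, g (D.legEnd l) := by
  rw [← Equiv.sum_comp D.halfEdgeEquiv g, Fintype.sum_sum_type, Fintype.sum_sigma]
  rfl

/-- The amplitude of a node in a labelling of the edges by bits. -/
def nodeAmp (D : ZXDiagram L) (v : D.V) (y : D.E → ZMod 2) : ℂ :=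
  spiderAmplitude (D.color v) (D.phase v) (fun h : D.HalfEdge v => y h.1.1)

theorem nodeAmp_congr {L' : Type} {D : ZXDiagram L} {D' : ZXDiagram L'} {v : D.V} {v' : D'.V}
    (e : D.HalfEdge v ≃ D'.HalfEdge v') {y : D.E → ZMod 2} {y' : D'.E → ZMod 2}
    (hc : D'.color v' = D.color v) (hp : D'.phase v' = D.phase v)
    (hy : ∀ h, y' (e h).1.1 = y h.1.1) : D'.nodeAmp v' y' = D.nodeAmp v y := by
  rw [nodeAmp, nodeAmp, hc, hp, ← spiderAmplitude_congr e]
  exact congrArg _ (funext hy)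

theorem eval_eq (D : ZXDiagram L) (x : L → ZMod 2) :
    D.eval x = ∑ y : D.E → ZMod 2, if ∀ l, y (D.legEnd l).1 = x l then
      ∏ v, D.nodeAmp v y else 0 := by
  unfold eval
  refine Finset.sum_congr rfl fun y _ => ?_
  congr 1
  simp only [endpoint_eq_inr, eq_iff_iff]
  exact ⟨fun h l => h _ l rfl, fun h a l e => e ▸ h l⟩

theorem eval_of_iso {D D' : ZXDiagram L} (h : D.Iso D') : D'.eval = D.eval := by
  obtain ⟨eV, eE, fl, hc, hp, he⟩ := h
  funext x
  have key : ∀ h : D.E × Bool, D'.endpoint (eE h.1, xor h.2 (fl h.1)) =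
      Sum.map eV id (D.endpoint h) := fun h => he h.1 h.2
  let eH : D.E × Bool ≃ D'.E × Bool :=
    { toFun := fun h => (eE h.1, xor h.2 (fl h.1))
      invFun := fun h => (eE.symm h.1, xor h.2 (fl (eE.symm h.1)))
      left_inv := fun h => by simp
      right_inv := fun h => by simp }
  have hleg : ∀ l, D'.legEnd l = eH (D.legEnd l) := fun l => by
    refine ((D'.endpoint_eq_inr _ _).1 ?_).symm
    change D'.endpoint (eE (D.legEnd l).1, _) = _
    rw [key, endpoint_legEnd]; rfl
  rw [eval_eq, eval_eq, ← Equiv.sum_comp (Equiv.arrowCongr eE.symm (Equiv.refl (ZMod 2))).symm]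
  refine Finset.sum_congr rfl fun y _ => ?_
  have hy : ∀ e, (Equiv.arrowCongr eE.symm (Equiv.refl (ZMod 2))).symm y (eE e) = y e := by
    intro e; simp [Equiv.arrowCongr]
  generalize (Equiv.arrowCongr eE.symm (Equiv.refl (ZMod 2))).symm y = y' at *
  have h1 : (∀ l, y' (D'.legEnd l).1 = x l) ↔ ∀ l, y (D.legEnd l).1 = x l := by
    refine forall_congr' fun l => ?_
    rw [hleg, ← hy]; rfl
  rw [if_congr h1 _ rfl]
  rw [← Equiv.prod_comp eV]
  refine Finset.prod_congr rfl fun v _ => ?_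
  let e : D.HalfEdge v ≃ D'.HalfEdge (eV v) := eH.subtypeEquiv fun h => by
    change _ ↔ D'.endpoint (eE h.1, _) = _
    rw [key]
    cases D.endpoint h <;> simp
  exact nodeAmp_congr e (hc v) (hp v) fun h => hy _

theorem SameMap.refl (D : ZXDiagram L) : D.SameMap D := ⟨1, one_ne_zero, by simp⟩

theorem SameMap.symm {D D' : ZXDiagram L} (h : D.SameMap D') : D'.SameMap D := by
  obtain ⟨c, hc, h⟩ := h
  exact ⟨c⁻¹, inv_ne_zero hc, by rw [h, smul_smul, inv_mul_cancel₀ hc, one_smul]⟩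

theorem SameMap.trans {D D' D'' : ZXDiagram L} (h : D.SameMap D') (h' : D'.SameMap D'') :
    D.SameMap D'' := by
  obtain ⟨c, hc, h⟩ := h
  obtain ⟨c', hc', h'⟩ := h'
  exact ⟨c' * c, mul_ne_zero hc' hc, by rw [h', h, smul_smul]⟩

/-- Bits on all legs before a wiring, from bits on the open legs and on the joined pairs. -/
def _root_.Wiring.spread {A B β : Type} (f : Wiring A L B) (x : L → β) (b : B → β) : A → β :=
  fun a => Sum.elim x b (f.toFun a)

theorem connect_endpoint_inl {A B : Type} [Fintype B] (D : ZXDiagram A) (f : Wiring A L B)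
    (h : D.E × Bool) (v : D.V) :
    (D.connect f).endpoint h = Sum.inl (Sum.inl v) ↔ D.endpoint h = Sum.inl v := by
  change (match D.endpoint h with
    | Sum.inl v => Sum.inl (Sum.inl v)
    | Sum.inr a => match f.toFun a with
      | Sum.inl l => Sum.inr l
      | Sum.inr b => Sum.inl (Sum.inr b)) = _ ↔ _
  split
  · rename_i h1; simp [h1]
  · rename_i a h1; split <;> simp [h1]

theorem connect_endpoint_inr {A B : Type} [Fintype B] (D : ZXDiagram A) (f : Wiring A L B)
    (h : D.E × Bool) (b : B) :
    (D.connect f).endpoint h = Sum.inl (Sum.inr b) ↔ ∃ a, f.toFun a = Sum.inr b ∧ h = D.legEnd a := by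
  change (match D.endpoint h with
    | Sum.inl v => Sum.inl (Sum.inl v)
    | Sum.inr a => match f.toFun a with
      | Sum.inl l => Sum.inr l
      | Sum.inr b => Sum.inl (Sum.inr b)) = _ ↔ _
  simp only [← endpoint_eq_inr]
  split
  · rename_i h1; simp [h1]
  · rename_i a h1; split <;> rename_i h2
    · simp only [h1, reduceCtorEq, false_iff, not_exists, not_and, Sum.inr.injEq]
      rintro a' h3 rfl
      rw [h2] at h3; cases h3
    · simp only [h1, Sum.inl.injEq, Sum.inr.injEq]
      constructor
      · rintro rfl; exact ⟨a, h2, rfl⟩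
      · rintro ⟨a', h3, rfl⟩
        rw [h2] at h3; exact Sum.inr.inj h3

theorem connect_legEnd {A B : Type} [Fintype B] (D : ZXDiagram A) (f : Wiring A L B)
    {l : L} {a : A} (h : f.toFun a = Sum.inl l) :
    (D.connect f).legEnd l = D.legEnd a := by
  refine (((D.connect f).endpoint_eq_inr _ _).1 ?_).symm
  change (match D.endpoint (D.legEnd a) with
    | Sum.inl v => Sum.inl (Sum.inl v)
    | Sum.inr a => match f.toFun a with
      | Sum.inl l => Sum.inr l
      | Sum.inr b => Sum.inl (Sum.inr b)) = Sum.inr l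
  simp [h]

/-- The half edges at a node of the original diagram. -/
def connectHalfEdge {A B : Type} [Fintype B] (D : ZXDiagram A) (f : Wiring A L B) (v : D.V) :
    D.HalfEdge v ≃ (D.connect f).HalfEdge (Sum.inl v) :=
  (Equiv.refl (D.E × Bool)).subtypeEquiv fun h => (D.connect_endpoint_inl f h v).symm

/-- The phaseless node of each joined pair is a sum over its common bit. Multiplied out, these nodes
give a sum over bits `b` on all pairs, and for fixed `b` the constraints on open and joined legs
together say that the legs carry `f.spread x b`. -/
theorem eval_connect {A B : Type} [Fintype B] (D : ZXDiagram A) (f : Wiring A L B)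
    (x : L → ZMod 2) :
    (D.connect f).eval x = ∑ b : B → ZMod 2, D.eval (f.spread x b) := by
  simp only [eval_eq]
  rw [Finset.sum_comm]
  refine Finset.sum_congr rfl fun (y : D.E → ZMod 2) _ => ?_
  have h1 : ∏ v : (D.connect f).V, (D.connect f).nodeAmp v y = (∏ v : D.V, D.nodeAmp v y) *
      ∑ b : B → ZMod 2, if ∀ a j, f.toFun a = Sum.inr j → y (D.legEnd a).1 = b j then 1 else 0 := by
    refine (Fintype.prod_sum_type _).trans ?_
    congr 1
    · refine Finset.prod_congr rfl fun v _ => ?_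
      exact nodeAmp_congr (D.connectHalfEdge f v) rfl rfl fun _ => rfl
    · have : ∀ j : B, (D.connect f).nodeAmp (Sum.inr j) y =
          ∑ t : ZMod 2, if ∀ a, f.toFun a = Sum.inr j → y (D.legEnd a).1 = t then 1 else 0 := by
        intro j
        refine (spiderAmplitude_Z_eq_sum 0 _).trans ?_
        refine Finset.sum_congr rfl fun t _ => ?_
        simp only [ZMod.val_zero, zero_mul, pow_zero]
        refine if_congr ?_ rfl rfl
        constructor
        · intro h a ha
          exact h ⟨D.legEnd a, (D.connect_endpoint_inr f _ _).2 ⟨a, ha, rfl⟩⟩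
        · rintro h ⟨h', hh⟩
          obtain ⟨a, ha, rfl⟩ := (D.connect_endpoint_inr f _ _).1 hh
          exact h a ha
      rw [Finset.prod_congr rfl fun j _ => this j, Finset.prod_univ_sum]
      simp only [Fintype.piFinset_univ]
      refine Finset.sum_congr rfl fun b _ => ?_
      rw [Finset.prod_ite_zero]
      simp only [Finset.mem_univ, true_implies, Finset.prod_const_one]
      exact if_congr ⟨fun h a j => h j a, fun h j a => h a j⟩ rfl rfl
  have h2 : ∀ b : B → ZMod 2, (∀ a, y (D.legEnd a).1 = f.spread x b a) ↔
      (∀ l, y ((D.connect f).legEnd l).1 = x l) ∧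
      ∀ a j, f.toFun a = Sum.inr j → y (D.legEnd a).1 = b j := by
    intro b
    constructor
    · intro h
      refine ⟨fun l => ?_, fun a j ha => ?_⟩
      · obtain ⟨a, ha, -⟩ := f.open_unique l
        rw [connect_legEnd D f ha, h, Wiring.spread, ha]; rfl
      · rw [h, Wiring.spread, ha]; rfl
    · rintro ⟨h, h'⟩ a
      cases ha : f.toFun a with
      | inl l => rw [Wiring.spread, ha, Sum.elim_inl, ← h, connect_legEnd D f ha]
      | inr j => rw [Wiring.spread, ha, Sum.elim_inr, h' a j ha]
  simp only [h2]
  by_cases hx : ∀ l, y ((D.connect f).legEnd l).1 = x l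
  · rw [if_pos hx, h1, Finset.mul_sum]
    simp [hx]
  · rw [if_neg hx]
    simp [hx]

theorem _root_.Sum.map_eq_inl_iff {α α' β β' : Type*} {f : α → α'} {g : β → β'} {o : α ⊕ β}
    {a : α'} : Sum.map f g o = Sum.inl a ↔ ∃ a', o = Sum.inl a' ∧ f a' = a := by
  cases o <;> simp

theorem union_endpoint_inl {A A' : Type} (D : ZXDiagram A) (D' : ZXDiagram A') (e : D.E)
    (b : Bool) : (D.union D').endpoint (Sum.inl e, b) =
      Sum.map Sum.inl Sum.inl (D.endpoint (e, b)) := rfl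

theorem union_endpoint_inr {A A' : Type} (D : ZXDiagram A) (D' : ZXDiagram A') (e : D'.E)
    (b : Bool) : (D.union D').endpoint (Sum.inr e, b) =
      Sum.map Sum.inr Sum.inr (D'.endpoint (e, b)) := rfl

theorem union_legEnd_inl {A A' : Type} (D : ZXDiagram A) (D' : ZXDiagram A') (a : A) :
    (D.union D').legEnd (Sum.inl a) = (Sum.inl (D.legEnd a).1, (D.legEnd a).2) := by
  refine (((D.union D').endpoint_eq_inr _ _).1 ?_).symm
  exact congrArg (Sum.map Sum.inl Sum.inl) (D.endpoint_legEnd a)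

theorem union_legEnd_inr {A A' : Type} (D : ZXDiagram A) (D' : ZXDiagram A') (a : A') :
    (D.union D').legEnd (Sum.inr a) = (Sum.inr (D'.legEnd a).1, (D'.legEnd a).2) := by
  refine (((D.union D').endpoint_eq_inr _ _).1 ?_).symm
  exact congrArg (Sum.map Sum.inr Sum.inr) (D'.endpoint_legEnd a)

/-- The half edges at a node of the first part of a disjoint union. -/
def unionHalfEdgeLeft {A A' : Type} (D : ZXDiagram A) (D' : ZXDiagram A') (v : D.V) :
    D.HalfEdge v ≃ (D.union D').HalfEdge (Sum.inl v) :=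
  Equiv.ofBijective (fun h => ⟨(Sum.inl h.1.1, h.1.2), by
      rw [union_endpoint_inl]; exact congrArg _ h.2⟩) <| by
    constructor
    · rintro ⟨⟨e, b⟩, h⟩ ⟨⟨e', b'⟩, h'⟩ hh
      have h1 := Sum.inl.inj (congrArg (fun h => h.1.1) hh)
      have h2 : b = b' := congrArg (fun h => h.1.2) hh
      cases h1; cases h2; rfl
    · rintro ⟨⟨e | e, b⟩, h⟩
      · obtain ⟨w, hw, hw'⟩ := Sum.map_eq_inl_iff.1 h
        cases hw'
        exact ⟨⟨(e, b), hw⟩, rfl⟩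
      · obtain ⟨w, -, hw'⟩ := Sum.map_eq_inl_iff.1 h
        cases hw'

/-- The half edges at a node of the second part of a disjoint union. -/
def unionHalfEdgeRight {A A' : Type} (D : ZXDiagram A) (D' : ZXDiagram A') (v : D'.V) :
    D'.HalfEdge v ≃ (D.union D').HalfEdge (Sum.inr v) :=
  Equiv.ofBijective (fun h => ⟨(Sum.inr h.1.1, h.1.2), by
      rw [union_endpoint_inr]; exact congrArg _ h.2⟩) <| by
    constructor
    · rintro ⟨⟨e, b⟩, h⟩ ⟨⟨e', b'⟩, h'⟩ hh
      have h1 := Sum.inr.inj (congrArg (fun h => h.1.1) hh)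
      have h2 : b = b' := congrArg (fun h => h.1.2) hh
      cases h1; cases h2; rfl
    · rintro ⟨⟨e | e, b⟩, h⟩
      · obtain ⟨w, -, hw'⟩ := Sum.map_eq_inl_iff.1 h
        cases hw'
      · obtain ⟨w, hw, hw'⟩ := Sum.map_eq_inl_iff.1 h
        cases hw'
        exact ⟨⟨(e, b), hw⟩, rfl⟩

theorem eval_union {A A' : Type} (D : ZXDiagram A) (D' : ZXDiagram A') (x : A ⊕ A' → ZMod 2) :
    (D.union D').eval x = D.eval (x ∘ Sum.inl) * D'.eval (x ∘ Sum.inr) := by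
  simp only [eval_eq]
  rw [Finset.sum_mul_sum, ← Fintype.sum_prod_type']
  refine @Fintype.sum_equiv ((D.union D').E → ZMod 2) ((D.E → ZMod 2) × (D'.E → ZMod 2)) _ _ _ _
    (Equiv.sumArrowEquivProdArrow D.E D'.E (ZMod 2)) _ _ fun (y : D.E ⊕ D'.E → ZMod 2) => ?_
  have h1 : (∀ l, y ((D.union D').legEnd l).1 = x l) ↔
      (∀ l, y (Sum.inl (D.legEnd l).1) = x (Sum.inl l)) ∧
      ∀ l, y (Sum.inr (D'.legEnd l).1) = x (Sum.inr l) := by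
    rw [Sum.forall]; simp only [union_legEnd_inl, union_legEnd_inr]
  have h2 : ∏ v : (D.union D').V, (D.union D').nodeAmp v y =
      (∏ v : D.V, D.nodeAmp v fun e => y (Sum.inl e)) *
      ∏ v : D'.V, D'.nodeAmp v fun e => y (Sum.inr e) := by
    refine (Fintype.prod_sum_type _).trans ?_
    congr 1
    · exact Finset.prod_congr rfl fun v _ =>
        nodeAmp_congr (D.unionHalfEdgeLeft D' v) rfl rfl fun _ => rfl
    · exact Finset.prod_congr rfl fun v _ =>
        nodeAmp_congr (D.unionHalfEdgeRight D' v) rfl rfl fun _ => rfl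
  change (if (∀ l, y ((D.union D').legEnd l).1 = x l) then _ else 0) =
    (if (∀ l, y (Sum.inl (D.legEnd l).1) = x (Sum.inl l)) then _ else 0) *
    (if (∀ l, y (Sum.inr (D'.legEnd l).1) = x (Sum.inr l)) then _ else 0)
  rw [ite_zero_mul_ite_zero]
  exact ite_congr_iff h1 h2

theorem sigma_legEnd {I : Type} [Fintype I] {A : I → Type} (G : ∀ i, ZXDiagram (A i)) (i : I)
    (a : A i) : (sigma G).legEnd ⟨i, a⟩ = (⟨i, ((G i).legEnd a).1⟩, ((G i).legEnd a).2) := by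
  refine (((sigma G).endpoint_eq_inr _ _).1 ?_).symm
  exact congrArg (Sum.map (Sigma.mk (β := fun i => (G i).V) i) (Sigma.mk (β := A) i))
    ((G i).endpoint_legEnd a)

theorem sigma_endpoint {I : Type} [Fintype I] {A : I → Type} (G : ∀ i, ZXDiagram (A i)) (i : I)
    (e : (G i).E) (b : Bool) : (sigma G).endpoint (⟨i, e⟩, b) =
      Sum.map (Sigma.mk i) (Sigma.mk i) ((G i).endpoint (e, b)) := rfl

/-- The half edges at a node of a member of a disjoint union. -/
def sigmaHalfEdge {I : Type} [Fintype I] {A : I → Type} (G : ∀ i, ZXDiagram (A i)) (i : I)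
    (v : (G i).V) : (G i).HalfEdge v ≃ (sigma G).HalfEdge ⟨i, v⟩ :=
  Equiv.ofBijective (fun h => ⟨(⟨i, h.1.1⟩, h.1.2), by
      rw [sigma_endpoint, h.2]; rfl⟩) <| by
    constructor
    · rintro ⟨⟨e, b⟩, h⟩ ⟨⟨e', b'⟩, h'⟩ hh
      have h1 := congrArg (fun h => h.1.1) hh
      have h2 : b = b' := congrArg (fun h => h.1.2) hh
      cases h1; cases h2; rfl
    · rintro ⟨⟨⟨j, e⟩, b⟩, h⟩
      rw [sigma_endpoint] at h
      obtain ⟨w, hw, hw'⟩ := Sum.map_eq_inl_iff.1 h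
      cases hw'
      exact ⟨⟨(e, b), hw⟩, rfl⟩

theorem eval_sigma {I : Type} [Fintype I] {A : I → Type} (G : ∀ i, ZXDiagram (A i))
    (x : (Σ i, A i) → ZMod 2) : (sigma G).eval x = ∏ i, (G i).eval fun a => x ⟨i, a⟩ := by
  simp only [eval_eq]
  rw [Finset.prod_univ_sum]
  simp only [Fintype.piFinset_univ]
  refine @Fintype.sum_equiv ((sigma G).E → ZMod 2) (∀ i, (G i).E → ZMod 2) _ _ _ _
    (Equiv.piCurry (fun i (_ : (G i).E) => ZMod 2)) _ _ fun (y : (Σ i, (G i).E) → ZMod 2) => ?_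
  have h2 : ∏ v : (sigma G).V, (sigma G).nodeAmp v y =
      ∏ i, ∏ v : (G i).V, (G i).nodeAmp v fun e => y ⟨i, e⟩ := by
    refine (Fintype.prod_sigma _).trans ?_
    exact Finset.prod_congr rfl fun i _ => Finset.prod_congr rfl fun v _ =>
        nodeAmp_congr (sigmaHalfEdge G i v) rfl rfl fun _ => rfl
  rw [Finset.prod_ite_zero]
  have h1 : ∀ i a, y ((sigma G).legEnd ⟨i, a⟩).1 = y ⟨i, ((G i).legEnd a).1⟩ := fun i a =>
    congrArg (fun h : (Σ i, (G i).E) × Bool => y h.1) (sigma_legEnd G i a)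
  refine ite_congr_iff ?_ h2
  exact ⟨fun h i _ a => (h1 i a).symm.trans (h ⟨i, a⟩),
    fun h l => (h1 l.1 l.2).trans (h l.1 (Finset.mem_univ _) l.2)⟩

end ZXDiagram

end

noncomputable section

open scoped Classical

namespace ZXDiagram

/-! ### Rewriting and equality of the linear maps -/

/-- After `eval_union` and `eval_connect` the tensor of the replaced part enters linearly, so its
scalar factors out. -/
theorem Rewrite.sameMap {L : Type} {D D' : ZXDiagram L} (h : Rewrite D D') : D.SameMap D' := by
  obtain ⟨P, P', C, f, _, _, ⟨c, hc, hP⟩, hD, hD'⟩ := h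
  refine ⟨c, hc, ?_⟩
  rw [← eval_of_iso hD, ← eval_of_iso hD']
  funext x
  simp only [Pi.smul_apply, smul_eq_mul, eval_connect, eval_union, hP, Finset.mul_sum, mul_assoc]

/-- The diagram without nodes and edges. -/
def emptyDiagram : ZXDiagram Empty where
  V := Empty
  E := Empty
  color := Empty.elim
  phase := Empty.elim
  endpoint h := h.1.elim
  leg_unique l := l.elim

/-- The wiring that joins no legs. -/
def openWiring (L : Type) : Wiring (L ⊕ Empty) L Empty where
  toFun := Sum.map id id
  open_unique l := ⟨Sum.inl l, rfl, by rintro (a | a) h <;> simp_all⟩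
  joined_pair b := b.elim

theorem iso_union_empty {L : Type} (D : ZXDiagram L) :
    D.Iso ((D.union emptyDiagram).connect (openWiring L)) := by
  refine ⟨(Equiv.sumEmpty D.V Empty).symm.trans (Equiv.sumEmpty _ Empty).symm,
    (Equiv.sumEmpty D.E Empty).symm, fun _ => false, fun _ => rfl, fun _ => rfl, fun e b => ?_⟩
  have hb : xor b false = b := by cases b <;> rfl
  rw [hb]
  cases h : D.endpoint (e, b) with
  | inl v =>
    refine (connect_endpoint_inl _ _ _ _).2 ?_
    exact congrArg (Sum.map Sum.inl Sum.inl) h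
  | inr l =>
    refine (endpoint_eq_inr _ _ _).2 ?_
    refine Eq.trans ?_ (connect_legEnd (D.union emptyDiagram) (openWiring L)
      (a := Sum.inl l) rfl).symm
    refine Eq.trans ?_ (union_legEnd_inl _ _ _).symm
    rw [← (D.endpoint_eq_inr _ _).1 h]
    rfl

/-- The rest of the diagram is taken to be empty, and the whole diagram is replaced at once. -/
theorem SameMap.rewrite {L : Type} {D D' : ZXDiagram L} (h : D.SameMap D') : Rewrite D D' :=
  .replace D D' emptyDiagram (openWiring L) D D' h (iso_union_empty D) (iso_union_empty D')

theorem zxEquiv_iff {L : Type} (D D' : ZXDiagram L) : ZXEquiv D D' ↔ D.SameMap D' := by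
  refine ⟨fun h => ?_, fun h => .single h.rewrite⟩
  induction h with
  | refl => exact SameMap.refl D
  | tail _ h ih => exact ih.trans h.sameMap

/-- One global replacement suffices, so the number of spacetime stabilizers has to be compared only
between the two ends of a chain. -/
theorem stabilizerPreservingRewrites_iff {L : Type} (D D' : ZXDiagram L) :
    StabilizerPreservingRewrites D D' ↔
      D.SameMap D' ∧ D.numSpacetimeStabilizers = D'.numSpacetimeStabilizers := by
  refine ⟨fun h => ?_, fun h => .single ⟨h.1.rewrite, h.2⟩⟩
  induction h with
  | refl => exact ⟨SameMap.refl D, rfl⟩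
  | tail _ h ih => exact ⟨ih.1.trans h.1.sameMap, ih.2.trans h.2⟩

end ZXDiagram

/-! ### The symplectic form and Pauli symmetries of tensors -/

section Symplectic

variable {A : Type} [Fintype A]

theorem pauliSymplectic_comm (p q : A → Pauli) : pauliSymplectic p q = pauliSymplectic q p :=
  Finset.sum_congr rfl fun _ _ => by ring

theorem pauliSymplectic_add_right (p q r : A → Pauli) :
    pauliSymplectic p (q + r) = pauliSymplectic p q + pauliSymplectic p r := by
  simp only [pauliSymplectic, ← Finset.sum_add_distrib]
  exact Finset.sum_congr rfl fun _ _ => by simp only [Pi.add_apply, Prod.fst_add, Prod.snd_add]; ring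

theorem pauliSymplectic_add_left (p q r : A → Pauli) :
    pauliSymplectic (p + q) r = pauliSymplectic p r + pauliSymplectic q r := by
  rw [pauliSymplectic_comm, pauliSymplectic_add_right, pauliSymplectic_comm r, pauliSymplectic_comm r]

@[simp] theorem pauliSymplectic_zero_right (p : A → Pauli) : pauliSymplectic p 0 = 0 := by
  simp [pauliSymplectic]

theorem pauliSymplectic_self (p : A → Pauli) : pauliSymplectic p p = 0 :=
  Finset.sum_eq_zero fun a _ => by rw [mul_comm (p a).2, ZMod.two_add_self]

theorem pauliSymplectic_single [DecidableEq A] (p : A → Pauli) (a : A) (r : Pauli) :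
    pauliSymplectic p (Pi.single a r) = (p a).1 * r.2 + (p a).2 * r.1 := by
  rw [pauliSymplectic, Fintype.sum_eq_single a]
  · simp
  · intro b hb; simp [Pi.single_eq_of_ne hb]

/-- The symplectic form as a linear functional of its second argument. -/
def pauliFunctional (p : A → Pauli) : (A → Pauli) →ₗ[ZMod 2] ZMod 2 where
  toFun := pauliSymplectic p
  map_add' := pauliSymplectic_add_right p
  map_smul' r q := by
    simp only [pauliSymplectic, Pi.smul_apply, Prod.smul_fst, Prod.smul_snd, smul_eq_mul,
      RingHom.id_apply, Finset.mul_sum]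
    exact Finset.sum_congr rfl fun _ _ => by ring

/-- Nondegeneracy of the symplectic form. The `X` component of `p` at a leg is read off from the
value of `f` on `Z` there, and conversely. -/
theorem exists_pauliFunctional_eq (f : (A → Pauli) →ₗ[ZMod 2] ZMod 2) :
    ∃ p, f = pauliFunctional p := by
  refine ⟨fun a => (f (Pi.single a (0, 1)), f (Pi.single a (1, 0))), ?_⟩
  refine LinearMap.pi_ext fun a r => ?_
  change _ = pauliSymplectic _ _
  have : (Pi.single a r : A → Pauli) =
      r.1 • (Pi.single a (1, 0) : A → Pauli) + r.2 • (Pi.single a (0, 1) : A → Pauli) := by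
    rw [← Pi.single_smul, ← Pi.single_smul, ← Pi.single_add]
    simp
  rw [pauliSymplectic_single, this, map_add, map_smul, map_smul, smul_eq_mul, smul_eq_mul]
  ring

/-- The action of a Pauli string on a tensor. -/
def pauliAct (p : A → Pauli) (T : (A → ZMod 2) → ℂ) : (A → ZMod 2) → ℂ :=
  fun x => sgn (∑ a, (p a).2 * x a) * T (fun a => x a + (p a).1)

/-- A Pauli string is a symmetry of a tensor if it preserves the tensor up to a scalar. -/
def IsSymm (T : (A → ZMod 2) → ℂ) (p : A → Pauli) : Prop :=
  ∃ c : ℂ, c ≠ 0 ∧ pauliAct p T = c • T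

/-- A tensor is Clifford if it is nonzero and its Pauli symmetries form a maximal isotropic
subspace. -/
def IsClifford (T : (A → ZMod 2) → ℂ) : Prop :=
  T ≠ 0 ∧ ∀ p, (∀ q, IsSymm T q → pauliSymplectic p q = 0) → IsSymm T p

theorem pauliAct_smul (p : A → Pauli) (c : ℂ) (T : (A → ZMod 2) → ℂ) :
    pauliAct p (c • T) = c • pauliAct p T := by
  funext x; simp only [pauliAct, Pi.smul_apply, smul_eq_mul]; ring

theorem pauliAct_add (p : A → Pauli) (T T' : (A → ZMod 2) → ℂ) :
    pauliAct p (T + T') = pauliAct p T + pauliAct p T' := by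
  funext x; simp only [pauliAct, Pi.add_apply]; ring

theorem pauliAct_zero (T : (A → ZMod 2) → ℂ) : pauliAct 0 T = T := by
  funext x; simp [pauliAct]

theorem pauliAct_pauliAct (p q : A → Pauli) (T : (A → ZMod 2) → ℂ) :
    pauliAct p (pauliAct q T) = sgn (∑ a, (q a).2 * (p a).1) • pauliAct (p + q) T := by
  funext x
  simp only [pauliAct, Pi.smul_apply, smul_eq_mul, ← mul_assoc, ← sgn_add]
  congr 1
  · congr 1
    simp only [← Finset.sum_add_distrib]
    exact Finset.sum_congr rfl fun _ _ => by simp only [Pi.add_apply, Prod.snd_add]; ring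
  · congr 1
    funext a
    simp only [Pi.add_apply, Prod.fst_add]; ring

theorem pauliAct_comm (p q : A → Pauli) (T : (A → ZMod 2) → ℂ) :
    pauliAct p (pauliAct q T) = sgn (pauliSymplectic p q) • pauliAct q (pauliAct p T) := by
  rw [pauliAct_pauliAct, pauliAct_pauliAct, smul_smul, ← sgn_add, add_comm q p]
  congr 2
  rw [pauliSymplectic, ← Finset.sum_add_distrib]
  refine Finset.sum_congr rfl fun a _ => ?_
  linear_combination -(ZMod.two_add_self ((p a).2 * (q a).1))

theorem IsSymm.zero (T : (A → ZMod 2) → ℂ) : IsSymm T 0 :=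
  ⟨1, one_ne_zero, by rw [pauliAct_zero, one_smul]⟩

theorem IsSymm.add {T : (A → ZMod 2) → ℂ} {p q : A → Pauli} (hp : IsSymm T p) (hq : IsSymm T q) :
    IsSymm T (p + q) := by
  obtain ⟨c, hc, hp⟩ := hp
  obtain ⟨d, hd, hq⟩ := hq
  have h := pauliAct_pauliAct p q T
  rw [hq, pauliAct_smul, hp] at h
  refine ⟨sgn (∑ a, (q a).2 * (p a).1) * d * c,
    mul_ne_zero (mul_ne_zero (sgn_ne_zero _) hd) hc, ?_⟩
  rw [mul_assoc, ← smul_smul, ← smul_smul, h, smul_smul, sgn_mul_self, one_smul]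

/-- Applying `p` and `q` in the two orders gives the same multiple of `T`, while the operators
differ by the sign of `pauliSymplectic p q`. Since `T` is nonzero, the sign is trivial. -/
theorem IsSymm.commute {T : (A → ZMod 2) → ℂ} (hT : T ≠ 0) {p q : A → Pauli} (hp : IsSymm T p)
    (hq : IsSymm T q) : pauliSymplectic p q = 0 := by
  obtain ⟨c, hc, hp⟩ := hp
  obtain ⟨d, hd, hq⟩ := hq
  have h := pauliAct_comm p q T
  rw [hq, pauliAct_smul, hp, pauliAct_smul, hq, smul_smul, smul_smul, smul_smul] at h
  obtain ⟨x, hx⟩ := Function.ne_iff.1 hT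
  have h2 := congrFun h x
  simp only [Pi.smul_apply, smul_eq_mul] at h2
  rw [← sgn_eq_one_iff]
  have h3 := mul_right_cancel₀ hx h2
  have h4 : d * c ≠ 0 := mul_ne_zero hd hc
  refine mul_right_cancel₀ h4 ?_
  linear_combination -h3

theorem IsSymm.smul {T : (A → ZMod 2) → ℂ} {p : A → Pauli} (hp : IsSymm T p) (c : ℂ) :
    IsSymm (c • T) p := by
  obtain ⟨d, hd, hp⟩ := hp
  exact ⟨d, hd, by rw [pauliAct_smul, hp, smul_comm]⟩

theorem isSymm_smul_iff {T : (A → ZMod 2) → ℂ} {p : A → Pauli} {c : ℂ} (hc : c ≠ 0) :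
    IsSymm (c • T) p ↔ IsSymm T p := by
  refine ⟨fun h => ?_, fun h => h.smul c⟩
  have := h.smul c⁻¹
  rwa [smul_smul, inv_mul_cancel₀ hc, one_smul] at this

end Symplectic

/-- The annihilator of an intersection is the sum of the annihilators, here for the range of `g` and
`C`. The functional `f ∘ g` vanishes on the kernel of the map from `V` to `F / C`, hence is pulled
back from a functional on that quotient. This is what makes maximal isotropy survive gluing. -/
theorem exists_functional_of_vanishing {V F : Type*} [AddCommGroup V] [Module (ZMod 2) V]
    [AddCommGroup F] [Module (ZMod 2) F] (g : V →ₗ[ZMod 2] F) (C : Submodule (ZMod 2) F)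
    (f : F →ₗ[ZMod 2] ZMod 2) (hf : ∀ v, g v ∈ C → f (g v) = 0) :
    ∃ f' : F →ₗ[ZMod 2] ZMod 2, (∀ u ∈ C, f' u = 0) ∧ ∀ v, f' (g v) = f (g v) := by
  have h : f.comp g ∈ LinearMap.range (C.mkQ.comp g).dualMap := by
    rw [LinearMap.range_dualMap_eq_dualAnnihilator_ker, Submodule.mem_dualAnnihilator]
    intro v hv
    exact hf v (by simpa using hv)
  obtain ⟨k, hk⟩ := h
  refine ⟨k.comp C.mkQ, fun u hu => ?_, fun v => LinearMap.congr_fun hk v⟩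
  rw [LinearMap.comp_apply, (Submodule.Quotient.mk_eq_zero C).2 hu |> fun h => (h : C.mkQ u = 0),
    map_zero]

/-- An additively closed set of vectors over `ZMod 2` is a subspace. -/
def Submodule.ofAddClosed {V : Type*} [AddCommGroup V] [Module (ZMod 2) V] (S : Set V)
    (h0 : 0 ∈ S) (hadd : ∀ a b, a ∈ S → b ∈ S → a + b ∈ S) : Submodule (ZMod 2) V where
  carrier := S
  zero_mem' := h0
  add_mem' ha hb := hadd _ _ ha hb
  smul_mem' r a ha := by
    rcases r.two_cases with rfl | rfl
    · rwa [zero_smul]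
    · rwa [one_smul]

/-! ### Stabilizers of a single node -/

/-- Exchange the roles of `X` and `Z` at an `X` node. -/
def orient : SpiderColor → Pauli ≃ₗ[ZMod 2] Pauli
  | .Z => LinearEquiv.refl _ _
  | .X => LinearEquiv.prodComm _ _ _

/-- The stabilizers of a node up to sign. -/
def SpiderCond (c : SpiderColor) (k : ZMod 4) {H : Type} [Fintype H] (u : H → Pauli) : Prop :=
  ∃ t : ZMod 2, (∀ h, (orient c (u h)).1 = t) ∧ ∑ h, (orient c (u h)).2 = t * (k.val : ZMod 2)

section Spider

variable {H : Type} [Fintype H] {c : SpiderColor} {k : ZMod 4}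

theorem SpiderCond.zero : SpiderCond c k (0 : H → Pauli) := ⟨0, by simp⟩

theorem SpiderCond.add {u u' : H → Pauli} (h : SpiderCond c k u) (h' : SpiderCond c k u') :
    SpiderCond c k (u + u') := by
  obtain ⟨t, h1, h2⟩ := h
  obtain ⟨t', h1', h2'⟩ := h'
  refine ⟨t + t', fun h => ?_, ?_⟩
  · simp [h1, h1']
  · simp [Finset.sum_add_distrib, h2, h2', add_mul]

theorem SpiderCond.congr_equiv {H' : Type} [Fintype H'] (e : H ≃ H') (u : H' → Pauli) :
    SpiderCond c k (fun h => u (e h)) ↔ SpiderCond c k u := by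
  refine exists_congr fun t => and_congr ⟨fun h a => ?_, fun h a => h _⟩ ?_
  · simpa using h (e.symm a)
  · rw [Equiv.sum_comp e (fun h => (orient c (u h)).2)]

theorem symplectic_orient (c : SpiderColor) (a b : Pauli) :
    a.1 * b.2 + a.2 * b.1 =
      (orient c a).1 * (orient c b).2 + (orient c a).2 * (orient c b).1 := by
  cases c
  · rfl
  · simp only [orient, LinearEquiv.prodComm_apply, Prod.fst_swap, Prod.snd_swap]; ring

/-- The stabilizer space of a node equals its own commutant. For a `Z` node, commuting with `Z Z` on
two legs forces equal `X` components, and commuting with the remaining generator gives the parity of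
the `Z` components; `orient` covers the `X` node. -/
theorem spiderCond_of_commute {u : H → Pauli}
    (h : ∀ t, SpiderCond c k t → pauliSymplectic u t = 0) : SpiderCond c k u := by
  have h1 : ∀ a b, (orient c (u a)).1 = (orient c (u b)).1 := by
    intro a b
    have hc : SpiderCond c k (Pi.single a ((orient c).symm (0, 1)) +
        Pi.single b ((orient c).symm (0, 1))) := by
      have hs : ∀ a h, orient c ((Pi.single a ((orient c).symm (0, 1)) : H → Pauli) h) =
          (Pi.single a (0, 1) : H → Pauli) h := by
        intro a h
        by_cases hh : h = a
        · subst hh; simp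
        · simp [Pi.single_eq_of_ne hh]
      refine ⟨0, fun h => ?_, ?_⟩
      · rw [Pi.add_apply, map_add, hs, hs, Prod.fst_add]
        by_cases ha : h = a <;> by_cases hb : h = b <;>
          simp [Pi.single_apply, ha, hb] <;> split_ifs <;> rfl
      · simp only [Pi.add_apply, map_add, hs, Prod.snd_add, Finset.sum_add_distrib]
        have : ∀ a : H, ∑ h, ((Pi.single a (0, 1) : H → Pauli) h).2 = 1 := by
          intro a
          rw [Fintype.sum_eq_single a]
          · simp
          · intro b hb; simp [Pi.single_eq_of_ne hb]
        rw [this, this, zero_mul, ZMod.two_add_self]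
    have := h _ hc
    rw [pauliSymplectic_add_right, pauliSymplectic_single, pauliSymplectic_single,
      symplectic_orient c, symplectic_orient c (u b)] at this
    simp only [LinearEquiv.apply_symm_apply, mul_one, mul_zero, add_zero] at this
    exact (CharTwo.add_eq_zero).1 this
  rcases isEmpty_or_nonempty H with hH | ⟨⟨h0⟩⟩
  · exact ⟨0, fun h => hH.elim h, by simp⟩
  refine ⟨(orient c (u h0)).1, fun a => h1 a h0, ?_⟩
  -- The remaining generator: for a `Z` node this is `X` on every leg, with an extra `Z` at `h0`
  -- exactly when the phase is odd.
  have hc : SpiderCond c k ((fun _ => (orient c).symm (1, 0)) +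
      Pi.single h0 ((orient c).symm (0, (k.val : ZMod 2)))) := by
    have hs : ∀ h, orient c ((Pi.single h0 ((orient c).symm (0, (k.val : ZMod 2))) : H → Pauli) h) =
        (Pi.single h0 (0, (k.val : ZMod 2)) : H → Pauli) h := by
      intro h
      by_cases hh : h = h0
      · subst hh; simp
      · simp [Pi.single_eq_of_ne hh]
    refine ⟨1, fun h => ?_, ?_⟩
    · rw [Pi.add_apply, map_add, hs, Prod.fst_add]
      by_cases ha : h = h0
      · subst ha; simp
      · simp [Pi.single_eq_of_ne ha]
    · simp only [Pi.add_apply, map_add, hs, Prod.snd_add, LinearEquiv.apply_symm_apply, zero_add,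
        one_mul]
      rw [Fintype.sum_eq_single h0]
      · simp
      · intro b hb; simp [Pi.single_eq_of_ne hb]
  have := h _ hc
  rw [pauliSymplectic_add_right, pauliSymplectic_single, symplectic_orient c, pauliSymplectic] at this
  simp only [symplectic_orient c, LinearEquiv.apply_symm_apply, mul_one, mul_zero, add_zero,
    zero_add] at this
  exact (CharTwo.add_eq_zero).1 this

theorem I_pow_val_sq (k : ZMod 4) :
    sgn (k.val : ZMod 2) * (Complex.I ^ k.val * Complex.I ^ k.val) = 1 := by
  have h : ∀ n : ℕ, n < 4 → sgn (n : ZMod 2) * (Complex.I ^ n * Complex.I ^ n) = 1 := by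
    intro n hn
    interval_cases n
    · simp
    · simp
    · have : ((2 : ℕ) : ZMod 2) = 0 := rfl
      rw [this]; simp
    · have : ((3 : ℕ) : ZMod 2) = 1 := rfl
      rw [this, sgn_one, ← pow_add]; norm_num
      rw [show (6 : ℕ) = 2 * 3 from rfl, pow_mul, Complex.I_sq]; norm_num
  exact h _ (ZMod.val_lt k)

theorem neg_one_pow_sum_val (y : H → ZMod 2) : (-1 : ℂ) ^ (∑ h, (y h).val) = sgn (∑ h, y h) := by
  rw [sgn_sum, ← Finset.prod_pow_eq_pow_sum]; rfl

/-- For a `Z` node, `X` on every leg exchanges the all-zero and the all-one value, whose amplitudes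
are 1 and i^k. The first branch is multiplied by i^k and the second by i^(-k); the `Z` components
correct the second by (-1)^k = i^(2k), so both factors agree. For an `X` node the same happens with
the two characters in its amplitude. -/
theorem SpiderCond.isSymm {u : H → Pauli} (hu : SpiderCond c k u) :
    IsSymm (spiderAmplitude c k) u := by
  obtain ⟨t, h1, h2⟩ := hu
  cases c with
  | Z =>
    have h1' : ∀ h, (u h).1 = t := h1
    have h2' : ∑ h, (u h).2 = t * (k.val : ZMod 2) := h2
    rcases isEmpty_or_nonempty H with hH | ⟨⟨h0⟩⟩
    · obtain rfl : u = 0 := Subsingleton.elim _ _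
      exact IsSymm.zero _
    have hsum : ∀ y : H → ZMod 2, (∀ h, y h = 1) → ∑ a, (u a).2 * y a = t * (k.val : ZMod 2) := by
      intro y hy
      rw [← h2']; exact Finset.sum_congr rfl fun a _ => by rw [hy, mul_one]
    have hsum0 : ∀ y : H → ZMod 2, (∀ h, y h = 0) → ∑ a, (u a).2 * y a = 0 := by
      intro y hy
      exact Finset.sum_eq_zero fun a _ => by rw [hy, mul_zero]
    have hn : ∀ y : H → ZMod 2, (∀ h, y h = 0) → ¬ ∀ h, y h = 1 := fun y hy hy' => by
      have := hy h0; rw [hy' h0] at this; exact one_ne_zero this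
    have hn' : ∀ y : H → ZMod 2, (∀ h, y h = 1) → ¬ ∀ h, y h = 0 := fun y hy hy' => by
      have := hy' h0; rw [hy h0] at this; exact one_ne_zero this
    have e1 : ∀ a : ZMod 2, a + 1 = 0 ↔ a = 1 := by decide
    rcases t.two_cases with rfl | rfl
    · refine ⟨1, one_ne_zero, funext fun y => ?_⟩
      simp only [pauliAct, spiderAmplitude, h1', add_zero, one_smul]
      by_cases hy : ∀ h, y h = 0
      · simp [hsum0 y hy]
      · by_cases hy' : ∀ h, y h = 1
        · simp [hsum y hy']
        · simp [hy, hy']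
    · refine ⟨Complex.I ^ k.val, pow_ne_zero _ Complex.I_ne_zero, funext fun y => ?_⟩
      simp only [pauliAct, spiderAmplitude, h1', e1, add_eq_right, Pi.smul_apply, smul_eq_mul]
      by_cases hy : ∀ h, y h = 0
      · simp only [if_neg (hn y hy), if_pos hy, hsum0 y hy]; simp
      · by_cases hy' : ∀ h, y h = 1
        · simp only [if_pos hy', if_neg (hn' y hy'), hsum y hy', one_mul, zero_add, add_zero,
            mul_one]
          have hk := I_pow_val_sq k
          have hs := sgn_mul_self (k.val : ZMod 2)
          linear_combination (Complex.I ^ k.val * Complex.I ^ k.val) * hs -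
            sgn (k.val : ZMod 2) * hk
        · simp [hy, hy']
  | X =>
    have h1' : ∀ h, (u h).2 = t := h1
    have h2' : ∑ h, (u h).1 = t * (k.val : ZMod 2) := h2
    refine ⟨if t = 0 then 1 else sgn (k.val : ZMod 2) * Complex.I ^ k.val, ?_, funext fun y => ?_⟩
    · split_ifs
      · exact one_ne_zero
      · exact mul_ne_zero (sgn_ne_zero _) (pow_ne_zero _ Complex.I_ne_zero)
    · simp only [pauliAct, spiderAmplitude, neg_one_pow_sum_val, h1', Finset.sum_add_distrib, h2',
        ← Finset.mul_sum, Pi.smul_apply, smul_eq_mul]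
      rcases t.two_cases with rfl | rfl
      · simp
      · simp only [one_mul, sgn_add, one_ne_zero, if_false]
        have hk := I_pow_val_sq k
        have hs := sgn_mul_self (∑ a, y a)
        linear_combination ((√2 : ℝ) : ℂ)⁻¹ ^ Fintype.card H * (Complex.I ^ k.val *
          sgn (k.val : ZMod 2) * hs - sgn (∑ a, y a) * hk)

end Spider

end

noncomputable section

open scoped Classical

namespace ZXDiagram

variable {L : Type}

/-! ### Pauli webs and symmetries of the tensor of a diagram -/

/-- The local condition at a node for a labelling of the edge ends by Pauli operators. -/
def NodeWeb (D : ZXDiagram L) (v : D.V) (u : D.E × Bool → Pauli) : Prop :=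
  SpiderCond (D.color v) (D.phase v) fun h : D.HalfEdge v => u h.1

theorem isPauliWeb_iff (D : ZXDiagram L) (w : D.E → Pauli) :
    D.IsPauliWeb w ↔ ∀ v, D.NodeWeb v fun h => w h.1 := by
  refine forall_congr' fun v => ?_
  unfold NodeWeb
  cases D.color v <;> rfl

theorem nodeWeb_congr {L' : Type} {D : ZXDiagram L} {D' : ZXDiagram L'} {v : D.V} {v' : D'.V}
    (e : D.HalfEdge v ≃ D'.HalfEdge v') {u : D.E × Bool → Pauli} {u' : D'.E × Bool → Pauli}
    (hc : D'.color v' = D.color v) (hp : D'.phase v' = D.phase v)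
    (hy : ∀ h, u' (e h).1 = u h.1) : D'.NodeWeb v' u' ↔ D.NodeWeb v u := by
  unfold NodeWeb
  rw [hc, hp, ← SpiderCond.congr_equiv e]
  simp only [hy]

theorem isStabilizer_iff (D : ZXDiagram L) (p : L → Pauli) :
    D.IsStabilizer p ↔ ∃ w, D.IsPauliWeb w ∧ ∀ l, w (D.legEnd l).1 = p l := by
  refine exists_congr fun w => and_congr Iff.rfl ?_
  simp only [endpoint_eq_inr]
  exact ⟨fun h l => h _ l rfl, fun h a l e => e ▸ h l⟩

theorem mem_spacetimeStabilizers (D : ZXDiagram L) (w : D.E → Pauli) :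
    w ∈ D.spacetimeStabilizers ↔ D.IsPauliWeb w ∧ ∀ l, w (D.legEnd l).1 = 0 := by
  refine and_congr Iff.rfl ?_
  simp only [endpoint_eq_inr]
  exact ⟨fun h l => h _ l rfl, fun h a l e => e ▸ h l⟩

theorem IsPauliWeb.add {D : ZXDiagram L} {w w' : D.E → Pauli} (h : D.IsPauliWeb w)
    (h' : D.IsPauliWeb w') : D.IsPauliWeb (w + w') := by
  rw [isPauliWeb_iff] at *
  exact fun v => (h v).add (h' v)

theorem IsPauliWeb.zero (D : ZXDiagram L) : D.IsPauliWeb 0 :=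
  (D.isPauliWeb_iff 0).2 fun _ => SpiderCond.zero

theorem IsStabilizer.add {D : ZXDiagram L} {p p' : L → Pauli} (h : D.IsStabilizer p)
    (h' : D.IsStabilizer p') : D.IsStabilizer (p + p') := by
  rw [isStabilizer_iff] at *
  obtain ⟨w, h1, h2⟩ := h
  obtain ⟨w', h1', h2'⟩ := h'
  exact ⟨w + w', h1.add h1', fun l => by simp [h2, h2']⟩

theorem IsStabilizer.zero (D : ZXDiagram L) : D.IsStabilizer 0 :=
  (D.isStabilizer_iff 0).2 ⟨0, IsPauliWeb.zero D, fun _ => rfl⟩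

/-- Shift the summation over edge labels by the `X` components of the web and use the symmetry of
every node. The eigenvalue is the product of those of the nodes. -/
theorem IsPauliWeb.isSymm [Fintype L] {D : ZXDiagram L} {w : D.E → Pauli} (hw : D.IsPauliWeb w) :
    IsSymm D.eval fun l => w (D.legEnd l).1 := by
  have h1 : ∀ v, ∃ c : ℂ, c ≠ 0 ∧ ∀ y : D.E → ZMod 2,
      sgn (∑ h : D.HalfEdge v, (w h.1.1).2 * y h.1.1) * D.nodeAmp v (fun e => y e + (w e).1) =
        c * D.nodeAmp v y := by
    intro v
    obtain ⟨c, hc, h⟩ := ((D.isPauliWeb_iff w).1 hw v).isSymm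
    exact ⟨c, hc, fun y => congrFun h fun h => y h.1.1⟩
  choose c hc hv using h1
  refine ⟨∏ v, c v, Finset.prod_ne_zero_iff.2 fun v _ => hc v, funext fun x => ?_⟩
  rw [Pi.smul_apply, smul_eq_mul, pauliAct, eval_eq, eval_eq, Finset.mul_sum, Finset.mul_sum]
  rw [← Equiv.sum_comp (Equiv.addRight fun e => (w e).1)]
  refine Finset.sum_congr rfl fun y _ => ?_
  simp only [Equiv.coe_addRight, Pi.add_apply, add_left_inj]
  split_ifs with hx
  -- Each edge has two ends with the same label, so the signs over all edge ends multiply to 1.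
  -- Hence the sign on the legs is the product of the signs at the nodes.
  · have key : sgn (∑ l, (w (D.legEnd l).1).2 * x l) =
        ∏ v, sgn (∑ h : D.HalfEdge v, (w h.1.1).2 * y h.1.1) := by
      rw [← sgn_sum]
      congr 1
      have h2 := D.sum_halfEdge fun h => (w h.1).2 * y h.1
      rw [Fintype.sum_prod_type] at h2
      simp only [Fintype.sum_bool, ZMod.two_add_self, Finset.sum_const_zero, hx] at h2
      exact ((CharTwo.add_eq_zero).1 h2.symm).symm
    rw [key, ← Finset.prod_mul_distrib, ← Finset.prod_mul_distrib]
    exact Finset.prod_congr rfl fun v _ => hv v y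
  · simp

/-- Labellings of the edge ends that satisfy the condition at every node. -/
def nodeWebs (D : ZXDiagram L) : Submodule (ZMod 2) (D.E × Bool → Pauli) :=
  Submodule.ofAddClosed {u | ∀ v, D.NodeWeb v u} (fun _ => SpiderCond.zero)
    fun _ _ h h' v => (h v).add (h' v)

theorem nodeWeb_of_commute [Fintype L] (D : ZXDiagram L) {u : D.E × Bool → Pauli}
    (h : ∀ t ∈ D.nodeWebs, pauliSymplectic u t = 0) (v : D.V) : D.NodeWeb v u := by
  refine spiderCond_of_commute fun t ht => ?_
  let t' : D.E × Bool → Pauli := fun h => if hh : D.endpoint h = Sum.inl v then t ⟨h, hh⟩ else 0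
  have h1 : ∀ h : D.HalfEdge v, t' h.1 = t h := fun h => dif_pos h.2
  have h2 : ∀ v', v' ≠ v → ∀ h : D.HalfEdge v', t' h.1 = 0 := fun v' hv h => dif_neg fun hh =>
    hv (Sum.inl.inj (h.2.symm.trans hh))
  have h3 : ∀ l, t' (D.legEnd l) = 0 := fun l => dif_neg fun hh => by
    rw [endpoint_legEnd] at hh; cases hh
  have ht' : t' ∈ D.nodeWebs := by
    intro v'
    by_cases hv : v' = v
    · subst hv
      unfold NodeWeb
      simpa only [h1] using ht
    · unfold NodeWeb
      simp only [h2 v' hv]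
      exact SpiderCond.zero
  have := h t' ht'
  rw [pauliSymplectic, sum_halfEdge, Fintype.sum_eq_single v] at this
  · simp only [h1, h3, Prod.fst_zero, Prod.snd_zero, mul_zero, add_zero, Finset.sum_const_zero]
      at this
    exact this
  · intro v' hv
    simp [h2 v' hv]

/-- Gluing of spaces that equal their commutants. Label edge ends instead of edges: a web is a
labelling that meets all node conditions and agrees at the two ends of each edge. The string `p`,
placed at the leg ends, annihilates all labellings with both properties. So its functional splits
into one, given by `u`, that annihilates the node labellings and one that annihilates the labellings
constant on edges. Self-duality turns the first property into the node conditions for `u`, and the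
second makes `u + p'` constant on edges. -/
theorem isStabilizer_of_commute [Fintype L] (D : ZXDiagram L) {p : L → Pauli}
    (hp : ∀ q, D.IsStabilizer q → pauliSymplectic p q = 0) : D.IsStabilizer p := by
  let p' : D.E × Bool → Pauli := fun h => Sum.elim (fun _ => 0) p (D.endpoint h)
  have hp1 : ∀ v (h : D.HalfEdge v), p' h.1 = 0 := fun v h => by
    change Sum.elim _ p (D.endpoint h.1) = 0
    rw [h.2]; rfl
  have hp2 : ∀ l, p' (D.legEnd l) = p l := fun l => by
    change Sum.elim _ p (D.endpoint _) = _
    rw [endpoint_legEnd]; rfl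
  let g : (D.E → Pauli) →ₗ[ZMod 2] (D.E × Bool → Pauli) :=
    LinearMap.funLeft (ZMod 2) Pauli Prod.fst
  obtain ⟨f, hf1, hf2⟩ := exists_functional_of_vanishing g D.nodeWebs (pauliFunctional p') (by
    intro w hw
    change pauliSymplectic p' (g w) = 0
    rw [pauliSymplectic, sum_halfEdge]
    simp only [hp1, hp2, Prod.fst_zero, Prod.snd_zero, zero_mul, add_zero, Finset.sum_const_zero,
      zero_add]
    exact hp (fun l => w (D.legEnd l).1) ((D.isStabilizer_iff _).2
      ⟨w, (D.isPauliWeb_iff w).2 hw, fun _ => rfl⟩))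
  obtain ⟨u, rfl⟩ := exists_pauliFunctional_eq f
  have hu : ∀ v, D.NodeWeb v u := D.nodeWeb_of_commute hf1
  -- The node conditions leave the leg ends free, so `u` has to commute with everything there.
  have hl : ∀ l, u (D.legEnd l) = 0 := by
    have h0 : ∀ l r, Pi.single (D.legEnd l) r ∈ D.nodeWebs := by
      intro l r v
      have h2 : ∀ h : D.HalfEdge v, (Pi.single (D.legEnd l) r : D.E × Bool → Pauli) h.1 = 0 := by
        intro h
        refine Pi.single_eq_of_ne (fun e => ?_) _
        have := h.2
        rw [e, endpoint_legEnd] at this; cases this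
      unfold NodeWeb
      simp only [h2]
      exact SpiderCond.zero
    intro l
    have h1 := hf1 _ (h0 l (0, 1))
    have h2 := hf1 _ (h0 l (1, 0))
    change pauliSymplectic u _ = 0 at h1 h2
    rw [pauliSymplectic_single] at h1 h2
    exact Prod.ext (by simpa using h1) (by simpa using h2)
  have hs : ∀ e, (u + p') (e, false) = (u + p') (e, true) := by
    intro e
    have h1 : ∀ r : Pauli, ((u + p') (e, true)).1 * r.2 + ((u + p') (e, true)).2 * r.1 +
        (((u + p') (e, false)).1 * r.2 + ((u + p') (e, false)).2 * r.1) = 0 := by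
      intro r
      have h2 := hf2 (Pi.single e r)
      change pauliSymplectic u _ = pauliSymplectic p' _ at h2
      have h3 : pauliSymplectic (u + p') (g (Pi.single e r)) = 0 := by
        rw [pauliSymplectic_add_left, h2, ZMod.two_add_self]
      rw [pauliSymplectic, Fintype.sum_prod_type, Fintype.sum_eq_single e] at h3
      · rw [Fintype.sum_bool] at h3
        simpa [g] using h3
      · intro e' he
        simp [g, Pi.single_eq_of_ne he]
    have h2 := h1 (0, 1)
    have h3 := h1 (1, 0)
    simp only [mul_one, mul_zero, add_zero, zero_add] at h2 h3
    exact (Prod.ext ((CharTwo.add_eq_zero).1 h2) ((CharTwo.add_eq_zero).1 h3)).symm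
  have hw : ∀ h : D.E × Bool, (u + p') (h.1, false) = (u + p') h := by
    rintro ⟨e, b⟩
    cases b
    · rfl
    · exact hs e
  refine (D.isStabilizer_iff p).2 ⟨fun e => (u + p') (e, false), ?_, fun l => ?_⟩
  · rw [isPauliWeb_iff]
    intro v
    have := hu v
    unfold NodeWeb at this ⊢
    simpa only [hw, Pi.add_apply, hp1, add_zero] using this
  · refine (hw _).trans ?_
    rw [Pi.add_apply, hl, hp2, zero_add]

theorem IsStabilizer.isSymm [Fintype L] {D : ZXDiagram L} {p : L → Pauli}
    (h : D.IsStabilizer p) : IsSymm D.eval p := by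
  obtain ⟨w, hw, hp⟩ := (D.isStabilizer_iff p).1 h
  obtain rfl := funext hp
  exact hw.isSymm

/-- A symmetry commutes with every stabilizer because stabilizers are symmetries too; maximality
then makes it a stabilizer. For a zero tensor every string is a symmetry, hence the hypothesis. -/
theorem isStabilizer_iff_isSymm [Fintype L] {D : ZXDiagram L} (hD : D.eval ≠ 0) {p : L → Pauli} :
    D.IsStabilizer p ↔ IsSymm D.eval p :=
  ⟨fun h => h.isSymm, fun h => D.isStabilizer_of_commute fun _ hq => h.commute hD hq.isSymm⟩

theorem isClifford_eval [Fintype L] {D : ZXDiagram L} (hD : D.eval ≠ 0) : IsClifford D.eval :=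
  ⟨hD, fun _ hp => (D.isStabilizer_of_commute fun q hq => hp q hq.isSymm).isSymm⟩

/-! ### Webs of composite diagrams -/

section Connect

variable {A B : Type}

theorem spiderCond_identity_iff {H : Type} [Fintype H] (h₁ h₂ : H) (hne : h₁ ≠ h₂)
    (hH : ∀ h, h = h₁ ∨ h = h₂) (u : H → Pauli) :
    SpiderCond SpiderColor.Z 0 u ↔ ∃ r, ∀ h, u h = r := by
  have huniv : (Finset.univ : Finset H) = {h₁, h₂} := by
    ext h; simpa using hH h
  constructor
  · rintro ⟨t, h1, h2⟩
    rw [huniv, Finset.sum_pair hne] at h2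
    have h3 : (u h₁).2 = (u h₂).2 := (CharTwo.add_eq_zero).1 (by simpa [orient] using h2)
    have h4 : ∀ h, (u h).1 = t := h1
    refine ⟨u h₁, fun h => ?_⟩
    rcases hH h with rfl | rfl
    · rfl
    · exact Prod.ext ((h4 _).trans (h4 _).symm) h3.symm
  · rintro ⟨r, hr⟩
    refine ⟨r.1, fun h => by simp [orient, hr], ?_⟩
    rw [huniv, Finset.sum_pair hne]
    simp [orient, hr, ZMod.two_add_self]

theorem isPauliWeb_connect [Fintype B] (D : ZXDiagram A) (f : Wiring A L B) (w : D.E → Pauli) :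
    (D.connect f).IsPauliWeb w ↔
      D.IsPauliWeb w ∧ ∃ β : B → Pauli, ∀ a b, f.toFun a = Sum.inr b → w (D.legEnd a).1 = β b := by
  rw [isPauliWeb_iff D]
  refine (isPauliWeb_iff (D.connect f) w).trans ?_
  refine (Sum.forall (p := fun v : D.V ⊕ B => (D.connect f).NodeWeb v fun h => w h.1)).trans
    (and_congr (forall_congr' fun v => ?_) ?_)
  · exact nodeWeb_congr (D.connectHalfEdge f v) rfl rfl fun _ => rfl
  · rw [← Classical.skolem (p := fun b r => ∀ a, f.toFun a = Sum.inr b → w (D.legEnd a).1 = r)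
      |>.trans (exists_congr fun β => forall_comm)]
    refine forall_congr' fun b => ?_
    obtain ⟨a, a', hne, hb⟩ := f.joined_pair b
    have ha := (hb a).2 (Or.inl rfl)
    have ha' := (hb a').2 (Or.inr rfl)
    refine (spiderCond_identity_iff (H := (D.connect f).HalfEdge (Sum.inr b))
      ⟨D.legEnd a, (D.connect_endpoint_inr f _ _).2 ⟨a, ha, rfl⟩⟩
      ⟨D.legEnd a', (D.connect_endpoint_inr f _ _).2 ⟨a', ha', rfl⟩⟩ ?_ ?_ _).trans
      (exists_congr fun r => ?_)
    · intro h
      exact hne (D.legEnd_injective (congrArg Subtype.val h))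
    · rintro ⟨h, hh⟩
      obtain ⟨c, hc, rfl⟩ := (D.connect_endpoint_inr f _ _).1 hh
      rcases (hb c).1 hc with rfl | rfl
      · exact Or.inl rfl
      · exact Or.inr rfl
    · constructor
      · intro h c hc
        exact h ⟨D.legEnd c, (D.connect_endpoint_inr f _ _).2 ⟨c, hc, rfl⟩⟩
      · rintro h ⟨h', hh⟩
        obtain ⟨c, hc, rfl⟩ := (D.connect_endpoint_inr f _ _).1 hh
        exact h c hc

theorem isPauliWeb_connect_legs [Fintype B] (D : ZXDiagram A) (f : Wiring A L B) (w : D.E → Pauli)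
    (p : L → Pauli) :
    ((D.connect f).IsPauliWeb w ∧ ∀ l, w ((D.connect f).legEnd l).1 = p l) ↔
      D.IsPauliWeb w ∧ ∃ β : B → Pauli, ∀ a, w (D.legEnd a).1 = f.spread p β a := by
  rw [isPauliWeb_connect, and_assoc, ← exists_and_right]
  refine and_congr Iff.rfl (exists_congr fun β => ?_)
  constructor
  · rintro ⟨h, h'⟩ a
    cases ha : f.toFun a with
    | inl l => rw [Wiring.spread, ha, Sum.elim_inl, ← h', connect_legEnd D f ha]
    | inr j => rw [Wiring.spread, ha, Sum.elim_inr, h a j ha]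
  · intro h
    refine ⟨fun a j ha => ?_, fun l => ?_⟩
    · rw [h, Wiring.spread, ha]; rfl
    · obtain ⟨a, ha, -⟩ := f.open_unique l
      rw [connect_legEnd D f ha, h, Wiring.spread, ha]; rfl

theorem isStabilizer_connect [Fintype B] (D : ZXDiagram A) (f : Wiring A L B) (p : L → Pauli) :
    (D.connect f).IsStabilizer p ↔ ∃ β : B → Pauli, D.IsStabilizer (f.spread p β) := by
  simp only [isStabilizer_iff]
  rw [exists_comm]
  refine exists_congr fun (w : D.E → Pauli) => ?_
  rw [isPauliWeb_connect_legs D f w p, exists_and_left]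

/-- The Pauli strings on the joined legs that extend to a stabilizer trivial on the open legs. -/
def joinedStabilizers (D : ZXDiagram A) (f : Wiring A L B) : Submodule (ZMod 2) (B → Pauli) :=
  Submodule.ofAddClosed {β | D.IsStabilizer (f.spread 0 β)}
    (by
      have : f.spread (0 : L → Pauli) 0 = 0 := by
        funext a; rw [Wiring.spread]; cases f.toFun a <;> rfl
      rw [Set.mem_ofPred_eq, this]
      exact IsStabilizer.zero D)
    fun β β' h h' => by
      have : f.spread (0 : L → Pauli) (β + β') = f.spread 0 β + f.spread 0 β' := by
        funext a; rw [Pi.add_apply]; simp only [Wiring.spread]; cases f.toFun a <;> simp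
      rw [Set.mem_ofPred_eq, this]
      exact h.add h'

theorem mem_joinedStabilizers (D : ZXDiagram A) (f : Wiring A L B) (β : B → Pauli) :
    β ∈ D.joinedStabilizers f ↔ D.IsStabilizer (f.spread 0 β) := Iff.rfl

theorem mem_spacetimeStabilizers_connect [Fintype B] (D : ZXDiagram A) (f : Wiring A L B) (w : D.E → Pauli) :
    w ∈ (D.connect f).spacetimeStabilizers ↔
      D.IsPauliWeb w ∧ ∃ β : B → Pauli, ∀ a, w (D.legEnd a).1 = f.spread 0 β a := by
  rw [← isPauliWeb_connect_legs]
  exact mem_spacetimeStabilizers _ _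

/-- Rank-nullity for the restriction of closed webs to the joined legs. The kernel consists of the
webs closed already before joining, and the range is `joinedStabilizers`. -/
theorem numSpacetimeStabilizers_connect [Fintype B] (D : ZXDiagram A) (f : Wiring A L B) :
    (D.connect f).numSpacetimeStabilizers =
      D.numSpacetimeStabilizers + Module.finrank (ZMod 2) (D.joinedStabilizers f) := by
  choose a a' _ ha using f.joined_pair
  have ha1 : ∀ b, f.toFun (a b) = Sum.inr b := fun b => (ha b _).2 (Or.inl rfl)
  let S : Submodule (ZMod 2) (D.E → Pauli) := (D.connect f).spacetimeStabilizers
  have hS : ∀ w, w ∈ S ↔ D.IsPauliWeb w ∧ ∃ β : B → Pauli,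
      ∀ a, w (D.legEnd a).1 = f.spread 0 β a := mem_spacetimeStabilizers_connect D f
  let φ : S →ₗ[ZMod 2] (B → Pauli) :=
    (LinearMap.funLeft (ZMod 2) Pauli fun b => (D.legEnd (a b)).1).comp S.subtype
  have hφ : ∀ (w : S) β, (∀ a, w.1 (D.legEnd a).1 = f.spread 0 β a) → φ w = β := by
    intro w β h
    funext b
    change w.1 (D.legEnd (a b)).1 = β b
    rw [h, Wiring.spread, ha1]; rfl
  have hrange : LinearMap.range φ = D.joinedStabilizers f := by
    ext β
    rw [LinearMap.mem_range, mem_joinedStabilizers, isStabilizer_iff]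
    constructor
    · rintro ⟨w, rfl⟩
      obtain ⟨h1, β, h2⟩ := (hS w.1).1 w.2
      rw [hφ w β h2]
      exact ⟨w.1, h1, h2⟩
    · rintro ⟨w, h1, h2⟩
      exact ⟨⟨w, (hS w).2 ⟨h1, β, h2⟩⟩, hφ ⟨w, _⟩ β h2⟩
  have hker : (LinearMap.ker φ).map S.subtype = D.spacetimeStabilizers := by
    ext w
    rw [mem_spacetimeStabilizers, Submodule.mem_map]
    have h0 : ∀ a, f.spread (0 : L → Pauli) (0 : B → Pauli) a = 0 := by
      intro a; rw [Wiring.spread]; cases f.toFun a <;> rfl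
    constructor
    · rintro ⟨w, hw, rfl⟩
      obtain ⟨h1, β, h2⟩ := (hS w.1).1 w.2
      have h3 : φ w = 0 := hw
      rw [hφ w β h2] at h3
      subst h3
      exact ⟨h1, fun l => (h2 l).trans (h0 l)⟩
    · rintro ⟨h1, h2⟩
      have h3 : ∀ a, w (D.legEnd a).1 = f.spread 0 0 a := fun a => (h2 a).trans (h0 a).symm
      exact ⟨⟨w, (hS w).2 ⟨h1, 0, h3⟩⟩, hφ ⟨w, _⟩ 0 h3, rfl⟩
  have h := LinearMap.finrank_range_add_finrank_ker φ
  have hk : Module.finrank (ZMod 2) (LinearMap.ker φ) = D.numSpacetimeStabilizers := by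
    rw [numSpacetimeStabilizers, ← hker]
    exact (LinearEquiv.finrank_eq
      (Submodule.equivMapOfInjective S.subtype S.injective_subtype (LinearMap.ker φ)))
  rw [hrange, hk] at h
  rw [add_comm] at h
  exact h.symm

end Connect

section Sigma

variable {I : Type} [Fintype I] {A : I → Type} (G : ∀ i, ZXDiagram (A i))

theorem isPauliWeb_sigma (w : (Σ i, (G i).E) → Pauli) :
    (sigma G).IsPauliWeb w ↔ ∀ i, (G i).IsPauliWeb fun e => w ⟨i, e⟩ := by
  refine (isPauliWeb_iff (sigma G) w).trans ?_
  refine (Sigma.forall (p := fun v : Σ i, (G i).V => (sigma G).NodeWeb v fun h => w h.1)).trans ?_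
  refine forall_congr' fun i => ?_
  rw [isPauliWeb_iff (G i)]
  exact forall_congr' fun v => nodeWeb_congr (sigmaHalfEdge G i v) rfl rfl fun _ => rfl

theorem isPauliWeb_sigma_legs (w : (Σ i, (G i).E) → Pauli) (p : (Σ i, A i) → Pauli) :
    ((sigma G).IsPauliWeb w ∧ ∀ l, w ((sigma G).legEnd l).1 = p l) ↔
      ∀ i, (G i).IsPauliWeb (fun e => w ⟨i, e⟩) ∧
        ∀ a, w ⟨i, ((G i).legEnd a).1⟩ = p ⟨i, a⟩ := by
  have h1 : ∀ i a, w ((sigma G).legEnd ⟨i, a⟩).1 = w ⟨i, ((G i).legEnd a).1⟩ := fun i a =>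
    congrArg (fun h : (Σ i, (G i).E) × Bool => w h.1) (sigma_legEnd G i a)
  rw [isPauliWeb_sigma, forall_and]
  exact and_congr Iff.rfl ⟨fun h i a => (h1 i a).symm.trans (h ⟨i, a⟩),
    fun h l => (h1 l.1 l.2).trans (h l.1 l.2)⟩

theorem isStabilizer_sigma (p : (Σ i, A i) → Pauli) :
    (sigma G).IsStabilizer p ↔ ∀ i, (G i).IsStabilizer fun a => p ⟨i, a⟩ := by
  simp only [isStabilizer_iff]
  constructor
  · rintro ⟨w, hw⟩ i
    exact ⟨_, (isPauliWeb_sigma_legs G w p).1 hw i⟩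
  · intro h
    choose w hw using h
    exact ⟨fun e : Σ i, (G i).E => w e.1 e.2, (isPauliWeb_sigma_legs G _ p).2 hw⟩

theorem numSpacetimeStabilizers_sigma :
    (sigma G).numSpacetimeStabilizers = ∑ i, (G i).numSpacetimeStabilizers := by
  have h : ∀ w : (Σ i, (G i).E) → Pauli, w ∈ (sigma G).spacetimeStabilizers ↔
      ∀ i, (fun e => w ⟨i, e⟩) ∈ (G i).spacetimeStabilizers := by
    intro w
    refine (mem_spacetimeStabilizers (sigma G) w).trans ?_
    simp only [mem_spacetimeStabilizers]
    exact isPauliWeb_sigma_legs G w 0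
  unfold numSpacetimeStabilizers
  rw [← Module.finrank_pi_fintype]
  let φ : (sigma G).spacetimeStabilizers ≃ₗ[ZMod 2] ∀ i, (G i).spacetimeStabilizers :=
    { toFun := fun w i => ⟨fun e => w.1 ⟨i, e⟩, (h w.1).1 w.2 i⟩
      map_add' := fun _ _ => rfl
      map_smul' := fun _ _ => rfl
      invFun := fun w => ⟨fun e : Σ i, (G i).E => (w e.1).1 e.2, (h _).2 fun i => (w i).2⟩
      left_inv := fun _ => rfl
      right_inv := fun _ => rfl }
  exact φ.finrank_eq

end Sigma

theorem isStabilizer_union {A A' : Type} (D : ZXDiagram A) (D' : ZXDiagram A')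
    (p : A ⊕ A' → Pauli) : (D.union D').IsStabilizer p ↔
      D.IsStabilizer (p ∘ Sum.inl) ∧ D'.IsStabilizer (p ∘ Sum.inr) := by
  have h : ∀ w : D.E ⊕ D'.E → Pauli, ((D.union D').IsPauliWeb w ∧
      ∀ l, w ((D.union D').legEnd l).1 = p l) ↔
      (D.IsPauliWeb (w ∘ Sum.inl) ∧ ∀ l, (w ∘ Sum.inl) (D.legEnd l).1 = (p ∘ Sum.inl) l) ∧
      (D'.IsPauliWeb (w ∘ Sum.inr) ∧ ∀ l, (w ∘ Sum.inr) (D'.legEnd l).1 = (p ∘ Sum.inr) l) := by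
    intro w
    have h1 : (D.union D').IsPauliWeb w ↔
        D.IsPauliWeb (w ∘ Sum.inl) ∧ D'.IsPauliWeb (w ∘ Sum.inr) := by
      refine (isPauliWeb_iff (D.union D') w).trans ?_
      refine (Sum.forall (p := fun v : D.V ⊕ D'.V => (D.union D').NodeWeb v fun h => w h.1)).trans ?_
      rw [isPauliWeb_iff D, isPauliWeb_iff D']
      exact and_congr
        (forall_congr' fun v => nodeWeb_congr (D.unionHalfEdgeLeft D' v) rfl rfl fun _ => rfl)
        (forall_congr' fun v => nodeWeb_congr (D.unionHalfEdgeRight D' v) rfl rfl fun _ => rfl)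
    have h2 : ∀ a, w ((D.union D').legEnd (Sum.inl a)).1 = w (Sum.inl (D.legEnd a).1) := fun a =>
      congrArg (fun h : (D.E ⊕ D'.E) × Bool => w h.1) (union_legEnd_inl D D' a)
    have h3 : ∀ a, w ((D.union D').legEnd (Sum.inr a)).1 = w (Sum.inr (D'.legEnd a).1) := fun a =>
      congrArg (fun h : (D.E ⊕ D'.E) × Bool => w h.1) (union_legEnd_inr D D' a)
    rw [h1, Sum.forall, and_and_and_comm]
    simp only [h2, h3]
    rfl
  simp only [isStabilizer_iff]
  constructor
  · rintro ⟨w, hw⟩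
    exact ⟨⟨_, ((h w).1 hw).1⟩, ⟨_, ((h w).1 hw).2⟩⟩
  · rintro ⟨⟨w, hw⟩, ⟨w', hw'⟩⟩
    exact ⟨(Sum.elim w w' : D.E ⊕ D'.E → Pauli), (h (Sum.elim w w')).2 ⟨hw, hw'⟩⟩

end ZXDiagram

end

noncomputable section

open scoped Classical

/-! ### The norm of a contraction -/

/-- The Hermitian inner product of two tensors. -/
def braket {A : Type} [Fintype A] (T T' : (A → ZMod 2) → ℂ) : ℂ :=
  ∑ x, (starRingEnd ℂ) (T x) * T' x

section Braket

variable {A : Type} [Fintype A]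

theorem braket_smul_left (c : ℂ) (T T' : (A → ZMod 2) → ℂ) :
    braket (c • T) T' = (starRingEnd ℂ) c * braket T T' := by
  simp only [braket, Pi.smul_apply, smul_eq_mul, map_mul, Finset.mul_sum, mul_assoc]

theorem braket_smul_right (c : ℂ) (T T' : (A → ZMod 2) → ℂ) :
    braket T (c • T') = c * braket T T' := by
  simp only [braket, Pi.smul_apply, smul_eq_mul, Finset.mul_sum]
  exact Finset.sum_congr rfl fun _ _ => by ring

theorem braket_self_ne_zero {T : (A → ZMod 2) → ℂ} (hT : T ≠ 0) : braket T T ≠ 0 := by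
  have h : braket T T = ((∑ x, Complex.normSq (T x) : ℝ) : ℂ) := by
    rw [braket, Complex.ofReal_sum]
    exact Finset.sum_congr rfl fun x _ => by rw [mul_comm, Complex.mul_conj]
  rw [h, Complex.ofReal_ne_zero]
  obtain ⟨x, hx⟩ := Function.ne_iff.1 hT
  refine ne_of_gt (Finset.sum_pos' (fun x _ => Complex.normSq_nonneg _)
    ⟨x, Finset.mem_univ _, Complex.normSq_pos.2 hx⟩)

theorem conj_sgn (a : ZMod 2) : (starRingEnd ℂ) (sgn a) = sgn a := by
  rcases a.two_cases with rfl | rfl <;> simp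

theorem braket_pauliAct (p : A → Pauli) (T T' : (A → ZMod 2) → ℂ) :
    braket (pauliAct p T) (pauliAct p T') = braket T T' := by
  unfold braket
  rw [← Equiv.sum_comp (Equiv.addRight fun a => (p a).1) fun x => (starRingEnd ℂ) (T x) * T' x]
  refine Finset.sum_congr rfl fun x _ => ?_
  simp only [pauliAct, map_mul, conj_sgn, Equiv.coe_addRight]
  have := sgn_mul_self (∑ a, (p a).2 * x a)
  change _ = (starRingEnd ℂ) (T fun a => x a + (p a).1) * T' fun a => x a + (p a).1
  linear_combination ((starRingEnd ℂ) (T fun a => x a + (p a).1) * T' fun a => x a + (p a).1) * this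

/-- By maximality some symmetry `r` anticommutes with `q`. Inserting the unitary `r` on both sides
of the inner product changes its sign without changing its value. -/
theorem IsClifford.braket_eq_zero {T : (A → ZMod 2) → ℂ} (hT : IsClifford T) {q : A → Pauli}
    (hq : ¬ IsSymm T q) : braket T (pauliAct q T) = 0 := by
  obtain ⟨r, hr, hqr⟩ : ∃ r, IsSymm T r ∧ pauliSymplectic q r ≠ 0 := by
    by_contra! h
    exact hq (hT.2 q h)
  obtain ⟨c, hc, hr⟩ := hr
  -- Pauli strings preserve the norm, so the eigenvalue `c` has modulus 1.
  have h1 : (starRingEnd ℂ) c * c = 1 := by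
    have := braket_pauliAct r T T
    rw [hr, braket_smul_left, braket_smul_right, ← mul_assoc] at this
    exact mul_right_cancel₀ (braket_self_ne_zero hT.1) (by rw [this, one_mul])
  have h2 := braket_pauliAct r T (pauliAct q T)
  rw [pauliAct_comm, hr, pauliAct_smul, braket_smul_left, braket_smul_right, braket_smul_right,
    pauliSymplectic_comm, (ZMod.two_cases _).resolve_left hqr, sgn_one] at h2
  linear_combination (-1 / 2 : ℂ) * h2 - (1 / 2 : ℂ) * braket T (pauliAct q T) * h1

end Braket

/-! ### Bits spread along a wiring -/

namespace Wiring

variable {A L B : Type} (f : Wiring A L B)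

theorem spread_injective {β : Type} :
    Function.Injective fun xb : (L → β) × (B → β) => f.spread xb.1 xb.2 := by
  rintro ⟨x, b⟩ ⟨x', b'⟩ h
  have h' : ∀ a, Sum.elim x b (f.toFun a) = Sum.elim x' b' (f.toFun a) := congrFun h
  refine Prod.ext (funext fun l => ?_) (funext fun j => ?_)
  · obtain ⟨a, ha, -⟩ := f.open_unique l
    simpa [ha] using h' a
  · obtain ⟨a, a', -, ha⟩ := f.joined_pair j
    simpa [(ha a).2 (Or.inl rfl)] using h' a

theorem mem_range_spread {β : Type} (y : A → β) :
    (∃ x b, f.spread x b = y) ↔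
      ∀ j a a', f.toFun a = Sum.inr j → f.toFun a' = Sum.inr j → y a = y a' := by
  constructor
  · rintro ⟨x, b, rfl⟩ j a a' h h'
    simp [spread, h, h']
  · intro h
    choose o ho using f.open_unique
    choose a a' _ ha using f.joined_pair
    refine ⟨fun l => y (o l), fun j => y (a j), funext fun c => ?_⟩
    cases hc : f.toFun c with
    | inl l => simp only [spread, hc, Sum.elim_inl]; rw [(ho l).2 c hc]
    | inr j =>
      simp only [spread, hc, Sum.elim_inr]
      exact h j _ _ ((ha j _).2 (Or.inl rfl)) hc

theorem sum_spread [Fintype A] [Fintype B] {a a' : B → A} (hne : ∀ b, a b ≠ a' b)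
    (ha : ∀ b c, f.toFun c = Sum.inr b ↔ c = a b ∨ c = a' b) (y : A → ZMod 2) (ζ : B → ZMod 2) :
    ∑ c, f.spread 0 ζ c * y c = ∑ b, ζ b * (y (a b) + y (a' b)) := by
  have h1 : ∀ c, f.spread 0 ζ c * y c = ∑ b, if f.toFun c = Sum.inr b then ζ b * y c else 0 := by
    intro c
    cases hc : f.toFun c with
    | inl l => simp [spread, hc]
    | inr j => simp [spread, hc]
  simp only [h1]
  rw [Finset.sum_comm]
  refine Finset.sum_congr rfl fun b _ => ?_
  rw [← Finset.sum_filter]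
  have : (Finset.univ.filter fun c => f.toFun c = Sum.inr b) = {a b, a' b} := by
    ext c; simp [ha]
  rw [this, Finset.sum_pair (hne b), mul_add]

end Wiring

theorem sum_sgn_mul {B : Type} [Fintype B] (s : B → ZMod 2) :
    ∑ ζ : B → ZMod 2, sgn (∑ b, ζ b * s b) =
      if ∀ b, s b = 0 then (2 : ℂ) ^ Fintype.card B else 0 := by
  have h2 : (Finset.univ : Finset (ZMod 2)) = {0, 1} := rfl
  have h : ∀ b, ∑ t : ZMod 2, sgn (t * s b) = if s b = 0 then (2 : ℂ) else 0 := by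
    intro b
    rw [h2, Finset.sum_pair (by decide)]
    rcases (s b).two_cases with h | h <;> simp [h]
    norm_num
  simp only [sgn_sum]
  rw [← Fintype.piFinset_univ, ← Finset.prod_univ_sum (fun _ => Finset.univ) fun b t => sgn (t * s b)]
  simp only [h]
  rw [Finset.prod_ite_zero]
  simp [Finset.card_univ]

namespace ZXDiagram

variable {A L B : Type} [Fintype A] [Fintype L] [Fintype B]

/-- On one joined pair, the sum of P ⊗ P over the four Pauli operators is 2 |Φ⟩⟨Φ| with Φ = |00⟩ +
|11⟩. The sum over `Z` components forces equal bits at the two ends, with a factor 2 per pair, and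
the sum over `X` components makes the bits of the two copies of `T` independent. -/
theorem sum_braket_pauliAct (f : Wiring A L B) (T : (A → ZMod 2) → ℂ) :
    ∑ β : B → Pauli, braket T (pauliAct (f.spread 0 β) T) =
      2 ^ Fintype.card B * braket (fun x => ∑ b, T (f.spread x b)) (fun x => ∑ b, T (f.spread x b)) := by
  choose a a' hne ha using f.joined_pair
  have e1 : ∀ (β : B → Pauli) c, (f.spread (0 : L → Pauli) β c).1 =
      f.spread 0 (fun b => (β b).1) c := by
    intro β c; simp only [Wiring.spread]; cases f.toFun c <;> rfl
  have e2 : ∀ (β : B → Pauli) c, (f.spread (0 : L → Pauli) β c).2 =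
      f.spread 0 (fun b => (β b).2) c := by
    intro β c; simp only [Wiring.spread]; cases f.toFun c <;> rfl
  have step1 : ∑ β : B → Pauli, braket T (pauliAct (f.spread 0 β) T) =
      ∑ α : B → ZMod 2, ∑ ζ : B → ZMod 2, ∑ y, (starRingEnd ℂ) (T y) *
        (sgn (∑ b, ζ b * (y (a b) + y (a' b))) * T (y + f.spread 0 α)) := by
    rw [← Fintype.sum_prod_type']
    refine Fintype.sum_equiv (Equiv.arrowProdEquivProdArrow B (fun _ => ZMod 2) fun _ => ZMod 2) _ _
      fun β => ?_
    refine Finset.sum_congr rfl fun y _ => ?_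
    simp only [pauliAct, e1, e2, f.sum_spread hne ha]
    rfl
  have step2 : ∀ α : B → ZMod 2, ∑ ζ : B → ZMod 2, ∑ y, (starRingEnd ℂ) (T y) *
        (sgn (∑ b, ζ b * (y (a b) + y (a' b))) * T (y + f.spread 0 α)) =
      ∑ y, if ∀ b, y (a b) + y (a' b) = 0 then
        (2 : ℂ) ^ Fintype.card B * ((starRingEnd ℂ) (T y) * T (y + f.spread 0 α)) else 0 := by
    intro α
    rw [Finset.sum_comm]
    refine Finset.sum_congr rfl fun y _ => ?_
    rw [← Finset.mul_sum, ← Finset.sum_mul, sum_sgn_mul]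
    split_ifs
    · ring
    · simp
  have step3 : ∀ α : B → ZMod 2, (∑ y, if ∀ b, y (a b) + y (a' b) = 0 then
        (2 : ℂ) ^ Fintype.card B * ((starRingEnd ℂ) (T y) * T (y + f.spread 0 α)) else 0) =
      ∑ x : L → ZMod 2, ∑ b : B → ZMod 2, (2 : ℂ) ^ Fintype.card B *
        ((starRingEnd ℂ) (T (f.spread x b)) * T (f.spread x (b + α))) := by
    intro α
    rw [← Fintype.sum_prod_type']
    symm
    refine Fintype.sum_of_injective _ f.spread_injective _ _ ?_ ?_
    · intro y hy
      rw [if_neg]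
      intro h
      refine hy ?_
      obtain ⟨x, b, hxb⟩ := (f.mem_range_spread y).2 (by
        intro j c c' hc hc'
        have h1 := (CharTwo.add_eq_zero).1 (h j)
        rcases (ha j c).1 hc with rfl | rfl <;> rcases (ha j c').1 hc' with rfl | rfl
        · rfl
        · exact h1
        · exact h1.symm
        · rfl)
      exact ⟨(x, b), hxb⟩
    · rintro ⟨x, b⟩
      have h1 : ∀ j, f.spread x b (a j) + f.spread x b (a' j) = 0 := by
        intro j
        rw [(f.mem_range_spread _).1 ⟨x, b, rfl⟩ j (a j) (a' j) ((ha j _).2 (Or.inl rfl))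
          ((ha j _).2 (Or.inr rfl)), ZMod.two_add_self]
      have h2 : f.spread x (b + α) = f.spread x b + f.spread 0 α := by
        funext c; rw [Pi.add_apply]; simp only [Wiring.spread]; cases f.toFun c <;> simp
      simp only [h1, implies_true, if_true, h2]
  rw [step1]
  simp only [step2, step3]
  rw [Finset.sum_comm, braket, Finset.mul_sum]
  refine Finset.sum_congr rfl fun x _ => ?_
  rw [Finset.sum_comm, map_sum, Finset.sum_mul, Finset.mul_sum]
  refine Finset.sum_congr rfl fun b _ => ?_
  rw [← Finset.mul_sum, ← Finset.mul_sum]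
  congr 2
  exact Equiv.sum_comp (Equiv.addLeft b) fun b' => T (f.spread x b')

/-- In the sum of `sum_braket_pauliAct` every bond string outside `joinedStabilizers` contributes 0,
by `IsClifford.braket_eq_zero`, and every string inside contributes the full norm. The dimension of
`joinedStabilizers` is thus encoded in two norms. -/
theorem braket_eval_connect (D : ZXDiagram A) (f : Wiring A L B) (hD : (D.connect f).eval ≠ 0) :
    2 ^ Fintype.card B * braket (D.connect f).eval (D.connect f).eval =
      2 ^ Module.finrank (ZMod 2) (D.joinedStabilizers f) * braket D.eval D.eval := by
  have hD0 : D.eval ≠ 0 := by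
    intro h
    refine hD (funext fun x => ?_)
    simp [eval_connect, h]
  have hc : (D.connect f).eval = fun x => ∑ b, D.eval (f.spread x b) := funext (eval_connect D f)
  have key : ∀ β : B → Pauli, braket D.eval (pauliAct (f.spread 0 β) D.eval) =
      if β ∈ D.joinedStabilizers f then braket D.eval D.eval else 0 := by
    intro β
    rw [mem_joinedStabilizers, isStabilizer_iff_isSymm hD0]
    split_ifs with h
    · obtain ⟨c, -, h⟩ := h
      -- The string acts by the same Pauli operator on both ends of each pair, which fixes the Bell
      -- pair. So `c` times the contraction equals the contraction, and the latter is nonzero.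
      have h1 : c = 1 := by
        obtain ⟨x, hx⟩ := Function.ne_iff.1 hD
        refine mul_right_cancel₀ hx ?_
        rw [one_mul, hc, Finset.mul_sum]
        have h2 : ∀ b, c * D.eval (f.spread x b) = D.eval (f.spread x (b + fun j => (β j).1)) := by
          intro b
          have h3 := congrFun h (f.spread x b)
          rw [Pi.smul_apply, smul_eq_mul] at h3
          rw [← h3, pauliAct]
          obtain ⟨a, ha⟩ := Classical.axiomOfChoice f.joined_pair
          obtain ⟨a', ha'⟩ := Classical.axiomOfChoice ha
          have h4 : ∑ c, (f.spread (0 : L → Pauli) β c).2 * f.spread x b c = 0 := by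
            have e2 : ∀ c, (f.spread (0 : L → Pauli) β c).2 =
                f.spread 0 (fun b => (β b).2) c := by
              intro c; simp only [Wiring.spread]; cases f.toFun c <;> rfl
            simp only [e2]
            rw [f.sum_spread (fun b => (ha' b).1) (fun b => (ha' b).2)]
            refine Finset.sum_eq_zero fun j _ => ?_
            rw [(f.mem_range_spread _).1 ⟨x, b, rfl⟩ j (a j) (a' j)
              (((ha' j).2 _).2 (Or.inl rfl)) (((ha' j).2 _).2 (Or.inr rfl)), ZMod.two_add_self,
              mul_zero]
          rw [h4, sgn_zero, one_mul]
          congr 1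
          funext c
          simp only [Wiring.spread]; cases f.toFun c <;> simp
        simp only [h2]
        exact Equiv.sum_comp (Equiv.addRight fun j => (β j).1) fun b => D.eval (f.spread x b)
      rw [h, h1, one_smul]
    · exact (isClifford_eval hD0).braket_eq_zero h
  rw [hc, ← sum_braket_pauliAct]
  simp only [key]
  rw [← Finset.sum_filter, Finset.sum_const, nsmul_eq_mul]
  congr 1
  have : (Finset.univ.filter fun β => β ∈ D.joinedStabilizers f).card =
      2 ^ Module.finrank (ZMod 2) (D.joinedStabilizers f) := by
    rw [← Fintype.card_subtype]
    have := Module.card_eq_pow_finrank (K := ZMod 2) (V := D.joinedStabilizers f)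
    rw [ZMod.card] at this
    rw [← this]
  rw [this]
  push_cast
  rfl

end ZXDiagram

end

noncomputable section

open scoped Classical

/-! ### Normal form of Clifford tensors -/

section NormalForm

variable {A : Type} [Fintype A]

/-- The space of Pauli symmetries of a tensor. -/
def symmSpace (T : (A → ZMod 2) → ℂ) : Submodule (ZMod 2) (A → Pauli) :=
  Submodule.ofAddClosed {p | IsSymm T p} (IsSymm.zero T) fun _ _ h h' => h.add h'

theorem exists_dot_of_notMem {X : Submodule (ZMod 2) (A → ZMod 2)} {v : A → ZMod 2} (hv : v ∉ X) :
    ∃ z : A → ZMod 2, (∀ x ∈ X, ∑ a, z a * x a = 0) ∧ ∑ a, z a * v a ≠ 0 := by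
  obtain ⟨f, hf, hX⟩ := Submodule.exists_le_ker_of_notMem hv
  have h : ∀ x, f x = ∑ a, f (Pi.single a 1) * x a := by
    intro x
    conv_lhs => rw [← Finset.univ_sum_single x]
    rw [map_sum]
    refine Finset.sum_congr rfl fun a _ => ?_
    have : Pi.single a (x a) = x a • (Pi.single a 1 : A → ZMod 2) := by
      rw [← Pi.single_smul, smul_eq_mul, mul_one]
    rw [this, map_smul, smul_eq_mul, mul_comm]
  exact ⟨fun a => f (Pi.single a 1), fun x hx => (h x).symm.trans (hX hx), fun e => hf ((h v).trans e)⟩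

/-- The `u k` form a basis of the `X` parts of the symmetries, and each lifts to a symmetry that
relates the values of `T` at points differing by `u k`. Applying such a symmetry twice gives a sign,
so its eigenvalue is a fourth root of unity. -/
theorem IsClifford.exists_shifts {T : (A → ZMod 2) → ℂ} (hT : IsClifford T) :
    ∃ (r : ℕ) (u z : Fin r → A → ZMod 2) (c : Fin r → ℂ) (x₀ : A → ZMod 2),
      LinearIndependent (ZMod 2) u ∧ T x₀ ≠ 0 ∧ (∀ k, c k ^ 4 = 1) ∧
      (∀ k y, T (y + u k) = c k * sgn (∑ a, z k a * y a) * T y) ∧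
      ∀ x, T x ≠ 0 → ∃ t : Fin r → ZMod 2, x = x₀ + ∑ k, t k • u k := by
  let π : (A → Pauli) →ₗ[ZMod 2] (A → ZMod 2) := (LinearMap.fst (ZMod 2) (ZMod 2) (ZMod 2)).compLeft A
  let X : Submodule (ZMod 2) (A → ZMod 2) := (symmSpace T).map π
  let b := Module.finBasis (ZMod 2) X
  have hlift : ∀ k, ∃ p, IsSymm T p ∧ π p = b k := fun k => by
    obtain ⟨p, hp, h⟩ := Submodule.mem_map.1 (b k).2
    exact ⟨p, hp, h⟩
  choose p hp hpb using hlift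
  choose c hc hcp using hp
  obtain ⟨x₀, hx₀⟩ := Function.ne_iff.1 hT.1
  refine ⟨_, fun k => (b k : A → ZMod 2), fun k a => (p k a).2, fun k => c k, x₀,
    b.linearIndependent.map' X.subtype X.ker_subtype, hx₀, fun k => ?_, fun k y => ?_, fun x hx => ?_⟩
  · have h := pauliAct_pauliAct (p k) (p k) T
    rw [hcp, pauliAct_smul, hcp, smul_smul] at h
    have h0 : p k + p k = 0 := funext fun a =>
      Prod.ext (ZMod.two_add_self _) (ZMod.two_add_self _)
    rw [h0, pauliAct_zero] at h
    have h1 := mul_right_cancel₀ hx₀ (congrFun h x₀)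
    have h2 := sgn_mul_self (∑ a, (p k a).2 * (p k a).1)
    rw [← h1] at h2
    linear_combination h2
  · have h := congrFun (hcp k) y
    have h1 : (fun a => y a + (p k a).1) = y + b k := by rw [← hpb k]; rfl
    rw [pauliAct, h1, Pi.smul_apply, smul_eq_mul] at h
    have h2 := sgn_mul_self (∑ a, (p k a).2 * y a)
    linear_combination sgn (∑ a, (p k a).2 * y a) * h - T (y + b k) * h2
  · have hX : x - x₀ ∈ X := by
      by_contra hX
      -- A `Z` string orthogonal to all `X` parts commutes with every symmetry, hence is itself a
      -- symmetry. Its sign is constant on the support of `T`, which confines the support to one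
      -- coset of `X`.
      obtain ⟨z, hz, hne⟩ := exists_dot_of_notMem hX
      obtain ⟨d, -, hd⟩ := hT.2 (fun a => (0, z a)) fun q hq => by
        rw [pauliSymplectic]
        simp only [zero_mul, zero_add]
        exact hz (π q) (Submodule.mem_map_of_mem hq)
      have h : ∀ y, T y ≠ 0 → sgn (∑ a, z a * y a) = d := by
        intro y hy
        have := congrFun hd y
        simp only [pauliAct, add_zero] at this
        exact mul_right_cancel₀ hy this
      have h3 := (h x hx).trans (h x₀ hx₀).symm
      apply hne
      rw [← sgn_eq_one_iff]
      simp only [Pi.sub_apply, CharTwo.sub_eq_add, mul_add, Finset.sum_add_distrib, sgn_add]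
      rw [h3, sgn_mul_self]
    refine ⟨fun k => b.repr ⟨_, hX⟩ k, ?_⟩
    have h := congrArg Subtype.val (b.sum_repr ⟨_, hX⟩)
    simp only [Submodule.coe_sum, Submodule.coe_smul] at h
    rw [h]; abel

/-- The shifts are applied one at a time. The sign picked up by shift `j` depends on the shifts `i <
j` made before, which produces the quadratic part of the exponent. -/
theorem shift_formula {T : (A → ZMod 2) → ℂ} (x₀ : A → ZMod 2) : ∀ {r : ℕ}
    (u z : Fin r → A → ZMod 2) (c : Fin r → ℂ)
    (_ : ∀ k y, T (y + u k) = c k * sgn (∑ a, z k a * y a) * T y) (t : Fin r → ZMod 2),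
    T (x₀ + ∑ k, t k • u k) = T x₀ * (∏ k, (c k * sgn (∑ a, z k a * x₀ a)) ^ (t k).val) *
      ∏ i, ∏ j, if i < j then sgn (t i * t j * ∑ a, z j a * u i a) else 1
  | 0, _, _, _, _, _ => by simp
  | r + 1, u, z, c, h, t => by
    have ih := shift_formula x₀ (fun k => u k.castSucc) (fun k => z k.castSucc)
      (fun k => c k.castSucc) (fun k => h _) (fun k => t k.castSucc)
    rw [Fin.sum_univ_castSucc, ← add_assoc]
    simp only [Fin.prod_univ_castSucc, Fin.castSucc_lt_castSucc_iff, Fin.castSucc_lt_last, if_true,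
      lt_irrefl, if_false, mul_one, (Fin.castSucc_lt_last _).not_gt, Finset.prod_const_one,
      Finset.prod_mul_distrib]
    rcases (t (Fin.last r)).two_cases with h0 | h1
    · simp only [h0, zero_smul, add_zero, ZMod.val_zero, pow_zero, mul_one, mul_zero, zero_mul,
        sgn_zero, Finset.prod_const_one, ih]
    · rw [h1, one_smul, h, ih]
      have h2 : sgn (∑ a, z (Fin.last r) a * (x₀ + ∑ k : Fin r, t k.castSucc • u k.castSucc) a) =
          sgn (∑ a, z (Fin.last r) a * x₀ a) *
          ∏ i : Fin r, sgn (t i.castSucc * 1 * ∑ a, z (Fin.last r) a * u i.castSucc a) := by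
        rw [← sgn_sum, ← sgn_add]
        congr 1
        simp only [Pi.add_apply, mul_add, Finset.sum_add_distrib, Finset.sum_apply, Pi.smul_apply,
          smul_eq_mul, Finset.mul_sum, mul_one]
        congr 1
        rw [Finset.sum_comm]
        exact Finset.sum_congr rfl fun i _ => Finset.sum_congr rfl fun a _ => by ring
      rw [h2, ZMod.val_one, pow_one]
      ring

theorem exists_I_pow {c : ℂ} (h : c ^ 4 = 1) : ∃ n : ZMod 4, c = Complex.I ^ n.val := by
  have h1 : (c - 1) * (c + 1) * ((c - Complex.I) * (c + Complex.I)) = 0 := by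
    linear_combination h + (1 - c ^ 2) * Complex.I_sq
  rcases mul_eq_zero.1 h1 with h1 | h1 <;> rcases mul_eq_zero.1 h1 with h1 | h1
  · exact ⟨0, by rw [sub_eq_zero.1 h1]; simp⟩
  · refine ⟨2, ?_⟩
    rw [show (2 : ZMod 4).val = 2 from rfl, Complex.I_sq]; linear_combination h1
  · refine ⟨1, ?_⟩
    rw [show (1 : ZMod 4).val = 1 from rfl, pow_one]; linear_combination h1
  · refine ⟨3, ?_⟩
    rw [show (3 : ZMod 4).val = 3 from rfl, pow_succ, Complex.I_sq]; linear_combination h1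

end NormalForm

/-! ### Bipartite diagrams -/

section Bipartite

theorem sum_univ_eq_single {α M : Type*} [AddCommMonoid M] {_ : Fintype α} (a : α) {f : α → M}
    (h : ∀ b, b ≠ a → f b = 0) : ∑ y, f y = f a := Fintype.sum_eq_single a h

theorem sum_univ_ite_eq {α M : Type*} [AddCommMonoid M] {i : Fintype α} (a : α)
    {d : ∀ y, Decidable (y = a)} (m : M) : (∑ y : α, @ite _ (y = a) (d y) m 0) = m := by
  rw [Fintype.sum_eq_single a fun y hy => if_neg hy, if_pos rfl]

variable {K M L : Type} [Fintype K] [Fintype M] [Fintype L]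

/-- The diagram with `Z` nodes `K` and `X` nodes `M`, with an edge between related nodes, and with
the open legs at the given `X` nodes. -/
def bipartite (φ : K → ZMod 4) (ψ : M → ZMod 4) (N : K → M → Prop) (leg : L → M) : ZXDiagram L where
  V := K ⊕ M
  E := {e : K × M // N e.1 e.2} ⊕ L
  color := Sum.elim (fun _ => .Z) fun _ => .X
  phase := Sum.elim φ ψ
  endpoint
    | (Sum.inl e, false) => Sum.inl (Sum.inl e.1.1)
    | (Sum.inl e, true) => Sum.inl (Sum.inr e.1.2)
    | (Sum.inr l, false) => Sum.inl (Sum.inr (leg l))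
    | (Sum.inr l, true) => Sum.inr l
  leg_unique l := ⟨(Sum.inr l, true), rfl, by
    rintro ⟨e | l', _ | _⟩ h
    · cases h
    · cases h
    · cases h
    · cases h; rfl⟩

variable (φ : K → ZMod 4) (ψ : M → ZMod 4) (N : K → M → Prop) (leg : L → M)

theorem bipartite_legEnd (l : L) : (bipartite φ ψ N leg).legEnd l = (Sum.inr l, true) :=
  (((bipartite φ ψ N leg).endpoint_eq_inr _ _).1 rfl).symm

/-- The edge ends at a `Z` node. -/
def bipartiteHalfEdgeZ (k : K) :
    {m // N k m} ≃ (bipartite φ ψ N leg).HalfEdge (Sum.inl k) :=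
  Equiv.ofBijective (fun m => ⟨(Sum.inl ⟨(k, m.1), m.2⟩, false), rfl⟩) <| by
    constructor
    · rintro ⟨m, hm⟩ ⟨m', hm'⟩ h
      have := Sum.inl.inj (congrArg (fun h => h.1.1) h)
      cases this; rfl
    · rintro ⟨⟨⟨⟨k', m⟩, hm⟩ | l, _ | _⟩, h⟩
      · cases h; exact ⟨⟨m, hm⟩, rfl⟩
      · cases h
      · cases h
      · cases h

/-- The edge ends at an `X` node. -/
def bipartiteHalfEdgeX (m : M) :
    {k // N k m} ⊕ {l // leg l = m} ≃ (bipartite φ ψ N leg).HalfEdge (Sum.inr m) :=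
  Equiv.ofBijective (Sum.elim (fun k => ⟨(Sum.inl ⟨(k.1, m), k.2⟩, true), rfl⟩)
      fun l => ⟨(Sum.inr l.1, false), congrArg (fun m => Sum.inl (Sum.inr m)) l.2⟩) <| by
    constructor
    · rintro (⟨k, hk⟩ | ⟨l, hl⟩) (⟨k', hk'⟩ | ⟨l', hl'⟩) h
      · have := Sum.inl.inj (congrArg (fun h => h.1.1) h)
        cases this; rfl
      · have := congrArg (fun h => h.1.1) h
        cases this
      · have := congrArg (fun h => h.1.1) h
        cases this
      · have := Sum.inr.inj (congrArg (fun h => h.1.1) h)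
        cases this; rfl
    · rintro ⟨⟨⟨⟨k, m'⟩, hm⟩ | l, _ | _⟩, h⟩
      · cases h
      · cases h; exact ⟨Sum.inl ⟨k, hm⟩, rfl⟩
      · cases h; exact ⟨Sum.inr ⟨l, rfl⟩, rfl⟩
      · cases h

/-- The sum of the bits on the edges at an `X` node. -/
def incidentSum (t : K → ZMod 2) (x : L → ZMod 2) (m : M) : ZMod 2 :=
  (∑ k, if N k m then t k else 0) + ∑ l, if leg l = m then x l else 0

/-- The `Z` nodes force one bit `t k` on all edges at `k`, and the legs carry `x`, so only the
labellings `lab t` contribute. What is left over from the `X` nodes, powers of √2, does not depend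
on `t` or `x`. -/
theorem eval_bipartite : ∃ c : ℂ, c ≠ 0 ∧ ∀ x, (bipartite φ ψ N leg).eval x =
    c * ∑ t : K → ZMod 2, (∏ k, Complex.I ^ ((φ k).val * (t k).val)) *
      ∏ m, (1 + Complex.I ^ (ψ m).val *
        sgn (incidentSum N leg t x m)) := by
  refine ⟨∏ m, ((√2 : ℝ) : ℂ)⁻¹ ^ Fintype.card ({k // N k m} ⊕ {l // leg l = m}),
    Finset.prod_ne_zero_iff.2 fun m _ => pow_ne_zero _ (inv_ne_zero (by
      rw [Complex.ofReal_ne_zero]; positivity)), fun x => ?_⟩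
  let lab : (K → ZMod 2) → {e : K × M // N e.1 e.2} ⊕ L → ZMod 2 := fun t =>
    Sum.elim (fun e => t e.1.1) x
  have hX : ∀ (t : K → ZMod 2) m, (bipartite φ ψ N leg).nodeAmp (Sum.inr m) (lab t) =
      ((√2 : ℝ) : ℂ)⁻¹ ^ Fintype.card ({k // N k m} ⊕ {l // leg l = m}) *
      (1 + Complex.I ^ (ψ m).val *
        sgn (incidentSum N leg t x m)) := by
    intro t m
    refine (spiderAmplitude_congr (bipartiteHalfEdgeX φ ψ N leg m) SpiderColor.X (ψ m) _).symm.trans ?_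
    simp only [spiderAmplitude, neg_one_pow_sum_val]
    rw [incidentSum, Fintype.sum_sum_type]
    congr 4
    congr 1
    · rw [← Finset.sum_filter, ← Finset.sum_subtype_eq_sum_filter, Finset.subtype_univ]
      rfl
    · rw [← Finset.sum_filter, ← Finset.sum_subtype_eq_sum_filter, Finset.subtype_univ]
      rfl
  have hZ : ∀ y : {e : K × M // N e.1 e.2} ⊕ L → ZMod 2,
      ∏ k, (bipartite φ ψ N leg).nodeAmp (Sum.inl k) y =
      ∑ t : K → ZMod 2, if ∀ e : {e : K × M // N e.1 e.2}, y (Sum.inl e) = t e.1.1 then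
        ∏ k, Complex.I ^ ((φ k).val * (t k).val) else 0 := by
    intro y
    have h1 : ∀ k, (bipartite φ ψ N leg).nodeAmp (Sum.inl k) y = ∑ s : ZMod 2,
        if ∀ m : {m // N k m}, y (Sum.inl ⟨(k, m.1), m.2⟩) = s then
          Complex.I ^ ((φ k).val * s.val) else 0 := by
      intro k
      refine (spiderAmplitude_congr (bipartiteHalfEdgeZ φ ψ N leg k) SpiderColor.Z (φ k) _).symm.trans ?_
      exact spiderAmplitude_Z_eq_sum _ _
    rw [Finset.prod_congr rfl fun k _ => h1 k, Finset.prod_univ_sum]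
    simp only [Fintype.piFinset_univ]
    refine Finset.sum_congr rfl fun t _ => ?_
    rw [Finset.prod_ite_zero]
    refine ite_congr_iff ?_ rfl
    simp only [Finset.mem_univ, true_implies]
    exact ⟨fun h e => h e.1.1 ⟨e.1.2, e.2⟩, fun h k m => h ⟨(k, m.1), m.2⟩⟩
  rw [ZXDiagram.eval_eq]
  have h1 : ∀ y : {e : K × M // N e.1 e.2} ⊕ L → ZMod 2,
      (if ∀ l, y ((bipartite φ ψ N leg).legEnd l).1 = x l then
        ∏ v, (bipartite φ ψ N leg).nodeAmp v y else 0) =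
      ∑ t : K → ZMod 2, if y = lab t then (∏ k, Complex.I ^ ((φ k).val * (t k).val)) *
        ∏ m, (bipartite φ ψ N leg).nodeAmp (Sum.inr m) (lab t) else 0 := by
    intro y
    have h2 : ∏ v, (bipartite φ ψ N leg).nodeAmp v y =
        (∏ k, (bipartite φ ψ N leg).nodeAmp (Sum.inl k) y) *
        ∏ m, (bipartite φ ψ N leg).nodeAmp (Sum.inr m) y := Fintype.prod_sum_type _
    have h3 : ∀ l, y ((bipartite φ ψ N leg).legEnd l).1 = y (Sum.inr l) := fun l =>
      congrArg (fun h : ({e : K × M // N e.1 e.2} ⊕ L) × Bool => y h.1) (bipartite_legEnd φ ψ N leg l)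
    have h4 : ∀ t, y = lab t ↔ (∀ l, y (Sum.inr l) = x l) ∧
        ∀ e : {e : K × M // N e.1 e.2}, y (Sum.inl e) = t e.1.1 := by
      intro t
      rw [funext_iff, Sum.forall, and_comm]
      rfl
    rw [h2, hZ, Finset.sum_mul]
    simp only [h3]
    split_ifs with hx
    · refine Finset.sum_congr rfl fun t _ => ?_
      by_cases ht : ∀ e : {e : K × M // N e.1 e.2}, y (Sum.inl e) = t e.1.1
      · have h5 := (h4 t).2 ⟨hx, ht⟩
        rw [if_pos ht, if_pos h5, h5]
      · rw [if_neg ht, if_neg fun h => ht ((h4 t).1 h).2, zero_mul]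
    · exact (Finset.sum_eq_zero fun t _ => if_neg fun h => hx ((h4 t).1 h).1).symm
  refine (Finset.sum_congr rfl fun y _ => (ite_congr_iff Iff.rfl rfl).trans (h1 y)).trans ?_
  refine Finset.sum_comm.trans ?_
  rw [Finset.mul_sum]
  refine Finset.sum_congr rfl fun t _ => ?_
  refine (sum_univ_ite_eq _ _).trans ?_
  simp only [hX, Finset.prod_mul_distrib]
  ring

/-- Only the necessary conditions that later exclude closed webs are extracted: the `X` components
are constant at each `Z` node, the `Z` components are constant at each `X` node, and the parity
condition holds at the `X` nodes. -/
theorem isPauliWeb_bipartite {w : {e : K × M // N e.1 e.2} ⊕ L → Pauli}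
    (hw : (bipartite φ ψ N leg).IsPauliWeb w) :
    (∃ s : K → ZMod 2, ∀ e, (w (Sum.inl e)).1 = s e.1.1) ∧
    ∃ d : M → ZMod 2, (∀ e, (w (Sum.inl e)).2 = d e.1.2) ∧ (∀ l, (w (Sum.inr l)).2 = d (leg l)) ∧
      ∀ m, (∑ k : {k // N k m}, (w (Sum.inl ⟨(k.1, m), k.2⟩)).1) +
        ∑ l : {l // leg l = m}, (w (Sum.inr l.1)).1 = d m * ((ψ m).val : ZMod 2) := by
  have h := ((bipartite φ ψ N leg).isPauliWeb_iff w).1 hw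
  have hZ : ∀ k, ∃ s, ∀ m : {m // N k m}, (w (Sum.inl ⟨(k, m.1), m.2⟩)).1 = s := fun k => by
    obtain ⟨s, hs, -⟩ := h (Sum.inl k)
    exact ⟨s, fun m => hs (bipartiteHalfEdgeZ φ ψ N leg k m)⟩
  have hX : ∀ m, ∃ d, ((∀ k : {k // N k m}, (w (Sum.inl ⟨(k.1, m), k.2⟩)).2 = d) ∧
      ∀ l : {l // leg l = m}, (w (Sum.inr l.1)).2 = d) ∧
      (∑ k : {k // N k m}, (w (Sum.inl ⟨(k.1, m), k.2⟩)).1) +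
        ∑ l : {l // leg l = m}, (w (Sum.inr l.1)).1 = d * ((ψ m).val : ZMod 2) := fun m => by
    have h2 := h (Sum.inr m)
    unfold ZXDiagram.NodeWeb at h2
    rw [← SpiderCond.congr_equiv (bipartiteHalfEdgeX φ ψ N leg m)] at h2
    obtain ⟨d, hd1, hd2⟩ := h2
    rw [Fintype.sum_sum_type] at hd2
    exact ⟨d, ⟨fun k => hd1 (Sum.inl k), fun l => hd1 (Sum.inr l)⟩, hd2⟩
  choose s hs using hZ
  choose d hd using hX
  exact ⟨⟨s, fun e => hs e.1.1 ⟨e.1.2, e.2⟩⟩, d, fun e => (hd e.1.2).1.1 ⟨e.1.1, e.2⟩,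
    fun l => (hd _).1.2 ⟨l, rfl⟩, fun m => (hd m).2⟩

end Bipartite

end

/-! ### Diagrams for Clifford tensors, and prescribed numbers of spacetime stabilizers -/

noncomputable section

open scoped Classical

theorem sum_ite_subtype {K : Type} [Fintype K] (P : K → Prop) (s : K → ZMod 2) :
    ∑ k : {k // P k}, s k.1 = ∑ k, if P k then s k else 0 := by
  rw [← Finset.sum_filter, ← Finset.sum_subtype_eq_sum_filter, Finset.subtype_univ]

/-- A controlled sign between two bits, up to local phases, as the amplitude of an `X` node. -/
theorem sgn_mul_eq (s t : ZMod 2) :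
    (1 + Complex.I) * sgn (s * t) =
      (1 + Complex.I * sgn (s + t)) * (Complex.I ^ s.val * Complex.I ^ t.val) := by
  have h := Complex.I_sq
  rcases s.two_cases with rfl | rfl <;> rcases t.two_cases with rfl | rfl <;>
    simp [ZMod.two_add_self, ZMod.val_one]
  · linear_combination (1 : ℂ) * h
  · linear_combination (1 : ℂ) * h

theorem prod_one_add_sgn {A : Type} [Fintype A] (s : A → ZMod 2) :
    ∏ a, (1 + sgn (s a)) = if ∀ a, s a = 0 then (2 : ℂ) ^ Fintype.card A else 0 := by
  have h : ∀ a, 1 + sgn (s a) = if s a = 0 then (2 : ℂ) else 0 := by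
    intro a
    rcases (s a).two_cases with h | h <;> simp [h]
    norm_num
  simp only [h]
  rw [Finset.prod_ite_zero]
  simp [Finset.card_univ]

theorem prod_pair_ite {K : Type} [Fintype K] {a b : K} {_ : ∀ k, Decidable (k = a ∨ k = b)}
    (hab : a ≠ b) (t : K → ZMod 2) :
    ∏ k, (if k = a ∨ k = b then Complex.I else 1) ^ (t k).val =
      Complex.I ^ (t a).val * Complex.I ^ (t b).val := by
  rw [← Finset.prod_subset (Finset.subset_univ {a, b}), Finset.prod_pair hab]
  · simp
  · intro k _ hk
    simp only [Finset.mem_insert, Finset.mem_singleton] at hk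
    rw [if_neg hk, one_pow]

/-- By the normal form, `T` lives on the points x₀ + ∑ t_k u_k and is there a product of powers of
i, linear in `t`, and of signs, quadratic in `t`. A `Z` node for each `k` copies t_k and carries the
linear phase; an `X` node at each leg enforces the position; an `X` node of phase π/2 for each
coupled pair supplies the controlled sign. Independence of the `u k` and oddness of the phases π/2
exclude closed webs. -/
theorem exists_diagram_of_isClifford {A : Type} [Fintype A] {T : (A → ZMod 2) → ℂ}
    (hT : IsClifford T) : ∃ D : ZXDiagram A, (∃ c : ℂ, c ≠ 0 ∧ D.eval = c • T) ∧
      D.numSpacetimeStabilizers = 0 := by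
  obtain ⟨r, u, z, c, x₀, hu, hx₀, hc4, hshift, hsupp⟩ := hT.exists_shifts
  -- The pairs whose quadratic coefficient in `shift_formula` is 1.
  let P : Type := {p : Fin r × Fin r // p.1 < p.2 ∧ ∑ a, z p.2 a * u p.1 a = 1}
  -- By `sgn_mul_eq` each controlled sign costs a factor i^(t k) at both of its ends. These factors
  -- are absorbed into the phase of the `Z` node together with the linear term.
  have hcn : ∀ k, ∃ n : ZMod 4, (c k * sgn (∑ a, z k a * x₀ a)) *
      (∏ p : P, if k = p.1.1 ∨ k = p.1.2 then Complex.I else 1) = Complex.I ^ n.val := by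
    intro k
    refine exists_I_pow ?_
    have h1 : (∏ p : P, if k = p.1.1 ∨ k = p.1.2 then Complex.I else 1) ^ 4 = 1 := by
      rw [← Finset.prod_pow]
      refine Finset.prod_eq_one fun p _ => ?_
      split_ifs
      · exact Complex.I_pow_four
      · exact one_pow 4
    have h2 := sgn_mul_self (∑ a, z k a * x₀ a)
    rw [mul_pow, mul_pow, hc4, h1, one_mul, mul_one]
    linear_combination (sgn (∑ a, z k a * x₀ a) ^ 2 + 1) * h2
  choose φ hφ using hcn
  let ψ : A ⊕ P → ZMod 4 := Sum.elim (fun a => if x₀ a = 0 then 0 else 2) fun _ => 1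
  let N : Fin r → A ⊕ P → Prop := fun k =>
    Sum.elim (fun a => u k a = 1) fun p => k = p.1.1 ∨ k = p.1.2
  refine ⟨bipartite φ ψ N Sum.inl, ?_, ?_⟩
  · obtain ⟨d, hd, heval⟩ := eval_bipartite φ ψ N (Sum.inl : A → A ⊕ P)
    have hI : (1 + Complex.I) ≠ 0 := by
      intro h
      have := congrArg Complex.re h
      simp at this
    refine ⟨d * (2 ^ Fintype.card A * (1 + Complex.I) ^ Fintype.card P * (T x₀)⁻¹), ?_, ?_⟩
    · exact mul_ne_zero hd (mul_ne_zero (mul_ne_zero (pow_ne_zero _ two_ne_zero)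
        (pow_ne_zero _ hI)) (inv_ne_zero hx₀))
    funext x
    rw [heval, Pi.smul_apply, smul_eq_mul, mul_assoc]
    congr 1
    have hA : ∀ t : Fin r → ZMod 2, ∏ a : A, (1 + Complex.I ^ (ψ (Sum.inl a)).val *
        sgn (incidentSum N Sum.inl t x (Sum.inl a))) =
        if x = x₀ + ∑ k, t k • u k then (2 : ℂ) ^ Fintype.card A else 0 := by
      intro t
      have h1 : ∀ a : A, 1 + Complex.I ^ (ψ (Sum.inl a)).val *
          sgn (incidentSum N Sum.inl t x (Sum.inl a)) =
          1 + sgn (x₀ a + (∑ k, t k * u k a) + x a) := by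
        intro a
        have e1 : incidentSum N Sum.inl t x (Sum.inl a) = (∑ k, t k * u k a) + x a := by
          refine congrArg₂ (· + ·) (Finset.sum_congr rfl fun k _ => ?_) ?_
          · refine (ite_congr_iff (q := u k a = 1) (dq := inferInstance) (b := t k) Iff.rfl rfl).trans ?_
            rcases (u k a).two_cases with h | h <;> simp [h]
          · exact (sum_univ_eq_single a fun l hl => if_neg fun h => hl (Sum.inl.inj h)).trans
              (if_pos rfl)
        have e3 : Complex.I ^ (ψ (Sum.inl a)).val = sgn (x₀ a) := by
          change Complex.I ^ (if x₀ a = 0 then (0 : ZMod 4) else 2).val = _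
          rcases (x₀ a).two_cases with h | h
          · rw [if_pos h, h]; simp
          · rw [if_neg (by rw [h]; exact one_ne_zero), h, sgn_one]
            exact Complex.I_sq
        rw [e1, e3, ← sgn_add, add_assoc]
      simp only [h1]
      rw [prod_one_add_sgn]
      refine ite_congr_iff ?_ rfl
      rw [funext_iff]
      refine forall_congr' fun a => ?_
      simp only [Pi.add_apply, Finset.sum_apply, Pi.smul_apply, smul_eq_mul]
      rw [CharTwo.add_eq_zero, eq_comm]
    have hP : ∀ t : Fin r → ZMod 2, (∏ p : P, (1 + Complex.I ^ (ψ (Sum.inr p)).val *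
        sgn (incidentSum N Sum.inl t x (Sum.inr p)))) *
          ∏ k, (∏ p : P, if k = p.1.1 ∨ k = p.1.2 then Complex.I else 1) ^ (t k).val =
        (1 + Complex.I) ^ Fintype.card P *
          ∏ i, ∏ j, if i < j then sgn (t i * t j * ∑ a, z j a * u i a) else 1 := by
      intro t
      have e1 : ∀ p : P, incidentSum N Sum.inl t x (Sum.inr p) = t p.1.1 + t p.1.2 := by
        intro p
        refine (congrArg₂ (· + ·) ?_ (Finset.sum_eq_zero fun l _ => if_neg fun h => ?_)).trans
          (add_zero _)
        · have : (Finset.univ.filter fun k => N k (Sum.inr p)) = {p.1.1, p.1.2} := by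
            ext k
            rw [Finset.mem_filter]
            simp [N]
          rw [← Finset.sum_filter, this, Finset.sum_pair p.2.1.ne]
        · cases h
      have e3 : ∀ p : P, Complex.I ^ (ψ (Sum.inr p)).val = Complex.I := fun p => pow_one _
      simp only [e1, e3, ← Finset.prod_pow]
      rw [Finset.prod_comm, ← Finset.prod_mul_distrib]
      have e4 : ∀ p : P, (1 + Complex.I * sgn (t p.1.1 + t p.1.2)) *
          ∏ k, (if k = p.1.1 ∨ k = p.1.2 then Complex.I else 1) ^ (t k).val =
          (1 + Complex.I) * sgn (t p.1.1 * t p.1.2) := fun p => by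
        rw [prod_pair_ite p.2.1.ne, sgn_mul_eq]
      simp only [e4, Finset.prod_mul_distrib, Finset.prod_const, Finset.card_univ]
      congr 1
      rw [← Fintype.prod_prod_type', ← Finset.prod_subtype (Finset.univ.filter
        fun p : Fin r × Fin r => p.1 < p.2 ∧ ∑ a, z p.2 a * u p.1 a = 1) (by simp)
        (fun p => sgn (t p.1 * t p.2)), Finset.prod_filter]
      refine Finset.prod_congr rfl fun p _ => ?_
      by_cases h1 : p.1 < p.2
      · rcases (∑ a, z p.2 a * u p.1 a).two_cases with h2 | h2 <;> simp [h1, h2]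
      · simp [h1]
    have key : ∀ t : Fin r → ZMod 2, (∏ k, Complex.I ^ ((φ k).val * (t k).val)) *
        ∏ m, (1 + Complex.I ^ (ψ m).val *
        sgn (incidentSum N Sum.inl t x m)) =
        if x = x₀ + ∑ k, t k • u k then
          2 ^ Fintype.card A * (1 + Complex.I) ^ Fintype.card P * (T x₀)⁻¹ * T x else 0 := by
      intro t
      have hk : ∏ k, Complex.I ^ ((φ k).val * (t k).val) =
          (∏ k, (c k * sgn (∑ a, z k a * x₀ a)) ^ (t k).val) *
          ∏ k, (∏ p : P, if k = p.1.1 ∨ k = p.1.2 then Complex.I else 1) ^ (t k).val := by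
        rw [← Finset.prod_mul_distrib]
        refine Finset.prod_congr rfl fun k _ => ?_
        rw [pow_mul, ← hφ, mul_pow]
      rw [Fintype.prod_sum_type, hA, hk]
      by_cases hx : x = x₀ + ∑ k, t k • u k
      · rw [if_pos hx, if_pos hx]
        have h1 := hP t
        have h2 := shift_formula x₀ u z c hshift t
        rw [← hx] at h2
        have h3 := inv_mul_cancel₀ hx₀
        rw [h2]
        linear_combination (∏ k, (c k * sgn (∑ a, z k a * x₀ a)) ^ (t k).val) *
          2 ^ Fintype.card A * h1 - 2 ^ Fintype.card A * (1 + Complex.I) ^ Fintype.card P *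
          (∏ k, (c k * sgn (∑ a, z k a * x₀ a)) ^ (t k).val) *
          (∏ i, ∏ j, if i < j then sgn (t i * t j * ∑ a, z j a * u i a) else 1) * h3
      · rw [if_neg hx, if_neg hx, zero_mul, mul_zero]
    simp only [key]
    by_cases hx : T x = 0
    · simp [hx]
    · obtain ⟨t, ht⟩ := hsupp x hx
      -- The `u k` are independent, so a point of the support has a single coordinate vector.
      refine (sum_univ_eq_single t fun t' ht' => if_neg ?_).trans (if_pos ht)
      intro h
      apply ht'
      rw [ht] at h
      have h1 := add_left_cancel h
      funext k
      have h2 := Fintype.linearIndependent_iff.1 hu (fun k => t' k - t k) (by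
        simp only [sub_smul, Finset.sum_sub_distrib, h1, sub_self]) k
      exact sub_eq_zero.1 h2
  · rw [ZXDiagram.numSpacetimeStabilizers, Submodule.finrank_eq_zero, Submodule.eq_bot_iff]
    intro w hw
    obtain ⟨h1, h2⟩ := (ZXDiagram.mem_spacetimeStabilizers _ w).1 hw
    have h2' : ∀ l, w (Sum.inr l) = 0 := by
      intro l
      have := h2 l
      rwa [bipartite_legEnd] at this
    obtain ⟨⟨s, hs⟩, d, hd1, hd2, hd3⟩ := isPauliWeb_bipartite φ ψ N Sum.inl h1
    have hdA : ∀ a, d (Sum.inl a) = 0 := fun a => by rw [← hd2, h2']; rfl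
    -- With closed legs, the parity conditions at the leg nodes say that `s` is a linear relation
    -- between the `u k`.
    have hs0 : s = 0 := by
      funext k
      refine Fintype.linearIndependent_iff.1 hu s (funext fun a => ?_) k
      have h3 := hd3 (Sum.inl a)
      simp only [hs, h2', hdA, Prod.fst_zero, Finset.sum_const_zero, add_zero, zero_mul] at h3
      rw [sum_ite_subtype] at h3
      simp only [Finset.sum_apply, Pi.smul_apply, smul_eq_mul, Pi.zero_apply]
      rw [← h3]
      refine Finset.sum_congr rfl fun k _ => ?_
      refine Eq.trans ?_ (ite_congr_iff (p := u k a = 1) (dp := inferInstance) (a := s k) Iff.rfl rfl)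
      rcases (u k a).two_cases with h | h <;> simp [h]
    -- At a node of odd phase a nonzero `Z` label would require an odd number of `X` components, but
    -- these all vanish.
    have hdP : ∀ p, d (Sum.inr p) = 0 := by
      intro p
      have h3 := hd3 (Sum.inr p)
      simp only [hs, h2', hs0, Pi.zero_apply, Prod.fst_zero, Finset.sum_const_zero, add_zero] at h3
      have h4 : (((ψ (Sum.inr p)).val : ℕ) : ZMod 2) = 1 := Nat.cast_one
      rw [h4, mul_one] at h3
      exact h3.symm
    funext (e : {e : Fin r × (A ⊕ P) // N e.1 e.2} ⊕ A)
    cases e with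
    | inr l => exact h2' l
    | inl e =>
      refine Prod.ext ((hs e).trans (by rw [hs0]; rfl)) ((hd1 e).trans ?_)
      rcases e with ⟨⟨k, a | p⟩, he⟩
      · exact hdA a
      · exact hdP p

namespace ZXDiagram

/-- Add closed components, each of which is an edge between two phaseless `Z` nodes. -/
def pad {A : Type} (D : ZXDiagram A) (n : ℕ) : ZXDiagram A where
  V := D.V ⊕ (Fin n × Bool)
  E := D.E ⊕ Fin n
  color := Sum.elim D.color fun _ => .Z
  phase := Sum.elim D.phase fun _ => 0
  endpoint
    | (Sum.inl e, b) => Sum.map Sum.inl id (D.endpoint (e, b))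
    | (Sum.inr k, b) => Sum.inl (Sum.inr (k, b))
  leg_unique l := by
    obtain ⟨⟨e, b⟩, h, hu⟩ := D.leg_unique l
    refine ⟨(Sum.inl e, b), by simp [h], ?_⟩
    rintro ⟨e' | k, b'⟩ h'
    · cases h2 : D.endpoint (e', b') with
      | inl v => simp [h2] at h'
      | inr l' =>
        simp only [h2, Sum.map_inr, id, Sum.inr.injEq] at h'
        subst h'
        have := hu _ h2
        simp_all
    · cases h'

variable {A : Type} (D : ZXDiagram A) (n : ℕ)

theorem pad_legEnd (a : A) : (D.pad n).legEnd a = (Sum.inl (D.legEnd a).1, (D.legEnd a).2) :=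
  (((D.pad n).endpoint_eq_inr (Sum.inl (D.legEnd a).1, (D.legEnd a).2) a).1
    (congrArg (Sum.map Sum.inl id) (D.endpoint_legEnd a))).symm

/-- The half edges at an original node. -/
def padHalfEdge (v : D.V) : D.HalfEdge v ≃ (D.pad n).HalfEdge (Sum.inl v) :=
  Equiv.ofBijective (fun h => ⟨(Sum.inl h.1.1, h.1.2), congrArg (Sum.map Sum.inl id) h.2⟩) <| by
    constructor
    · rintro ⟨⟨e, b⟩, h⟩ ⟨⟨e', b'⟩, h'⟩ hh
      have h1 := Sum.inl.inj (congrArg (fun h => h.1.1) hh)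
      have h2 : b = b' := congrArg (fun h => h.1.2) hh
      cases h1; cases h2; rfl
    · rintro ⟨⟨e | e, b⟩, h⟩
      · obtain ⟨w, hw, hw'⟩ := Sum.map_eq_inl_iff.1 h
        cases hw'
        exact ⟨⟨(e, b), hw⟩, rfl⟩
      · cases h

/-- An added node has a single edge end. -/
def padHalfEdgeNew (k : Fin n × Bool) : Unit ≃ (D.pad n).HalfEdge (Sum.inr k) :=
  Equiv.ofBijective (fun _ => ⟨(Sum.inr k.1, k.2), rfl⟩) <| by
    constructor
    · rintro ⟨⟩ ⟨⟩ _; rfl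
    · rintro ⟨⟨e | e, b⟩, h⟩
      · obtain ⟨w, -, hw'⟩ := Sum.map_eq_inl_iff.1 h
        cases hw'
      · cases h; exact ⟨(), rfl⟩

/-- A phaseless one-legged `Z` node has amplitude 1 on both bits, so each added edge contributes the
factor 2. -/
theorem eval_pad : (D.pad n).eval = (2 : ℂ) ^ n • D.eval := by
  funext x
  rw [Pi.smul_apply, smul_eq_mul, eval_eq, eval_eq]
  have hnew : ∀ (k : Fin n × Bool) y, (D.pad n).nodeAmp (Sum.inr k) y = 1 := by
    intro k y
    refine (spiderAmplitude_congr (D.padHalfEdgeNew n k) SpiderColor.Z 0 _).symm.trans ?_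
    rw [spiderAmplitude_Z_eq_sum]
    simp [Unique.forall_iff]
  have h1 : ∀ y : D.E ⊕ Fin n → ZMod 2, (if ∀ l, y ((D.pad n).legEnd l).1 = x l then
      ∏ v, (D.pad n).nodeAmp v y else 0) =
      if ∀ l, y (Sum.inl (D.legEnd l).1) = x l then ∏ v, D.nodeAmp v (y ∘ Sum.inl) else 0 := by
    intro y
    have h2 : ∀ l, y ((D.pad n).legEnd l).1 = y (Sum.inl (D.legEnd l).1) := fun l =>
      congrArg (fun h : (D.E ⊕ Fin n) × Bool => y h.1) (D.pad_legEnd n l)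
    refine ite_congr_iff (forall_congr' fun l => by rw [h2]) ?_
    refine (Fintype.prod_sum_type _).trans ?_
    rw [Finset.prod_eq_one fun k _ => hnew k y, mul_one]
    exact Finset.prod_congr rfl fun v _ => nodeAmp_congr (D.padHalfEdge n v) rfl rfl fun _ => rfl
  refine (Finset.sum_congr rfl fun y _ => h1 y).trans ?_
  refine (@Fintype.sum_equiv ((D.pad n).E → ZMod 2) ((D.E → ZMod 2) × (Fin n → ZMod 2)) _ _ _ _
    (Equiv.sumArrowEquivProdArrow D.E (Fin n) (ZMod 2)) _ (fun y =>
      if ∀ l, y.1 (D.legEnd l).1 = x l then ∏ v, D.nodeAmp v y.1 else 0) fun y => rfl).trans ?_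
  rw [Fintype.sum_prod_type]
  simp [Finset.mul_sum]

/-- A phaseless one-legged `Z` node is stabilized by `X` and not by `Z`, so each added edge carries
exactly one independent closed web. -/
theorem numSpacetimeStabilizers_pad (hD : D.numSpacetimeStabilizers = 0) :
    (D.pad n).numSpacetimeStabilizers = n := by
  have h0 : ∀ w, D.IsPauliWeb w → (∀ l, w (D.legEnd l).1 = 0) → w = 0 := by
    intro w h1 h2
    rw [numSpacetimeStabilizers, Submodule.finrank_eq_zero, Submodule.eq_bot_iff] at hD
    exact hD w ((D.mem_spacetimeStabilizers w).2 ⟨h1, h2⟩)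
  have hleg : ∀ (w : D.E ⊕ Fin n → Pauli) l,
      w ((D.pad n).legEnd l).1 = w (Sum.inl (D.legEnd l).1) := fun w l =>
    congrArg (fun h : (D.E ⊕ Fin n) × Bool => w h.1) (D.pad_legEnd n l)
  have hw : ∀ w : D.E ⊕ Fin n → Pauli, w ∈ (D.pad n).spacetimeStabilizers ↔
      w ∘ Sum.inl = 0 ∧ ∀ k, (w (Sum.inr k)).2 = 0 := by
    intro w
    refine (mem_spacetimeStabilizers (D.pad n) w).trans ?_
    refine (and_congr_left' (isPauliWeb_iff (D.pad n) w)).trans ?_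
    refine (and_congr_left' (Sum.forall (p := fun v : D.V ⊕ (Fin n × Bool) =>
      (D.pad n).NodeWeb v fun h => w h.1))).trans ?_
    have e1 : ∀ v, ((D.pad n).NodeWeb (Sum.inl v) fun h => w h.1) ↔
        D.NodeWeb v fun h => (w ∘ Sum.inl) h.1 := fun v =>
      nodeWeb_congr (D.padHalfEdge n v) rfl rfl fun _ => rfl
    have e2 : ∀ k, ((D.pad n).NodeWeb (Sum.inr k) fun h => w h.1) ↔ (w (Sum.inr k.1)).2 = 0 := by
      intro k
      refine (SpiderCond.congr_equiv (D.padHalfEdgeNew n k) _).symm.trans ?_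
      constructor
      · rintro ⟨t, -, h⟩
        rw [Fintype.sum_unique] at h
        refine Eq.trans h ?_
        exact mul_eq_zero_of_right _ Nat.cast_zero
      · intro h
        refine ⟨(w (Sum.inr k.1)).1, fun _ => rfl, ?_⟩
        rw [Fintype.sum_unique]
        exact h.trans (mul_eq_zero_of_right _ Nat.cast_zero).symm
    constructor
    · rintro ⟨⟨h1, h2⟩, h3⟩
      refine ⟨h0 _ ((D.isPauliWeb_iff _).2 fun v => (e1 v).1 (h1 v)) fun l => ?_, fun k =>
        (e2 (k, true)).1 (h2 _)⟩
      exact (hleg w l).symm.trans (h3 l)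
    · rintro ⟨h1, h2⟩
      refine ⟨⟨fun v => (e1 v).2 ?_, fun k => (e2 k).2 (h2 _)⟩, fun l => ?_⟩
      · rw [h1]; exact (D.isPauliWeb_iff 0).1 (IsPauliWeb.zero D) v
      · exact (hleg w l).trans (congrFun h1 _)
  let e : (D.pad n).spacetimeStabilizers ≃ₗ[ZMod 2] (Fin n → ZMod 2) :=
    { toFun := fun w k => (w.1 (Sum.inr k)).1
      map_add' := fun _ _ => rfl
      map_smul' := fun _ _ => rfl
      invFun := fun t => ⟨Sum.elim 0 fun k => (t k, 0), (hw _).2 ⟨rfl, fun _ => rfl⟩⟩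
      left_inv := fun w => by
        obtain ⟨h1, h2⟩ := (hw w.1).1 w.2
        refine Subtype.ext (funext fun (e : D.E ⊕ Fin n) => ?_)
        cases e with
        | inl e => exact (congrFun h1 e).symm
        | inr k => exact Prod.ext rfl (h2 k).symm
      right_inv := fun _ => rfl }
  exact e.finrank_eq.trans (by simp)

/-- Rebuild the tensor without spacetime stabilizers, then pad. The number of spacetime stabilizers
can thus be prescribed independently of a nonzero map. -/
theorem exists_sameMap_num {D : ZXDiagram A} (hD : D.eval ≠ 0) (n : ℕ) :
    ∃ D' : ZXDiagram A, D.SameMap D' ∧ D'.numSpacetimeStabilizers = n := by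
  have := D.finite_legs
  let _ := Fintype.ofFinite A
  obtain ⟨D', ⟨c, hc, h⟩, h0⟩ := exists_diagram_of_isClifford (isClifford_eval hD)
  refine ⟨D'.pad n, ⟨2 ^ n * c, mul_ne_zero (pow_ne_zero _ two_ne_zero) hc, ?_⟩,
    D'.numSpacetimeStabilizers_pad n h0⟩
  rw [eval_pad, h, smul_smul]

end ZXDiagram

end

noncomputable section

open scoped Classical

/-! ### Reduction of the number of legs of a bond -/

section Reduction

variable {A : Type} [Fintype A]

/-- Criterion for computing symmetries: if some of them already contain their own commutant, then
these are all, because symmetries of a nonzero tensor commute. -/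
theorem isClifford_of_forall {T : (A → ZMod 2) → ℂ} (hT : T ≠ 0) (S : (A → Pauli) → Prop)
    (hS : ∀ p, S p → IsSymm T p) (hperp : ∀ p, (∀ q, S q → pauliSymplectic p q = 0) → S p) :
    IsClifford T ∧ ∀ p, IsSymm T p ↔ S p :=
  ⟨⟨hT, fun p h => hS p (hperp p fun q hq => h q (hS q hq))⟩,
    fun p => ⟨fun h => hperp p fun q hq => h.commute hT (hS q hq), hS p⟩⟩

theorem pauliSymplectic_elim {A B : Type} [Fintype A] [Fintype B] (p q : A ⊕ B → Pauli) :
    pauliSymplectic p q = pauliSymplectic (p ∘ Sum.inl) (q ∘ Sum.inl) +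
      pauliSymplectic (p ∘ Sum.inr) (q ∘ Sum.inr) := Fintype.sum_sum_type _

/-- The projection of a Clifford tensor to an eigenspace of a Pauli string that anticommutes with
one of its symmetries. -/
theorem IsClifford.project {T : (A → ZMod 2) → ℂ} (hT : IsClifford T) {q r : A → Pauli} {c : ℂ}
    (hc : c * c = sgn (∑ a, (q a).2 * (q a).1)) (hr : IsSymm T r) (hqr : pauliSymplectic q r = 1) :
    IsClifford (T + c⁻¹ • pauliAct q T) ∧ ∀ p, IsSymm (T + c⁻¹ • pauliAct q T) p ↔
      pauliSymplectic p q = 0 ∧ (IsSymm T p ∨ IsSymm T (p + q)) := by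
  have hc0 : c ≠ 0 := fun h => sgn_ne_zero _ (by rw [← hc, h, mul_zero])
  have hqq : q + q = 0 := funext fun a => Prod.ext (ZMod.two_add_self _) (ZMod.two_add_self _)
  have hq2 : pauliAct q (T + c⁻¹ • pauliAct q T) = c • (T + c⁻¹ • pauliAct q T) := by
    rw [pauliAct_add, pauliAct_smul, pauliAct_pauliAct, hqq, pauliAct_zero, ← hc, smul_add,
      smul_smul, smul_smul, ← mul_assoc, inv_mul_cancel₀ hc0, one_mul, mul_inv_cancel₀ hc0,
      one_smul, add_comm]
  have hcomm : ∀ p, pauliSymplectic p q = 0 → IsSymm T p →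
      IsSymm (T + c⁻¹ • pauliAct q T) p := by
    rintro p hp ⟨d, hd, h⟩
    refine ⟨d, hd, ?_⟩
    rw [pauliAct_add, pauliAct_smul, pauliAct_comm, hp, sgn_zero, one_smul, h, pauliAct_smul,
      smul_add, smul_comm]
  have hqs : IsSymm (T + c⁻¹ • pauliAct q T) q := ⟨c, hc0, hq2⟩
  refine isClifford_of_forall ?_ _ ?_ ?_
  -- If the projection vanished, `q` would be a symmetry of `T` with eigenvalue `-c`, although it
  -- anticommutes with `r`.
  · intro h0
    have h1 : IsSymm T q := by
      refine ⟨-c, neg_ne_zero.2 hc0, ?_⟩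
      have h2 := congrArg (fun X => c • X) h0
      simp only [smul_add, smul_smul, mul_inv_cancel₀ hc0, one_smul, smul_zero] at h2
      rw [neg_smul]
      exact eq_neg_of_add_eq_zero_right h2
    rw [h1.commute hT.1 hr] at hqr
    exact zero_ne_one hqr
  · rintro p ⟨h1, h2 | h2⟩
    · exact hcomm p h1 h2
    · have h3 := (hcomm (p + q) (by
        rw [pauliSymplectic_add_left, h1, pauliSymplectic_self, add_zero]) h2).add hqs
      rwa [add_assoc, hqq, add_zero] at h3
  · intro p hp
    have hpq : pauliSymplectic p q = 0 := by
      refine hp q ⟨pauliSymplectic_self q, Or.inr ?_⟩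
      rw [hqq]; exact IsSymm.zero T
    refine ⟨hpq, ?_⟩
    -- A symmetry `e` of `T` that anticommutes with `q` becomes one that commutes with `q` after
    -- adding `r`. So on the symmetries of `T` the string `p` pairs like 0 or like `q`, depending on
    -- its value at `r`.
    have key : ∀ e, IsSymm T e → pauliSymplectic p e = pauliSymplectic p r * pauliSymplectic q e := by
      intro e he
      rcases (pauliSymplectic q e).two_cases with h | h
      · rw [h, mul_zero]
        exact hp e ⟨by rw [pauliSymplectic_comm, h], Or.inl he⟩
      · have h1 := hp (e + r) ⟨by rw [pauliSymplectic_comm, pauliSymplectic_add_right, h, hqr]; rfl,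
          Or.inl (he.add hr)⟩
        rw [pauliSymplectic_add_right] at h1
        rw [h, mul_one]
        exact CharTwo.add_eq_zero.1 h1
    rcases (pauliSymplectic p r).two_cases with h | h
    · exact Or.inl (hT.2 p fun e he => by rw [key e he, h, zero_mul])
    · refine Or.inr (hT.2 _ fun e he => ?_)
      rw [pauliSymplectic_add_left, key e he, h, one_mul, ZMod.two_add_self]

variable {m n : ℕ}

/-- The tensor that identifies the legs along an injection and caps the other legs. -/
def capTensor (ι : Fin m → Fin n) (f : ZMod 2 → ℂ) (x : Fin m ⊕ Fin n → ZMod 2) : ℂ :=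
  if ∀ k, x (Sum.inl k) = x (Sum.inr (ι k)) then
    ∏ k with k ∉ Set.range ι, f (x (Sum.inr k)) else 0

theorem Pauli.eq_of_commute : ∀ p r : Pauli, r ≠ 0 → p.1 * r.2 + p.2 * r.1 = 0 → p = 0 ∨ p = r := by
  decide

theorem Pauli.eq_of_forall_commute : ∀ p q : Pauli,
    (∀ r : Pauli, p.1 * r.2 + p.2 * r.1 + (q.1 * r.2 + q.2 * r.1) = 0) → p = q := by
  decide

/-- The tensor is a product of identity wires and of one-leg states fixed by `r`. Testing a string
against equal operators at the two ends of a wire, and against `r` on a capped leg, shows that there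
are no further symmetries. -/
theorem isClifford_capTensor {ι : Fin m → Fin n} (hι : Function.Injective ι) {f : ZMod 2 → ℂ}
    {r : Pauli} (hr : r ≠ 0) (hf : ∀ t, sgn (r.2 * t) * f (t + r.1) = f t) {t₀ : ZMod 2}
    (ht₀ : f t₀ ≠ 0) :
    IsClifford (capTensor ι f) ∧ ∀ p, IsSymm (capTensor ι f) p ↔
      (∀ k, p (Sum.inl k) = p (Sum.inr (ι k))) ∧
      ∀ k, k ∉ Set.range ι → p (Sum.inr k) = 0 ∨ p (Sum.inr k) = r := by
  refine isClifford_of_forall ?_ _ ?_ ?_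
  · refine Function.ne_iff.2 ⟨fun _ => t₀, ?_⟩
    simp only [capTensor, implies_true, if_true, Finset.prod_const]
    exact pow_ne_zero _ ht₀
  · rintro p ⟨h1, h2⟩
    refine ⟨1, one_ne_zero, funext fun x => ?_⟩
    rw [one_smul]
    simp only [pauliAct, capTensor, h1, add_left_inj]
    split_ifs with hx
    · rw [Fintype.sum_sum_type]
      simp only [h1, hx]
      have e1 : ∑ k, (p (Sum.inr k)).2 * x (Sum.inr k) =
          (∑ k, (p (Sum.inr (ι k))).2 * x (Sum.inr (ι k))) +
          ∑ k with k ∉ Set.range ι, (p (Sum.inr k)).2 * x (Sum.inr k) := by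
        rw [← Finset.sum_filter_add_sum_filter_not Finset.univ fun k => k ∈ Set.range ι]
        congr 1
        rw [← Finset.sum_image (g := ι) (s := Finset.univ)
          (f := fun k => (p (Sum.inr k)).2 * x (Sum.inr k)) fun _ _ _ _ h => hι h]
        refine Finset.sum_congr ?_ fun _ _ => rfl
        ext k; simp
      rw [e1, ← add_assoc, ZMod.two_add_self, zero_add, sgn_sum, ← Finset.prod_mul_distrib]
      refine Finset.prod_congr rfl fun k hk => ?_
      rcases h2 k (Finset.mem_filter.1 hk).2 with h | h
      · simp [h]
      · rw [h]; exact hf _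
    · simp
  · intro p hp
    have hsingle : ∀ k (s : Pauli), pauliSymplectic p (Sum.elim 0 (Pi.single k s)) =
        (p (Sum.inr k)).1 * s.2 + (p (Sum.inr k)).2 * s.1 := by
      intro k s
      rw [pauliSymplectic_elim]
      simp only [Sum.elim_comp_inl, Sum.elim_comp_inr]
      rw [pauliSymplectic_zero_right, pauliSymplectic_single, zero_add]
      rfl
    constructor
    · intro k
      refine Pauli.eq_of_forall_commute _ _ fun s => ?_
      have := hp (Sum.elim (Pi.single k s) (Pi.single (ι k) s)) ⟨fun k' => ?_, fun k' hk' => ?_⟩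
      · rw [pauliSymplectic_elim] at this
        simp only [Sum.elim_comp_inl, Sum.elim_comp_inr] at this
        rwa [pauliSymplectic_single, pauliSymplectic_single] at this
      · simp only [Sum.elim_inl, Sum.elim_inr]
        by_cases h : k' = k
        · subst h; simp
        · rw [Pi.single_eq_of_ne h, Pi.single_eq_of_ne (hι.ne h)]
      · left
        rw [Sum.elim_inr, Pi.single_eq_of_ne]
        rintro rfl
        exact hk' ⟨k, rfl⟩
    · intro k hk
      refine Pauli.eq_of_commute _ _ hr ?_
      rw [← hsingle]
      refine hp _ ⟨fun k' => ?_, fun k' hk' => ?_⟩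
      · rw [Sum.elim_inl, Sum.elim_inr, Pi.single_eq_of_ne]
        · rfl
        · rintro rfl; exact hk ⟨k', rfl⟩
      · rw [Sum.elim_inr]
        by_cases h : k' = k
        · subst h; right; simp
        · left; rw [Pi.single_eq_of_ne h]

/-- A pair of tensors that are applied to the two ends of a bond in order to remove the part of the
bond on which the Pauli string `q` is fixed by the gadget at the first end, with eigenvalue `c`. -/
structure IsBondReduction (q : Fin n → Pauli) (c : ℂ) (V V' : (Fin m ⊕ Fin n → ZMod 2) → ℂ) :
    Prop where
  clifford : IsClifford V
  clifford' : IsClifford V'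
  eq_zero : ∀ β', IsSymm V' (Sum.elim β' 0) → β' = 0
  exists_partner : ∀ β, pauliSymplectic β q = 0 → ∃ β', IsSymm V' (Sum.elim β' β) ∧
    (IsSymm V (Sum.elim β' β) ∨ IsSymm V (Sum.elim β' (β + q))) ∧ (β = 0 → β' = 0)
  symm_of_commute : ∀ β' γ, pauliSymplectic γ q = 0 → IsSymm V (Sum.elim β' γ) →
    IsSymm V' (Sum.elim β' γ)
  eq_of_symm : ∀ γ, IsSymm V' (Sum.elim 0 γ) → γ = 0 ∨ γ = q
  -- The two tensors contract to `g` composed with 1 + c⁻¹ q at the second end. If the first gadget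
  -- has eigenvalue `c` under `q`, then c⁻¹ can be traded for `q` at the first end. This replaces
  -- `g` by the sum of `g` and its conjugate by `q`, which is `κ` times the identity wire.
  contraction : ∃ (g : (Fin n → ZMod 2) → (Fin n → ZMod 2) → ℂ) (κ : ℂ), κ ≠ 0 ∧
    (∀ u v, ∑ w, V (Sum.elim w u) * V' (Sum.elim w v) =
      g u v + c⁻¹ * sgn (∑ a, (q a).2 * v a) * g u fun a => v a + (q a).1) ∧
    ∀ u v, g u v + sgn (∑ a, (q a).2 * (u a + v a)) *
      g (fun a => u a + (q a).1) (fun a => v a + (q a).1) = if u = v then κ else 0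

theorem sum_capTensor (ι : Fin m → Fin n) (f : ZMod 2 → ℂ) (u v : Fin n → ZMod 2) :
    ∑ w, capTensor ι f (Sum.elim w u) * capTensor ι f (Sum.elim w v) =
      if ∀ k, u (ι k) = v (ι k) then ∏ k with k ∉ Set.range ι, f (u k) * f (v k) else 0 := by
  have e : ∀ (w : Fin m → ZMod 2) z, capTensor ι f (Sum.elim w z) =
      if ∀ k, w k = z (ι k) then ∏ k with k ∉ Set.range ι, f (z k) else 0 :=
    fun _ _ => ite_congr_iff Iff.rfl rfl
  rw [Fintype.sum_eq_single fun k => u (ι k)]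
  · rw [e, e, if_pos fun _ => rfl, Finset.prod_mul_distrib, mul_ite, mul_zero]
  · intro w hw
    rw [e, if_neg fun h => hw (funext h), zero_mul]

theorem isBondReduction_id (n : ℕ) :
    IsBondReduction (0 : Fin n → Pauli) 1 (capTensor id 1) (capTensor id 1) := by
  obtain ⟨h1, h2⟩ := isClifford_capTensor (m := n) Function.injective_id (f := 1) (r := (1, 0))
    (by decide) (by simp) (t₀ := 0) one_ne_zero
  have h3 : ∀ p : Fin n ⊕ Fin n → Pauli, IsSymm (capTensor id 1) p ↔
      ∀ k, p (Sum.inl k) = p (Sum.inr k) := by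
    intro p
    rw [h2]
    simp
  refine ⟨h1, h1, fun β' h => ?_, fun β _ => ⟨β, ?_, Or.inl ?_, id⟩, fun β' γ _ h => h,
    fun γ h => Or.inl ?_, ?_⟩
  · exact funext ((h3 _).1 h)
  · exact (h3 _).2 fun _ => rfl
  · exact (h3 _).2 fun _ => rfl
  · exact (funext ((h3 _).1 h)).symm
  -- For `q = 0` the two terms coincide, so each is half of the identity.
  · refine ⟨fun u v => if u = v then 1 / 2 else 0, 1, one_ne_zero, fun u v => ?_, fun u v => ?_⟩
    · rw [sum_capTensor]
      simp only [id, Set.range_id, Set.mem_univ, not_true_eq_false, Finset.filter_false,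
        Finset.prod_empty, Pi.zero_apply, Prod.snd_zero, zero_mul, Finset.sum_const_zero, sgn_zero,
        Prod.fst_zero, add_zero, inv_one, one_mul, ← funext_iff]
      split_ifs <;> norm_num
    · simp only [Pi.zero_apply, Prod.snd_zero, zero_mul, Finset.sum_const_zero, sgn_zero,
        Prod.fst_zero, add_zero, one_mul]
      split_ifs <;> norm_num

/-- The state `f` is fixed by an `r` that anticommutes with `p`, so `f` and `p f` form an orthogonal
basis with equal norms, and f fᵀ + (p f)(p f)ᵀ is a multiple of the identity. For `p = Z` the cap is
|0⟩ + |1⟩; when `p` has an `X` component it is |0⟩. -/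
theorem exists_cap (p : Pauli) (hp : p ≠ 0) : ∃ (r : Pauli) (f : ZMod 2 → ℂ) (κ : ℂ), κ ≠ 0 ∧
    p.1 * r.2 + p.2 * r.1 = 1 ∧ (∀ t, sgn (r.2 * t) * f (t + r.1) = f t) ∧ f 0 ≠ 0 ∧
    ∀ s t, f s * f t + sgn (p.2 * (s + t)) * (f (s + p.1) * f (t + p.1)) =
      if s = t then κ else 0 := by
  obtain ⟨a, b⟩ := p
  rcases a.two_cases with rfl | rfl
  · obtain rfl : b = 1 := by
      rcases b.two_cases with rfl | rfl
      · exact (hp rfl).elim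
      · rfl
    refine ⟨(1, 0), fun _ => 1, 2, two_ne_zero, by decide, by simp, one_ne_zero, fun s t => ?_⟩
    rcases s.two_cases with rfl | rfl <;> rcases t.two_cases with rfl | rfl <;>
      simp [ZMod.two_add_self] <;> norm_num
  · refine ⟨(0, 1), fun t => if t = 0 then 1 else 0, 1, one_ne_zero, by simp, fun t => ?_, by simp,
      fun s t => ?_⟩
    · rcases t.two_cases with rfl | rfl <;> simp
    · rcases s.two_cases with rfl | rfl <;> rcases t.two_cases with rfl | rfl <;>
        simp [ZMod.two_add_self]

/-- One wire `a` on which `q` acts nontrivially is removed. At the first end it is capped by a state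
whose stabilizer `r` anticommutes with `q a`; at the other end the same cap is projected to the
eigenspace of `q`. The projection restores what the cap forgets, because `q` correlates wire `a`
with the remaining wires. -/
theorem exists_isBondReduction (q : Fin n → Pauli) (hq : q ≠ 0) (c : ℂ)
    (hc : c * c = sgn (∑ a, (q a).2 * (q a).1)) :
    ∃ m < n, ∃ V V' : (Fin m ⊕ Fin n → ZMod 2) → ℂ, IsBondReduction q c V V' := by
  obtain ⟨a, ha⟩ := Function.ne_iff.1 hq
  obtain ⟨r, f, κ, hκ, hqr, hf, hf0, hff⟩ := exists_cap (q a) ha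
  have hr : r ≠ 0 := by
    rintro rfl
    simp at hqr
  have hcard : Fintype.card {k : Fin n // k ≠ a} = n - 1 := by simp
  let e := Fintype.equivFinOfCardEq hcard
  let ι : Fin (n - 1) → Fin n := fun k => (e.symm k).1
  have hι : Function.Injective ι := Subtype.val_injective.comp e.symm.injective
  have hrange : ∀ k, k ∉ Set.range ι ↔ k = a := by
    intro k
    rw [← not_iff_not, not_not]
    constructor
    · rintro ⟨k', rfl⟩; exact (e.symm k').2
    · intro h; exact ⟨e ⟨k, h⟩, by simp [ι]⟩
  have hext : ∀ {X : Type} (u v : Fin n → X), (∀ k, u (ι k) = v (ι k)) → u a = v a → u = v := by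
    intro X u v h h'
    funext k
    by_cases hk : k = a
    · rw [hk, h']
    · obtain ⟨k', rfl⟩ := not_not.1 ((not_congr (hrange k)).2 hk)
      exact h k'
  obtain ⟨hV, hVs⟩ := isClifford_capTensor hι hr hf hf0
  have hVs' : ∀ β' β, IsSymm (capTensor ι f) (Sum.elim β' β) ↔
      (∀ k, β' k = β (ι k)) ∧ (β a = 0 ∨ β a = r) := by
    intro β' β
    rw [hVs]
    simp only [hrange, forall_eq, Sum.elim_inl, Sum.elim_inr]
  have hq2 : pauliSymplectic (Sum.elim 0 q : Fin (n - 1) ⊕ Fin n → Pauli)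
      (Sum.elim 0 (Pi.single a r)) = 1 := by
    rw [pauliSymplectic_elim]
    simp only [Sum.elim_comp_inl, Sum.elim_comp_inr]
    rw [pauliSymplectic_zero_right, pauliSymplectic_single, zero_add, hqr]
  have hrs : IsSymm (capTensor ι f) (Sum.elim 0 (Pi.single a r)) := by
    rw [hVs']
    refine ⟨fun k => ?_, Or.inr (by simp)⟩
    rw [Pi.single_eq_of_ne]
    · rfl
    · exact (e.symm k).2
  obtain ⟨hV', hVs2⟩ := hV.project (q := Sum.elim 0 q) (c := c) (by simpa using hc) hrs hq2
  have hsymp : ∀ (β' : Fin (n - 1) → Pauli) β,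
      pauliSymplectic (Sum.elim β' β) (Sum.elim 0 q) = pauliSymplectic β q := by
    intro β' β
    rw [pauliSymplectic_elim]
    simp
  have hadd : ∀ (β' : Fin (n - 1) → Pauli) (β : Fin n → Pauli),
      (Sum.elim β' β + Sum.elim (0 : Fin (n - 1) → Pauli) q : Fin (n - 1) ⊕ Fin n → Pauli) =
        Sum.elim β' (β + q) := by
    intro β' β
    funext k
    cases k <;> simp
  have hVs3 : ∀ β' β, IsSymm (capTensor ι f + c⁻¹ • pauliAct (Sum.elim 0 q) (capTensor ι f))
      (Sum.elim β' β) ↔ pauliSymplectic β q = 0 ∧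
      (((∀ k, β' k = β (ι k)) ∧ (β a = 0 ∨ β a = r)) ∨
      ((∀ k, β' k = (β + q) (ι k)) ∧ ((β + q) a = 0 ∨ (β + q) a = r))) := by
    intro β' β
    rw [hVs2, hsymp, hadd, hVs', hVs']
  have hqa : ¬ (q a = 0 ∨ q a = r) := by
    rintro (h | h)
    · exact ha h
    · rw [h, mul_comm r.2, ZMod.two_add_self] at hqr
      exact zero_ne_one hqr
  -- The only nonzero candidate is `r` at wire `a`, and it anticommutes with `q`.
  have hzero : ∀ γ : Fin n → Pauli, pauliSymplectic γ q = 0 → (∀ k, 0 = γ (ι k)) →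
      (γ a = 0 ∨ γ a = r) → γ = 0 := by
    intro γ h1 h2 h3
    refine hext γ 0 (fun k => (h2 k).symm) (h3.resolve_right fun h => ?_)
    have h4 : γ = Pi.single a r := by
      refine hext _ _ (fun k => ?_) (by simp [h])
      rw [← h2, Pi.single_eq_of_ne (e.symm k).2]
    rw [pauliSymplectic_comm, h4, pauliSymplectic_single, hqr] at h1
    exact one_ne_zero h1
  refine ⟨n - 1, Nat.sub_lt (Fin.pos a) one_pos, capTensor ι f,
    capTensor ι f + c⁻¹ • pauliAct (Sum.elim 0 q) (capTensor ι f), hV, hV', ?_, ?_, ?_, ?_, ?_⟩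
  · intro β' h
    obtain ⟨-, ⟨h, -⟩ | ⟨-, h⟩⟩ := (hVs3 _ _).1 h
    · exact funext h
    · rw [zero_add] at h
      exact (hqa h).elim
  · intro β hβ
    by_cases h : (β a).1 * r.2 + (β a).2 * r.1 = 0
    · have h1 := Pauli.eq_of_commute _ _ hr h
      refine ⟨fun k => β (ι k), (hVs3 _ _).2 ⟨hβ, Or.inl ⟨fun _ => rfl, h1⟩⟩,
        Or.inl ((hVs' _ _).2 ⟨fun _ => rfl, h1⟩), ?_⟩
      rintro rfl; rfl
    -- Both `β a` and `q a` anticommute with `r`, so their sum commutes with it and passes through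
    -- the cap.
    · have h1 : (β + q) a = 0 ∨ (β + q) a = r := by
        refine Pauli.eq_of_commute _ _ hr ?_
        rw [Pi.add_apply, Prod.fst_add, Prod.snd_add]
        have h2 := (ZMod.two_cases _).resolve_left h
        linear_combination h2 + hqr + ZMod.two_add_self 1
      refine ⟨fun k => (β + q) (ι k), (hVs3 _ _).2 ⟨hβ, Or.inr ⟨fun _ => rfl, h1⟩⟩,
        Or.inr ((hVs' _ _).2 ⟨fun _ => rfl, h1⟩), ?_⟩
      rintro rfl
      simp at h
  · intro β' γ h h1
    exact (hVs3 _ _).2 ⟨h, Or.inl ((hVs' _ _).1 h1)⟩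
  · intro γ h
    obtain ⟨h0, ⟨h1, h2⟩ | ⟨h1, h2⟩⟩ := (hVs3 _ _).1 h
    · exact Or.inl (hzero γ h0 h1 h2)
    · right
      have h3 := hzero (γ + q) (by
        rw [pauliSymplectic_add_left, h0, pauliSymplectic_self, add_zero]) h1 h2
      funext k
      have h4 := congrFun h3 k
      exact Prod.ext (CharTwo.add_eq_zero.1 (congrArg Prod.fst h4))
        (CharTwo.add_eq_zero.1 (congrArg Prod.snd h4))
  · refine ⟨fun u v => if ∀ k, u (ι k) = v (ι k) then f (u a) * f (v a) else 0, κ, hκ,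
      fun u v => ?_, fun u v => ?_⟩
    · have hprod : ∀ F : Fin n → ℂ, ∏ k with k ∉ Set.range ι, F k = F a := by
        intro F
        have : (Finset.univ.filter fun k => k ∉ Set.range ι) = {a} := by
          ext k; rw [Finset.mem_filter, hrange]; simp
        rw [this, Finset.prod_singleton]
      have hact : ∀ w, pauliAct (Sum.elim 0 q) (capTensor ι f) (Sum.elim w v) =
          sgn (∑ a, (q a).2 * v a) * capTensor ι f (Sum.elim w fun a => v a + (q a).1) := by
        intro w
        rw [pauliAct, Fintype.sum_sum_type]
        simp only [Sum.elim_inl, Sum.elim_inr, Pi.zero_apply, Prod.snd_zero, zero_mul,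
          Finset.sum_const_zero, zero_add]
        congr 2
        funext k
        cases k <;> simp
      simp only [Pi.add_apply, Pi.smul_apply, smul_eq_mul, hact, mul_add, Finset.sum_add_distrib]
      rw [sum_capTensor, hprod]
      congr 1
      rw [← hprod fun k => f (u k) * f (v k + (q k).1), ← sum_capTensor ι f u fun a => v a + (q a).1,
        Finset.mul_sum]
      exact Finset.sum_congr rfl fun w _ => by ring
    · simp only [add_left_inj]
      by_cases h : ∀ k, u (ι k) = v (ι k)
      -- Where `u` and `v` agree off `a`, conjugation by `q` is visible on wire `a` alone, and
      -- `exists_cap` applies.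
      · have h1 : ∑ k, (q k).2 * (u k + v k) = (q a).2 * (u a + v a) := by
          refine Fintype.sum_eq_single a fun k hk => ?_
          obtain ⟨k', rfl⟩ := not_not.1 ((not_congr (hrange k)).2 hk)
          rw [h, ZMod.two_add_self, mul_zero]
        rw [if_pos h, if_pos h, h1, hff]
        exact ite_congr_iff ⟨fun h' => hext u v h h', fun h' => by rw [h']⟩ rfl
      · rw [if_neg h, if_neg h, mul_zero, add_zero, if_neg]
        rintro rfl
        exact h fun _ => rfl

end Reduction

end

noncomputable section

open scoped Classical

/-! ### Contraction of the bonds of a layout -/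

/-- The bonds between different locations. -/
abbrev Bond (I : Type) : Type := {e : Sym2 I // ¬ e.IsDiag}

/-- The ends of the bonds. -/
abbrev BondEnd (I : Type) : Type := Σ e : Bond I, {i // i ∈ e.1}

/-- The end at `i` of the bond between `i` and `j`. -/
abbrev bondEnd {I : Type} (i : I) (j : {j // i ≠ j}) : BondEnd I :=
  ⟨⟨s(i, j.1), by simpa using j.2⟩, ⟨i, Sym2.mem_mk_left _ _⟩⟩

/-- Every end of a bond is determined by the location at which it lies and the opposite one. -/
def bondEndEquiv (I : Type) : (Σ i : I, {j // i ≠ j}) ≃ BondEnd I :=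
  Equiv.ofBijective (fun d => bondEnd d.1 d.2) <| by
    constructor
    · rintro ⟨i, j, hj⟩ ⟨i', j', hj'⟩ h
      have h1 : s(i, j) = s(i', j') := congrArg (fun d : BondEnd I => d.1.1) h
      obtain rfl : i = i' := congrArg (fun d : BondEnd I => d.2.1) h
      obtain rfl := Sym2.congr_right.1 h1
      rfl
    · rintro ⟨⟨e, he⟩, i, hi⟩
      obtain ⟨j, rfl⟩ := id hi
      exact ⟨⟨i, j, by simpa using he⟩, rfl⟩

/-- Families over all bond ends, sorted by location. -/
def bondEndPiEquiv {I : Type} (F : BondEnd I → Type) :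
    (∀ d, F d) ≃ ∀ i (j : {j // i ≠ j}), F (bondEnd i j) :=
  (Equiv.piCongrLeft F (bondEndEquiv I)).symm.trans (Equiv.piCurry fun i j => F (bondEnd i j))

theorem prod_mem_sym2 {I M : Type} [CommMonoid M] {i j : I} (hij : i ≠ j)
    [Fintype {k // k ∈ s(i, j)}] (f : {k // k ∈ s(i, j)} → M) :
    ∏ k, f k = f ⟨i, Sym2.mem_mk_left _ _⟩ * f ⟨j, Sym2.mem_mk_right _ _⟩ := by
  rw [← Finset.prod_pair (f := f) fun h => hij (congrArg Subtype.val h)]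
  refine Finset.prod_congr (Finset.ext ?_) fun _ _ => rfl
  rintro ⟨k, hk⟩
  simpa using hk

theorem sum_prod_sym2 {I : Type} {i j : I} (hij : i ≠ j) {X : Type} [Fintype X]
    [Fintype {k // k ∈ s(i, j)}] (f : X → {k // k ∈ s(i, j)} → ℂ) :
    ∑ b, ∏ k, f b k =
      ∑ b, f b ⟨i, Sym2.mem_mk_left _ _⟩ * f b ⟨j, Sym2.mem_mk_right _ _⟩ :=
  Finset.sum_congr rfl fun b _ => prod_mem_sym2 hij (f b)

theorem sum_ite_mul_ite {X : Type} [Fintype X] [DecidableEq X] (u v : X) :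
    ∑ b, (if b = u then (1 : ℂ) else 0) * (if b = v then 1 else 0) = if u = v then 1 else 0 := by
  simp [eq_comm]

section Contraction

variable {Q I : Type} [Fintype I] {site : Q → I} {ℓ m : Sym2 I → ℕ}

/-- The basis values on the legs of a gadget, from those on the open and on the internal legs. -/
def legBits (x : Q ⊕ Q → ZMod 2) {i : I} (y : ∀ j : {j // i ≠ j}, Fin (ℓ s(i, j.1)) → ZMod 2) :
    GadgetLeg site ℓ i → ZMod 2
  | .incoming q _ => x (Sum.inl q)
  | .outgoing q _ => x (Sum.inr q)
  | .internal j hj a => y ⟨j, hj⟩ a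

/-- The tensor obtained from the tensors of the gadgets by contracting all bonds. -/
def contract (T : ∀ i, (GadgetLeg site ℓ i → ZMod 2) → ℂ) (x : Q ⊕ Q → ZMod 2) : ℂ :=
  ∑ b : ∀ e : Bond I, Fin (ℓ e) → ZMod 2, ∏ i, T i (legBits x fun j => b (bondEnd i j).1)

theorem eval_diagram (G : GadgetLayout site ℓ) :
    G.diagram.eval = contract fun i => (G i).eval := by
  funext x
  refine (ZXDiagram.eval_connect _ _ _).trans ?_
  let E : (BondWire ℓ → ZMod 2) ≃ (∀ e : Bond I, Fin (ℓ e) → ZMod 2) :=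
    Equiv.piCurry fun (e : Bond I) (_ : Fin (ℓ e)) => ZMod 2
  have h : ∀ b : BondWire ℓ → ZMod 2, (ZXDiagram.sigma G).eval ((bondWiring site ℓ).spread x b) =
      ∏ i, (G i).eval (legBits x fun j => E b (bondEnd i j).1) := by
    intro b
    refine (ZXDiagram.eval_sigma G ((bondWiring site ℓ).spread x b)).trans ?_
    refine Finset.prod_congr rfl fun i _ => congrArg _ (funext fun a => ?_)
    cases a <;> rfl
  exact Finset.sum_bijective E E.bijective (fun _ => iff_of_true (@Finset.mem_univ _ (_) _)
    (@Finset.mem_univ _ (_) _)) fun b _ => h b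

/-- The internal legs of a gadget replaced by other internal legs. -/
def mixInternal {i : I} (x : GadgetLeg site m i → ZMod 2)
    (y : ∀ j : {j // i ≠ j}, Fin (ℓ s(i, j.1)) → ZMod 2) : GadgetLeg site ℓ i → ZMod 2
  | .incoming q hq => x (.incoming q hq)
  | .outgoing q hq => x (.outgoing q hq)
  | .internal j hj a => y ⟨j, hj⟩ a

/-- Apply to the tensor of a gadget a matrix on every bond. -/
def applyBond {i : I} (V : ∀ e, Matrix (Fin (m e) → ZMod 2) (Fin (ℓ e) → ZMod 2) ℂ)
    (T : (GadgetLeg site ℓ i → ZMod 2) → ℂ) (x : GadgetLeg site m i → ZMod 2) : ℂ :=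
  ∑ y : (∀ j : {j // i ≠ j}, Fin (ℓ s(i, j.1)) → ZMod 2),
    (∏ j : {j // i ≠ j}, V s(i, j.1) (fun a => x (.internal j.1 j.2 a)) (y j)) * T (mixInternal x y)

theorem applyBondMatrices_eq {i : I} (U : ∀ e, Matrix (Fin (ℓ e) → ZMod 2) (Fin (ℓ e) → ZMod 2) ℂ)
    (T : (GadgetLeg site ℓ i → ZMod 2) → ℂ) :
    GadgetLayout.applyBondMatrices U T = applyBond U T := by
  funext x
  refine Finset.sum_congr rfl fun y _ => ?_
  have : GadgetLayout.setInternal x y = mixInternal x y := by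
    funext a; cases a <;> rfl
  rw [this]

theorem applyBond_legBits {i : I} (V : ∀ e, Matrix (Fin (m e) → ZMod 2) (Fin (ℓ e) → ZMod 2) ℂ)
    (T : (GadgetLeg site ℓ i → ZMod 2) → ℂ) (x : Q ⊕ Q → ZMod 2)
    (z : ∀ j : {j // i ≠ j}, Fin (m s(i, j.1)) → ZMod 2) :
    applyBond V T (legBits x z) = ∑ y : (∀ j : {j // i ≠ j}, Fin (ℓ s(i, j.1)) → ZMod 2),
      (∏ j : {j // i ≠ j}, V s(i, j.1) (z j) (y j)) * T (legBits x y) := by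
  refine Finset.sum_congr rfl fun y _ => ?_
  have : mixInternal (legBits x z : GadgetLeg site m i → ZMod 2) y =
      (legBits x y : GadgetLeg site ℓ i → ZMod 2) := by
    funext a; cases a <;> rfl
  rw [this]
  rfl

theorem applyBond_one {i : I} {V : ∀ e, Matrix (Fin (ℓ e) → ZMod 2) (Fin (ℓ e) → ZMod 2) ℂ}
    (hV : ∀ e u v, V e u v = if u = v then 1 else 0) (T : (GadgetLeg site ℓ i → ZMod 2) → ℂ) :
    applyBond V T = T := by
  funext x
  refine (Fintype.sum_eq_single (fun j a => x (.internal j.1 j.2 a)) fun y hy => ?_).trans ?_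
  · obtain ⟨j, hj⟩ := Function.ne_iff.1 hy
    have h : V s(i, j.1) (fun a => x (.internal j.1 j.2 a)) (y j) = 0 := by
      rw [hV, if_neg hj.symm]
    rw [Finset.prod_eq_zero (Finset.mem_univ j) h, zero_mul]
  · have h : ∀ j : {j // i ≠ j}, V s(i, j.1) (fun a => x (.internal j.1 j.2 a))
        (fun a => x (.internal j.1 j.2 a)) = 1 := fun j => by rw [hV, if_pos rfl]
    rw [Finset.prod_eq_one fun j _ => h j, one_mul]
    refine congrArg T (funext fun a => ?_)
    cases a <;> rfl

/-- The bits at the two ends of a bond become independent summation variables, coupled by one kernel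
per bond. Changes on the bonds can then be compared kernel by kernel; `contract_eq` is the case of
identity matrices. -/
theorem contract_applyBond (V : I → ∀ e, Matrix (Fin (m e) → ZMod 2) (Fin (ℓ e) → ZMod 2) ℂ)
    (T : ∀ i, (GadgetLeg site ℓ i → ZMod 2) → ℂ) (x : Q ⊕ Q → ZMod 2) :
    contract (fun i => applyBond (V i) (T i)) x =
      ∑ y : ∀ d : BondEnd I, Fin (ℓ d.1) → ZMod 2,
        (∏ i, T i (legBits x fun j => y (bondEnd i j))) *
        ∏ e : Bond I, ∑ b : Fin (m e) → ZMod 2, ∏ i : {i // i ∈ e.1}, V i e b (y ⟨e, i⟩) := by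
  have h1 : ∀ b : ∀ e : Bond I, Fin (m e) → ZMod 2,
      ∏ i, applyBond (V i) (T i) (legBits x fun j => b (bondEnd i j).1) =
      ∑ y : ∀ d : BondEnd I, Fin (ℓ d.1) → ZMod 2,
        (∏ i, T i (legBits x fun j => y (bondEnd i j))) *
        ∏ e : Bond I, ∏ i : {i // i ∈ e.1}, V i e (b e) (y ⟨e, i⟩) := by
    intro b
    simp only [applyBond_legBits]
    rw [Finset.prod_univ_sum, Fintype.piFinset_univ]
    refine Fintype.sum_equiv
      (bondEndPiEquiv fun d : BondEnd I => Fin (ℓ d.1) → ZMod 2).symm _ _ fun y => ?_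
    obtain ⟨y, rfl⟩ := (bondEndPiEquiv fun d : BondEnd I => Fin (ℓ d.1) → ZMod 2).surjective y
    rw [Equiv.symm_apply_apply, Finset.prod_mul_distrib, mul_comm]
    refine congrArg₂ _ rfl ?_
    let F : BondEnd I → ℂ := fun d => V d.2 d.1 (b d.1) (y d)
    refine (Fintype.prod_sigma' fun (i : I) (j : {j // i ≠ j}) => F (bondEnd i j)).symm.trans ?_
    refine Eq.trans ?_ (Fintype.prod_sigma' fun (e : Bond I) (i : {i // i ∈ e.1}) => F ⟨e, i⟩)
    exact Fintype.prod_equiv (bondEndEquiv I) _ _ fun _ => rfl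
  rw [contract, Finset.sum_congr rfl fun b _ => h1 b, Finset.sum_comm]
  refine Finset.sum_congr rfl fun y _ => ?_
  rw [← Finset.mul_sum, Finset.prod_univ_sum, Fintype.piFinset_univ]

theorem contract_eq (T : ∀ i, (GadgetLeg site ℓ i → ZMod 2) → ℂ) (x : Q ⊕ Q → ZMod 2) :
    contract T x = ∑ y : ∀ d : BondEnd I, Fin (ℓ d.1) → ZMod 2,
        (∏ i, T i (legBits x fun j => y (bondEnd i j))) *
        ∏ e : Bond I, ∑ b : Fin (ℓ e) → ZMod 2, ∏ i : {i // i ∈ e.1},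
          (if b = y ⟨e, i⟩ then 1 else 0) := by
  rw [← contract_applyBond (fun _ _ b y => if b = y then 1 else 0),
    funext fun i => applyBond_one (fun _ _ _ => rfl) (T i)]

theorem contract_smul (c : I → ℂ) (T : ∀ i, (GadgetLeg site ℓ i → ZMod 2) → ℂ) :
    contract (fun i => c i • T i) = (∏ i, c i) • contract T := by
  funext x
  simp only [contract, Pi.smul_apply, smul_eq_mul, Finset.prod_mul_distrib, Finset.mul_sum]

theorem ne_zero_of_contract_ne_zero {T : ∀ i, (GadgetLeg site ℓ i → ZMod 2) → ℂ}
    (h : contract T ≠ 0) (i : I) : T i ≠ 0 := by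
  intro h0
  refine h (funext fun x => Finset.sum_eq_zero fun b _ =>
    Finset.prod_eq_zero (Finset.mem_univ i) ?_)
  rw [h0]; rfl

end Contraction

end

noncomputable section

open scoped Classical

/-! ### Bond-local unitaries preserve spacetime equivalence -/

instance GadgetLeg.instFintype {Q I : Type} [Fintype Q] [Fintype I] (site : Q → I)
    (ℓ : Sym2 I → ℕ) (i : I) : Fintype (GadgetLeg site ℓ i) :=
  @Fintype.ofFinite _ <| Finite.of_injective
    (β := Q ⊕ Q ⊕ Σ j : I, Fin (ℓ s(i, j)))
    (fun l => match l with
      | .incoming q _ => Sum.inl q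
      | .outgoing q _ => Sum.inr (Sum.inl q)
      | .internal j _ a => Sum.inr (Sum.inr ⟨j, a⟩))
    (by
      rintro (⟨q, _⟩ | ⟨q, _⟩ | ⟨j, _, a⟩) (⟨q', _⟩ | ⟨q', _⟩ | ⟨j', _, a'⟩) h <;> cases h <;> rfl)

section Unitary

variable {Q I : Type} [Fintype I] {site : Q → I} {ℓ : Sym2 I → ℕ}

theorem applyBond_applyBond {i : I} {V W : ∀ e, Matrix (Fin (ℓ e) → ZMod 2) (Fin (ℓ e) → ZMod 2) ℂ}
    (h : ∀ e u v, ∑ w, W e u w * V e w v = if u = v then 1 else 0)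
    (T : (GadgetLeg site ℓ i → ZMod 2) → ℂ) : applyBond W (applyBond V T) = T := by
  refine Eq.trans ?_ (applyBond_one (V := fun e u v => if u = v then 1 else 0) (fun _ _ _ => rfl) T)
  funext x
  simp only [applyBond, Finset.mul_sum]
  rw [Finset.sum_comm]
  refine Finset.sum_congr rfl fun z _ => ?_
  simp only [← h]
  rw [Finset.prod_univ_sum, Fintype.piFinset_univ, Finset.sum_mul]
  refine Finset.sum_congr rfl fun y _ => ?_
  have : mixInternal (ℓ := ℓ) (mixInternal (ℓ := ℓ) x y) z = mixInternal x z := by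
    funext a; cases a <;> rfl
  rw [this, Finset.prod_mul_distrib, mul_assoc]
  rfl

/-- The number of independent spacetime stabilizers of a layout, in terms of those of the
gadgets. -/
theorem numSpacetimeStabilizers_diagram (G : GadgetLayout site ℓ) :
    G.diagram.numSpacetimeStabilizers = ∑ i, (G i).numSpacetimeStabilizers +
      Module.finrank (ZMod 2) ((ZXDiagram.sigma G).joinedStabilizers (bondWiring site ℓ)) := by
  refine (ZXDiagram.numSpacetimeStabilizers_connect _ _).trans ?_
  rw [ZXDiagram.numSpacetimeStabilizers_sigma]

theorem sum_conj_mul_of_mem_unitaryGroup {n : ℕ}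
    {U : Matrix (Fin n → ZMod 2) (Fin n → ZMod 2) ℂ}
    (hU : U ∈ Matrix.unitaryGroup (Fin n → ZMod 2) ℂ) (u v : Fin n → ZMod 2) :
    ∑ w, (starRingEnd ℂ) (U w u) * U w v = if u = v then 1 else 0 := by
  have h := congrFun (congrFun (Matrix.mem_unitaryGroup_iff'.1 hU) u) v
  rw [Matrix.mul_apply, Matrix.one_apply] at h
  exact h.trans (ite_congr_iff Iff.rfl rfl)

variable {U : I → ∀ e, Matrix (Fin (ℓ e) → ZMod 2) (Fin (ℓ e) → ZMod 2) ℂ}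

/-- On a bond the kernel is the sum of `U` times its conjugate, that is U†U = 1. -/
theorem contract_applyBond_unitary
    (hU : ∀ i e, U i e ∈ Matrix.unitaryGroup (Fin (ℓ e) → ZMod 2) ℂ)
    (hU' : ∀ i j, i ≠ j → U j s(i, j) = (U i s(i, j)).map star)
    (T : ∀ i, (GadgetLeg site ℓ i → ZMod 2) → ℂ) :
    contract (fun i => applyBond (U i) (T i)) = contract T := by
  funext x
  rw [contract_applyBond, contract_eq]
  refine Finset.sum_congr rfl fun y _ => congrArg _ (Finset.prod_congr rfl ?_)
  rintro ⟨e, he⟩ -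
  induction e using Sym2.ind with
  | _ i j =>
  have hij : i ≠ j := by simpa using he
  refine (sum_prod_sym2 hij _).trans (Eq.trans ?_ (sum_prod_sym2 hij _).symm)
  refine Eq.trans ?_ (sum_ite_mul_ite _ _).symm
  refine Eq.trans (Finset.sum_congr rfl fun b _ => ?_)
    ((sum_conj_mul_of_mem_unitaryGroup (hU i s(i, j)) _ _).trans (ite_congr_iff eq_comm rfl))
  rw [hU' i j hij, mul_comm]
  rfl

variable [Fintype Q]

/-- Moving a matrix to the other argument takes its adjoint. The involution `f` exchanges the
internal bits with the summation variable of `applyBond`. -/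
theorem braket_applyBond {i : I} {V W : ∀ e, Matrix (Fin (ℓ e) → ZMod 2) (Fin (ℓ e) → ZMod 2) ℂ}
    (h : ∀ e u v, W e u v = (starRingEnd ℂ) (V e v u)) (T T' : (GadgetLeg site ℓ i → ZMod 2) → ℂ) :
    braket T (applyBond V T') = braket (applyBond W T) T' := by
  simp only [braket, applyBond, map_sum, Finset.mul_sum, Finset.sum_mul]
  rw [← Fintype.sum_prod_type', ← Fintype.sum_prod_type']
  let f : (GadgetLeg site ℓ i → ZMod 2) × (∀ j : {j // i ≠ j}, Fin (ℓ s(i, j.1)) → ZMod 2) →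
      (GadgetLeg site ℓ i → ZMod 2) × (∀ j : {j // i ≠ j}, Fin (ℓ s(i, j.1)) → ZMod 2) :=
    fun x => (mixInternal x.1 x.2, fun j a => x.1 (.internal j.1 j.2 a))
  have hf : Function.Involutive f := by
    rintro ⟨x, y⟩
    refine Prod.ext (funext fun a => ?_) rfl
    cases a <;> rfl
  refine Fintype.sum_equiv hf.toPerm _ _ ?_
  rintro ⟨x, y⟩
  have hx : mixInternal (mixInternal x y) (fun j a => x (.internal j.1 j.2 a)) = x :=
    congrArg Prod.fst (hf (x, y))
  change (starRingEnd ℂ) (T x) * ((∏ j : {j // i ≠ j}, V s(i, j.1)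
      (fun a => x (.internal j.1 j.2 a)) (y j)) * T' (mixInternal x y)) =
    (starRingEnd ℂ) ((∏ j : {j // i ≠ j}, W s(i, j.1) (y j)
      (fun a => x (.internal j.1 j.2 a))) * T (mixInternal (mixInternal x y)
        (fun j a => x (.internal j.1 j.2 a)))) * T' (mixInternal x y)
  rw [hx, map_mul, map_prod]
  simp only [h, Complex.conj_conj]
  ring

theorem braket_applyBond_unitary
    (hU : ∀ i e, U i e ∈ Matrix.unitaryGroup (Fin (ℓ e) → ZMod 2) ℂ) {i : I}
    (T : (GadgetLeg site ℓ i → ZMod 2) → ℂ) :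
    braket (applyBond (U i) T) (applyBond (U i) T) = braket T T := by
  rw [braket_applyBond (W := fun e u v => (starRingEnd ℂ) (U i e v u)) (fun _ _ _ => rfl)]
  exact congrArg (braket · T)
    (applyBond_applyBond (fun e u v => sum_conj_mul_of_mem_unitaryGroup (hU i e) u v) T)

theorem braket_eval_sigma (G : GadgetLayout site ℓ) :
    braket (ZXDiagram.sigma G).eval (ZXDiagram.sigma G).eval =
      ∏ i, braket (G i).eval (G i).eval := by
  simp only [braket]
  rw [Finset.prod_univ_sum, Fintype.piFinset_univ]
  let E : ((Σ i, GadgetLeg site ℓ i) → ZMod 2) ≃ ∀ i, GadgetLeg site ℓ i → ZMod 2 :=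
    Equiv.piCurry fun i (_ : GadgetLeg site ℓ i) => ZMod 2
  refine Finset.sum_bijective E E.bijective (fun _ => iff_of_true (@Finset.mem_univ _ (_) _)
    (@Finset.mem_univ _ (_) _)) fun x _ => ?_
  rw [ZXDiagram.eval_sigma, map_prod, ← Finset.prod_mul_distrib]
  rfl

/-- The numbers inside the gadgets agree by definition, so only the dimension of the joined
stabilizers is at stake. A general unitary need not map Pauli webs to Pauli webs, but it preserves
the two norms that determine this dimension. -/
theorem GadgetLayout.BondLocalUnitaryEquiv.diagram {G G' : GadgetLayout site ℓ}
    (h : G.BondLocalUnitaryEquiv G') (hG : G.diagram.eval ≠ 0) :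
    G.diagram.SameMap G'.diagram ∧
      G.diagram.numSpacetimeStabilizers = G'.diagram.numSpacetimeStabilizers := by
  obtain ⟨U, hU, hU', h⟩ := h
  have hc := fun i => (h i).1
  choose c hc0 hc using hc
  have e1 : G'.diagram.eval = (∏ i, c i) • G.diagram.eval := by
    rw [eval_diagram, eval_diagram, funext hc, contract_smul]
    simp only [applyBondMatrices_eq]
    rw [contract_applyBond_unitary hU hU']
  have hG' : G'.diagram.eval ≠ 0 := by
    rw [e1]
    exact smul_ne_zero (Finset.prod_ne_zero_iff.2 fun i _ => hc0 i) hG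
  refine ⟨⟨_, Finset.prod_ne_zero_iff.2 fun i _ => hc0 i, e1⟩, ?_⟩
  rw [numSpacetimeStabilizers_diagram, numSpacetimeStabilizers_diagram,
    Finset.sum_congr rfl fun i _ => (h i).2]
  refine congrArg _ (Nat.pow_right_injective (le_refl 2) ?_)
  -- The scalars `c i` rescale the norm of the product of gadgets and the norm of the contraction by
  -- the same factor, which therefore cancels.
  have e2 : braket (ZXDiagram.sigma G').eval (ZXDiagram.sigma G').eval =
      (∏ i, (starRingEnd ℂ) (c i) * c i) *
        braket (ZXDiagram.sigma G).eval (ZXDiagram.sigma G).eval := by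
    rw [braket_eval_sigma, braket_eval_sigma, ← Finset.prod_mul_distrib]
    refine Finset.prod_congr rfl fun i _ => ?_
    rw [hc, applyBondMatrices_eq, braket_smul_left, braket_smul_right, braket_applyBond_unitary hU,
      mul_assoc]
  have e3 : braket G'.diagram.eval G'.diagram.eval =
      (∏ i, (starRingEnd ℂ) (c i) * c i) * braket G.diagram.eval G.diagram.eval := by
    rw [e1, braket_smul_left, braket_smul_right, map_prod, Finset.prod_mul_distrib, mul_assoc]
  have h1 := ZXDiagram.braket_eval_connect (ZXDiagram.sigma G) (bondWiring site ℓ) hG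
  have h2 := ZXDiagram.braket_eval_connect (ZXDiagram.sigma G') (bondWiring site ℓ) hG'
  change _ * braket G.diagram.eval G.diagram.eval = _ at h1
  change _ * braket G'.diagram.eval G'.diagram.eval = _ at h2
  have hB : braket (ZXDiagram.sigma G).eval (ZXDiagram.sigma G).eval ≠ 0 := by
    intro h0
    rw [h0, mul_zero] at h1
    exact mul_ne_zero (pow_ne_zero _ two_ne_zero) (braket_self_ne_zero hG) h1
  have hγ : ∏ i, (starRingEnd ℂ) (c i) * c i ≠ 0 :=
    Finset.prod_ne_zero_iff.2 fun i _ => mul_ne_zero ((map_ne_zero _).2 (hc0 i)) (hc0 i)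
  have h3 : (2 : ℂ) ^ Module.finrank (ZMod 2)
      ((ZXDiagram.sigma G).joinedStabilizers (bondWiring site ℓ)) =
      2 ^ Module.finrank (ZMod 2)
      ((ZXDiagram.sigma G').joinedStabilizers (bondWiring site ℓ)) := by
    refine mul_right_cancel₀ (mul_ne_zero hγ hB) ?_
    rw [e2, e3] at h2
    rw [← h2, mul_left_comm, ← h1]
    ring
  exact_mod_cast h3

end Unitary

end

noncomputable section

open scoped Classical

/-! ### Attaching diagrams to the bonds of a gadget -/

section Attach

variable {Q I : Type} [Fintype I] {site : Q → I} {ℓ m : Sym2 I → ℕ} {i : I}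

/-- The wiring that joins the internal legs of a gadget to a diagram on every bond. -/
def attachWiring (site : Q → I) (ℓ m : Sym2 I → ℕ) (i : I) :
    Wiring (GadgetLeg site ℓ i ⊕ Σ j : {j // i ≠ j}, Fin (m s(i, j.1)) ⊕ Fin (ℓ s(i, j.1)))
      (GadgetLeg site m i) (Σ j : {j // i ≠ j}, Fin (ℓ s(i, j.1))) where
  toFun a := match a with
    | Sum.inl (.incoming q h) => Sum.inl (.incoming q h)
    | Sum.inl (.outgoing q h) => Sum.inl (.outgoing q h)
    | Sum.inl (.internal j h a) => Sum.inr ⟨⟨j, h⟩, a⟩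
    | Sum.inr ⟨j, Sum.inl a⟩ => Sum.inl (.internal j.1 j.2 a)
    | Sum.inr ⟨j, Sum.inr a⟩ => Sum.inr ⟨j, a⟩
  open_unique := by
    rintro (⟨q, h⟩ | ⟨q, h⟩ | ⟨j, h, a⟩)
    · refine ⟨Sum.inl (.incoming q h), rfl, ?_⟩
      rintro ((⟨q', h'⟩ | ⟨q', h'⟩ | ⟨j', h', a'⟩) | ⟨j', a' | a'⟩) e <;> cases e
      rfl
    · refine ⟨Sum.inl (.outgoing q h), rfl, ?_⟩
      rintro ((⟨q', h'⟩ | ⟨q', h'⟩ | ⟨j', h', a'⟩) | ⟨j', a' | a'⟩) e <;> cases e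
      rfl
    · refine ⟨Sum.inr ⟨⟨j, h⟩, Sum.inl a⟩, rfl, ?_⟩
      rintro ((⟨q', h'⟩ | ⟨q', h'⟩ | ⟨j', h', a'⟩) | ⟨j', a' | a'⟩) e <;> cases e
      rfl
  joined_pair := by
    rintro ⟨⟨j, h⟩, a⟩
    refine ⟨Sum.inl (.internal j h a), Sum.inr ⟨⟨j, h⟩, Sum.inr a⟩, Sum.inl_ne_inr, ?_⟩
    rintro ((⟨q', h'⟩ | ⟨q', h'⟩ | ⟨j', h', a'⟩) | ⟨j', a' | a'⟩) <;> constructor <;> intro e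
    all_goals first
      | (cases e; done)
      | (cases e; exact Or.inl rfl)
      | (cases e; exact Or.inr rfl)
      | (rcases e with e | e <;> cases e; done)
      | (rcases e with e | e <;> cases e; rfl)

/-- Attach a diagram to every bond of a gadget. -/
def ZXDiagram.attach (G : ZXDiagram (GadgetLeg site ℓ i))
    (W : ∀ e, ZXDiagram (Fin (m e) ⊕ Fin (ℓ e))) : ZXDiagram (GadgetLeg site m i) :=
  (G.union (ZXDiagram.sigma fun j : {j // i ≠ j} => W s(i, j.1))).connect
    (attachWiring site ℓ m i)

/-- A tensor on two groups of legs as a matrix. -/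
def bondMatrix {a b : ℕ} (V : (Fin a ⊕ Fin b → ZMod 2) → ℂ) :
    Matrix (Fin a → ZMod 2) (Fin b → ZMod 2) ℂ :=
  Matrix.of fun u v => V (Sum.elim u v)

theorem eval_attach (G : ZXDiagram (GadgetLeg site ℓ i))
    (W : ∀ e, ZXDiagram (Fin (m e) ⊕ Fin (ℓ e))) :
    (G.attach W).eval = applyBond (fun e => bondMatrix (W e).eval) G.eval := by
  funext x
  refine (ZXDiagram.eval_connect _ _ _).trans ?_
  let E : ((Σ j : {j // i ≠ j}, Fin (ℓ s(i, j.1))) → ZMod 2) ≃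
      (∀ j : {j // i ≠ j}, Fin (ℓ s(i, j.1)) → ZMod 2) :=
    Equiv.piCurry fun (j : {j // i ≠ j}) (_ : Fin (ℓ s(i, j.1))) => ZMod 2
  refine Finset.sum_bijective E E.bijective (fun _ => iff_of_true (@Finset.mem_univ _ (_) _)
    (@Finset.mem_univ _ (_) _)) fun b _ => ?_
  refine (ZXDiagram.eval_union _ _ _).trans ((congrArg (_ * ·) (ZXDiagram.eval_sigma _ _)).trans ?_)
  rw [mul_comm]
  refine congrArg₂ (· * ·) (Finset.prod_congr rfl fun j _ => congrArg _ (funext fun a => ?_))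
    (congrArg _ (funext fun a => ?_))
  · cases a <;> rfl
  · cases a <;> rfl

/-- A gadget sees only the bonds at its own location, while bond operators are families over all of
`Sym2 I`. Values elsewhere do not matter and are set to the default. -/
theorem exists_pi_extend {A B : Type} {F : B → Type} [∀ b, Inhabited (F b)] {f : A → B}
    (hf : Function.Injective f) (γ : ∀ a, F (f a)) : ∃ γ' : ∀ b, F b, ∀ a, γ' (f a) = γ a := by
  refine ⟨fun b => if h : ∃ a, f a = b then h.choose_spec ▸ γ h.choose else default, fun a => ?_⟩
  have h : ∃ a', f a' = f a := ⟨a, rfl⟩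
  refine (dif_pos h).trans ?_
  have key : ∀ a' (e : f a' = f a), e ▸ γ a' = γ a := by
    intro a' e
    obtain rfl := hf e
    rfl
  exact key _ _

theorem isStabilizer_attach (G : ZXDiagram (GadgetLeg site ℓ i))
    (W : ∀ e, ZXDiagram (Fin (m e) ⊕ Fin (ℓ e))) (s s' : Q → Pauli)
    (β' : ∀ e, Fin (m e) → Pauli) :
    (G.attach W).IsStabilizer (GadgetLayout.legPauli s s' β' i) ↔
      ∃ γ : ∀ e, Fin (ℓ e) → Pauli, G.IsStabilizer (GadgetLayout.legPauli s s' γ i) ∧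
        ∀ j, i ≠ j → (W s(i, j)).IsStabilizer (Sum.elim (β' s(i, j)) (γ s(i, j))) := by
  refine (ZXDiagram.isStabilizer_connect _ _ _).trans ?_
  have key : ∀ (β : (Σ j : {j // i ≠ j}, Fin (ℓ s(i, j.1))) → Pauli)
      (γ : ∀ e, Fin (ℓ e) → Pauli), (∀ j a, β ⟨j, a⟩ = γ s(i, j.1) a) →
      ((G.union (ZXDiagram.sigma fun j : {j // i ≠ j} => W s(i, j.1))).IsStabilizer
        ((attachWiring site ℓ m i).spread (GadgetLayout.legPauli s s' β' i) β) ↔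
      G.IsStabilizer (GadgetLayout.legPauli s s' γ i) ∧
        ∀ j, i ≠ j → (W s(i, j)).IsStabilizer (Sum.elim (β' s(i, j)) (γ s(i, j)))) := by
    intro β γ h
    refine (ZXDiagram.isStabilizer_union _ _ _).trans (and_congr ?_ ?_)
    · refine iff_of_eq (congrArg _ (funext fun a => ?_))
      cases a
      · rfl
      · rfl
      · exact h _ _
    · refine (ZXDiagram.isStabilizer_sigma _ _).trans (Subtype.forall.trans ?_)
      refine forall₂_congr fun j hj => iff_of_eq (congrArg _ (funext fun a => ?_))
      cases a
      · rfl
      · exact h ⟨j, hj⟩ _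
  constructor
  · rintro ⟨β, hβ⟩
    obtain ⟨γ, hγ⟩ := exists_pi_extend (F := fun e => Fin (ℓ e) → Pauli)
      (f := fun j : {j // i ≠ j} => s(i, j.1))
      (fun j j' h => Subtype.ext (Sym2.congr_right.1 h)) fun j a => β ⟨j, a⟩
    exact ⟨γ, (key β γ fun j a => (congrFun (hγ j) a).symm).1 hβ⟩
  · rintro ⟨γ, hγ⟩
    exact ⟨fun a => γ s(i, a.1.1) a.2, (key _ γ fun _ _ => rfl).2 hγ⟩

end Attach

end

noncomputable section

open scoped Classical

/-! ### Reduction of a layout along a stabilizer supported on one bond -/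

section LayoutReduction

variable {Q I : Type} {site : Q → I} {ℓ m : Sym2 I → ℕ} {i₀ j₀ : I}
  {P : ∀ e, Fin (ℓ e) → Pauli} {c : Sym2 I → ℂ} {V V' : ∀ e, (Fin (m e) ⊕ Fin (ℓ e) → ZMod 2) → ℂ}

/-- Bond reductions on all bonds that are trivial except on the bond between `i₀` and `j₀`. -/
structure IsLayoutReduction (i₀ j₀ : I) (P : ∀ e, Fin (ℓ e) → Pauli) (c : Sym2 I → ℂ)
    (V V' : ∀ e, (Fin (m e) ⊕ Fin (ℓ e) → ZMod 2) → ℂ) : Prop where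
  ne : i₀ ≠ j₀
  eq_zero : ∀ e, e ≠ s(i₀, j₀) → P e = 0
  eq_one : ∀ e, e ≠ s(i₀, j₀) → c e = 1
  eq : ∀ e, e ≠ s(i₀, j₀) → V e = V' e
  bond : ∀ e, IsBondReduction (P e) (c e) (V e) (V' e)

theorem exists_isLayoutReduction (h : i₀ ≠ j₀) {q : Fin (ℓ s(i₀, j₀)) → Pauli} (hq : q ≠ 0) {c₀ : ℂ}
    (hc : c₀ * c₀ = sgn (∑ a, (q a).2 * (q a).1)) :
    ∃ m : Sym2 I → ℕ, m ≤ ℓ ∧ m s(i₀, j₀) < ℓ s(i₀, j₀) ∧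
      ∃ V V' : ∀ e, (Fin (m e) ⊕ Fin (ℓ e) → ZMod 2) → ℂ, IsLayoutReduction i₀ j₀
        (Function.update 0 s(i₀, j₀) q) (Function.update 1 s(i₀, j₀) c₀) V V' := by
  have h1 : ∀ e, ∃ m ≤ ℓ e, (e = s(i₀, j₀) → m < ℓ e) ∧
      ∃ V V' : (Fin m ⊕ Fin (ℓ e) → ZMod 2) → ℂ, (e ≠ s(i₀, j₀) → V = V') ∧
        IsBondReduction ((Function.update 0 s(i₀, j₀) q : ∀ e, Fin (ℓ e) → Pauli) e)
          ((Function.update 1 s(i₀, j₀) c₀ : Sym2 I → ℂ) e) V V' := by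
    intro e
    rcases eq_or_ne e s(i₀, j₀) with rfl | he
    · obtain ⟨m, hm, V, V', hV⟩ := exists_isBondReduction q hq c₀ hc
      refine ⟨m, hm.le, fun _ => hm, V, V', fun h => (h rfl).elim, ?_⟩
      rwa [Function.update_self, Function.update_self]
    · refine ⟨ℓ e, le_refl _, fun h => (he h).elim, capTensor id 1, capTensor id 1, fun _ => rfl, ?_⟩
      rw [Function.update_of_ne he, Function.update_of_ne he]
      exact isBondReduction_id _
  choose m hm hm' V V' hV hred using h1
  exact ⟨m, hm, hm' _ rfl, V, V', h, fun e he => Function.update_of_ne he _ _,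
    fun e he => Function.update_of_ne he _ _, hV, hred⟩

/-- The tensors that are applied at the location `i`. -/
def reduceAt (i₀ : I) (V V' : ∀ e, (Fin (m e) ⊕ Fin (ℓ e) → ZMod 2) → ℂ) (i : I) (e : Sym2 I) :
    (Fin (m e) ⊕ Fin (ℓ e) → ZMod 2) → ℂ :=
  if i = i₀ then V e else V' e

theorem sum_gadgetLeg [Fintype Q] [Fintype I] {M : Type} [AddCommMonoid M] {i j : I} (hj : i ≠ j)
    (f : GadgetLeg site ℓ i → M)
    (h1 : ∀ q hq, f (.incoming q hq) = 0) (h2 : ∀ q hq, f (.outgoing q hq) = 0)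
    (h3 : ∀ k hk a, k ≠ j → f (.internal k hk a) = 0) :
    ∑ a, f a = ∑ a, f (.internal j hj a) := by
  refine (Fintype.sum_of_injective (fun a => GadgetLeg.internal j hj a) ?_ _ f ?_
    fun _ => rfl).symm
  · intro a a' h
    cases h; rfl
  · rintro (⟨q, hq⟩ | ⟨q, hq⟩ | ⟨k, hk, a⟩) h
    · exact h1 q hq
    · exact h2 q hq
    · refine h3 k hk a ?_
      rintro rfl
      exact h ⟨a, rfl⟩

namespace IsLayoutReduction

theorem reduceAt_of_ne (h : IsLayoutReduction i₀ j₀ P c V V') {e : Sym2 I} (he : e ≠ s(i₀, j₀))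
    (i : I) : reduceAt i₀ V V' i e = V' e := by
  rw [reduceAt, h.eq e he, ite_self]

theorem sum_legPauli [Fintype Q] [Fintype I] (h : IsLayoutReduction i₀ j₀ P c V V')
    {M : Type} [AddCommMonoid M] (f : GadgetLeg site ℓ i₀ → Pauli → M) (hf : ∀ a, f a 0 = 0) :
    ∑ a, f a (GadgetLayout.legPauli 0 0 P i₀ a) =
      ∑ a, f (.internal j₀ h.ne a) (P s(i₀, j₀) a) := by
  refine sum_gadgetLeg h.ne _ (fun _ _ => hf _) (fun _ _ => hf _) fun k hk a hkj => ?_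
  rw [GadgetLayout.legPauli, h.eq_zero _ fun h => hkj (Sym2.congr_right.1 h)]
  exact hf _

theorem exists_sum_reduceAt (h : IsLayoutReduction i₀ j₀ P c V V') (e : Bond I)
    (he : e.1 ≠ s(i₀, j₀)) [Fintype {i // i ∈ e.1}] : ∃ κ : ℂ, κ ≠ 0 ∧
      ∀ y : {i // i ∈ e.1} → Fin (ℓ e) → ZMod 2,
        ∑ b, ∏ i, reduceAt i₀ V V' i.1 e (Sum.elim b (y i)) =
        κ * ∑ b, ∏ i, if b = y i then 1 else 0 := by
  obtain ⟨g, κ, hκ, h1, h2⟩ := (h.bond e).contraction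
  refine ⟨κ, hκ, fun y => ?_⟩
  simp only [h.reduceAt_of_ne he]
  simp only [h.eq _ he, h.eq_zero _ he, h.eq_one _ he, Pi.zero_apply, Prod.snd_zero, zero_mul,
    Finset.sum_const_zero, sgn_zero, Prod.fst_zero, add_zero, inv_one, one_mul] at h1 h2
  obtain ⟨e, he'⟩ := e
  induction e using Sym2.ind with
  | _ i j =>
  have hij : i ≠ j := by simpa using he'
  refine (sum_prod_sym2 hij _).trans ?_
  rw [h1, h2]
  refine Eq.trans ?_ (congrArg (κ * ·) ((sum_prod_sym2 hij _).trans (sum_ite_mul_ite _ _))).symm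
  rw [mul_ite, mul_one, mul_zero]

/-- On bonds other than that of `i₀` and `j₀` the reduction only rescales the identity kernel. On
this bond the eigenvalue equation at `i₀` turns the kernel of `IsBondReduction.contraction` into a
multiple of the identity kernel. -/
theorem contract_eq [Fintype Q] [Fintype I] (h : IsLayoutReduction i₀ j₀ P c V V')
    (T : ∀ i, (GadgetLeg site ℓ i → ZMod 2) → ℂ) (hc : c s(i₀, j₀) ≠ 0)
    (hT : pauliAct (GadgetLayout.legPauli 0 0 P i₀) (T i₀) = c s(i₀, j₀) • T i₀) :
    ∃ κ : ℂ, κ ≠ 0 ∧ contract (fun i => applyBond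
      (fun e => bondMatrix (reduceAt i₀ V V' i e)) (T i)) = κ • contract T := by
  have he₀ : ¬ (s(i₀, j₀)).IsDiag := by simpa using h.ne
  let e₀ : Bond I := ⟨s(i₀, j₀), he₀⟩
  obtain ⟨g, κ₀, hκ₀, hg1, hg2⟩ := (h.bond s(i₀, j₀)).contraction
  have hδ : ∀ e : Bond I, ∃ κ : ℂ, κ ≠ 0 ∧ (e ≠ e₀ →
      ∀ y : {i // i ∈ e.1} → Fin (ℓ e) → ZMod 2,
        ∑ b, ∏ i, reduceAt i₀ V V' i.1 e (Sum.elim b (y i)) =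
        κ * ∑ b, ∏ i, if b = y i then 1 else 0) := by
    intro e
    by_cases he : e = e₀
    · exact ⟨1, one_ne_zero, fun h => (h he).elim⟩
    · obtain ⟨κ, hκ, h1⟩ := h.exists_sum_reduceAt e fun h => he (Subtype.ext h)
      exact ⟨κ, hκ, fun _ => h1⟩
  choose κ hκ hδ using hδ
  refine ⟨κ₀ * ∏ e ∈ Finset.univ.erase e₀, κ e,
    mul_ne_zero hκ₀ (Finset.prod_ne_zero_iff.2 fun e _ => hκ e), funext fun x => ?_⟩
  let R : (∀ d : BondEnd I, Fin (ℓ d.1) → ZMod 2) → ℂ := fun y => ∏ e ∈ Finset.univ.erase e₀,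
    ∑ b : Fin (ℓ e) → ZMod 2, ∏ i : {i // i ∈ e.1}, if b = y ⟨e, i⟩ then 1 else 0
  let Φ : (∀ d : BondEnd I, Fin (ℓ d.1) → ZMod 2) → ℂ := fun y =>
    ∏ i, T i (legBits x fun j => y (bondEnd i j))
  let u : (∀ d : BondEnd I, Fin (ℓ d.1) → ZMod 2) → Fin (ℓ s(i₀, j₀)) → ZMod 2 := fun y =>
    y ⟨e₀, ⟨i₀, Sym2.mem_mk_left _ _⟩⟩
  let v : (∀ d : BondEnd I, Fin (ℓ d.1) → ZMod 2) → Fin (ℓ s(i₀, j₀)) → ZMod 2 := fun y =>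
    y ⟨e₀, ⟨j₀, Sym2.mem_mk_right _ _⟩⟩
  let q := P s(i₀, j₀)
  have hK : ∀ y : ∀ d : BondEnd I, Fin (ℓ d.1) → ZMod 2,
      ∏ e : Bond I, ∑ b, ∏ i : {i // i ∈ e.1}, reduceAt i₀ V V' i e (Sum.elim b (y ⟨e, i⟩)) =
      (g (u y) (v y) + (c s(i₀, j₀))⁻¹ * sgn (∑ a, (q a).2 * v y a) *
        g (u y) fun a => v y a + (q a).1) * ((∏ e ∈ Finset.univ.erase e₀, κ e) * R y) := by
    intro y
    rw [← Finset.mul_prod_erase _ _ (Finset.mem_univ e₀), ← Finset.prod_mul_distrib]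
    refine congrArg₂ _ ?_ (Finset.prod_congr rfl fun e he =>
      hδ e (Finset.ne_of_mem_erase he) fun i => y ⟨e, i⟩)
    refine ((sum_prod_sym2 h.ne _).trans ?_).trans (hg1 (u y) (v y))
    refine Finset.sum_congr rfl fun b _ => ?_
    simp only [reduceAt, if_true, if_neg h.ne.symm]
    rfl
  have hI : ∀ y : ∀ d : BondEnd I, Fin (ℓ d.1) → ZMod 2,
      κ₀ * ∏ e : Bond I, ∑ b : Fin (ℓ e) → ZMod 2, ∏ i : {i // i ∈ e.1},
        (if b = y ⟨e, i⟩ then (1 : ℂ) else 0) =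
      (g (u y) (v y) + sgn (∑ a, (q a).2 * (u y a + v y a)) *
        g (fun a => u y a + (q a).1) fun a => v y a + (q a).1) * R y := by
    intro y
    rw [← Finset.mul_prod_erase _ _ (Finset.mem_univ e₀), ← mul_assoc, hg2]
    refine congrArg (· * R y) ?_
    refine (congrArg (κ₀ * ·) ((sum_prod_sym2 h.ne _).trans (sum_ite_mul_ite _ _))).trans ?_
    rw [mul_ite, mul_one, mul_zero]
  -- The `X` part of the stabilizer, acting only on the bond ends at `i₀`; it is zero off the
  -- reduced bond.
  let s : ∀ d : BondEnd I, Fin (ℓ d.1) → ZMod 2 := fun d a => if d.2.1 = i₀ then (P d.1 a).1 else 0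
  have hu : ∀ y, u (y + s) = fun a => u y a + (q a).1 := fun y => funext fun a =>
    congrArg (u y a + ·) (if_pos rfl)
  have hv : ∀ y, v (y + s) = v y := fun y => funext fun a =>
    (congrArg (v y a + ·) (if_neg h.ne.symm)).trans (add_zero _)
  have hR : ∀ y, R (y + s) = R y := by
    intro y
    refine Finset.prod_congr rfl fun e he => Finset.sum_congr rfl fun b _ =>
      Finset.prod_congr rfl fun i _ => ?_
    have h1 : s ⟨e, i⟩ = 0 := by
      funext a
      have : P e = 0 := h.eq_zero _ fun h => Finset.ne_of_mem_erase he (Subtype.ext h)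
      simp [s, this]
    rw [Pi.add_apply, h1, add_zero]
  have hΦ : ∀ y, sgn (∑ a, (q a).2 * u y a) * Φ (y + s) = c s(i₀, j₀) * Φ y := by
    intro y
    have h1 := congrFun hT (legBits x fun j => y (bondEnd i₀ j))
    rw [Pi.smul_apply, smul_eq_mul, pauliAct,
      h.sum_legPauli (fun a r => r.2 * legBits x (fun j => y (bondEnd i₀ j)) a)
        fun a => by simp] at h1
    have h2 : ∀ i, i ≠ i₀ → T i (legBits x fun j => (y + s) (bondEnd i j)) =
        T i (legBits x fun j => y (bondEnd i j)) := by
      intro i hi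
      refine congrArg _ (funext fun a => ?_)
      cases a with
      | incoming => rfl
      | outgoing => rfl
      | internal j hj a => exact (congrArg (y (bondEnd i ⟨j, hj⟩) a + ·) (if_neg hi)).trans (add_zero _)
    have h3 : T i₀ (legBits x fun j => (y + s) (bondEnd i₀ j)) =
        T i₀ fun a => legBits x (fun j => y (bondEnd i₀ j)) a +
          (GadgetLayout.legPauli 0 0 P i₀ a).1 := by
      refine congrArg _ (funext fun a => ?_)
      cases a with
      | incoming => exact (add_zero _).symm
      | outgoing => exact (add_zero _).symm
      | internal j hj a => exact congrArg (y (bondEnd i₀ ⟨j, hj⟩) a + ·) (if_pos rfl)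
    change _ * ∏ i, _ = _ * ∏ i, _
    rw [← Finset.mul_prod_erase _ _ (Finset.mem_univ i₀), h3,
      Finset.prod_congr rfl fun i hi => h2 i (Finset.ne_of_mem_erase hi), ← mul_assoc]
    refine (congrArg (· * _) h1).trans ?_
    rw [mul_assoc, Finset.mul_prod_erase _ (fun i => T i (legBits x fun j => y (bondEnd i j)))
      (Finset.mem_univ i₀)]
  -- Shifting the summation variable by `s` moves the first end by `q`, and the eigenvalue equation
  -- `hΦ` cancels c⁻¹ against a sign. This is the exchange of c⁻¹ for `q` at the first end.
  have key : ∑ y, Φ y * ((c s(i₀, j₀))⁻¹ * sgn (∑ a, (q a).2 * v y a) *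
        g (u y) fun a => v y a + (q a).1) * R y =
      ∑ y, Φ y * (sgn (∑ a, (q a).2 * (u y a + v y a)) *
        g (fun a => u y a + (q a).1) fun a => v y a + (q a).1) * R y := by
    refine (Equiv.sum_comp (Equiv.addRight s) _).symm.trans ?_
    refine Finset.sum_congr rfl fun y _ => ?_
    rw [Equiv.coe_addRight, hu, hv, hR]
    simp only [mul_add, Finset.sum_add_distrib, sgn_add]
    have h1 := hΦ y
    have h2 := sgn_mul_self (∑ a, (q a).2 * u y a)
    generalize sgn (∑ a, (q a).2 * u y a) = t at *
    have h3 : Φ (y + s) * (c s(i₀, j₀))⁻¹ = t * Φ y := by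
      have : Φ (y + s) = t * (c s(i₀, j₀) * Φ y) := by rw [← h1, ← mul_assoc, h2, one_mul]
      rw [this]
      field_simp
    rw [← mul_assoc, ← mul_assoc, h3]
    ring
  refine (contract_applyBond _ _ _).trans ?_
  rw [Pi.smul_apply, smul_eq_mul, _root_.contract_eq, mul_comm κ₀, mul_assoc, Finset.mul_sum]
  have h1 : ∀ y, κ₀ * (Φ y * ∏ e : Bond I, ∑ b : Fin (ℓ e) → ZMod 2, ∏ i : {i // i ∈ e.1},
        (if b = y ⟨e, i⟩ then (1 : ℂ) else 0)) = Φ y * g (u y) (v y) * R y +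
      Φ y * (sgn (∑ a, (q a).2 * (u y a + v y a)) *
        g (fun a => u y a + (q a).1) fun a => v y a + (q a).1) * R y := by
    intro y
    rw [mul_left_comm, hI]
    ring
  refine Eq.trans ?_ (congrArg (_ * ·) (Finset.sum_congr rfl fun y _ => (h1 y).symm))
  rw [Finset.sum_add_distrib, ← key, ← Finset.sum_add_distrib, Finset.mul_sum]
  refine Finset.sum_congr rfl fun y _ => ?_
  refine (congrArg (Φ y * ·) (hK y)).trans ?_
  ring

end IsLayoutReduction

end LayoutReduction

end

/-! ### Pauli webs under a layout reduction -/

noncomputable section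

open scoped Classical

section LayoutReduction

variable {Q I : Type} {site : Q → I} {ℓ m : Sym2 I → ℕ} {i₀ j₀ : I}
  {P : ∀ e, Fin (ℓ e) → Pauli} {c : Sym2 I → ℂ} {V V' : ∀ e, (Fin (m e) ⊕ Fin (ℓ e) → ZMod 2) → ℂ}

open GadgetLayout

theorem Pauli.add_self {A : Type} (p : A → Pauli) : p + p = 0 :=
  funext fun _ => Prod.ext (ZMod.two_add_self _) (ZMod.two_add_self _)

theorem Pauli.add_eq_iff {A : Type} {p q r : A → Pauli} : p + q = r ↔ p = q + r := by
  constructor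
  · rintro rfl
    rw [add_comm p, ← add_assoc, Pauli.add_self, zero_add]
  · rintro rfl
    rw [add_comm q, add_assoc, Pauli.add_self, add_zero]

theorem Pauli.elim_add_elim {A B : Type} (p p' : A → Pauli) (q q' : B → Pauli) :
    (Sum.elim p q + Sum.elim p' q' : A ⊕ B → Pauli) = Sum.elim (p + p') (q + q') := by
  funext a; cases a <;> rfl

theorem legPauli_add (s s' t t' : Q → Pauli) (β γ : ∀ e, Fin (ℓ e) → Pauli) (i : I) :
    (legPauli s s' β i + legPauli t t' γ i : GadgetLeg site ℓ i → Pauli) =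
      legPauli (s + t) (s' + t') (β + γ) i := by
  funext a; cases a <;> rfl

theorem legPauli_congr (s s' : Q → Pauli) {β γ : ∀ e, Fin (ℓ e) → Pauli} {i : I}
    (h : ∀ j, i ≠ j → β s(i, j) = γ s(i, j)) :
    (legPauli s s' β i : GadgetLeg site ℓ i → Pauli) = legPauli s s' γ i := by
  funext a
  cases a with
  | incoming => rfl
  | outgoing => rfl
  | internal j hj a => exact congrFun (h j hj) a

theorem exists_eq_bondWire (b : BondWire ℓ → Pauli) :
    ∃ β : ∀ e, Fin (ℓ e) → Pauli, b = fun w => β w.1 w.2 := by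
  obtain ⟨β, hβ⟩ := exists_pi_extend (F := fun e => Fin (ℓ e) → Pauli)
    (f := fun e : Bond I => e.1) Subtype.val_injective fun e a => b ⟨e, a⟩
  exact ⟨β, funext fun w => (congrFun (hβ w.1) w.2).symm⟩

theorem mem_joinedStabilizers_bondWiring [Fintype I] (G : GadgetLayout site ℓ) (β : ∀ e, Fin (ℓ e) → Pauli) :
    (fun w : BondWire ℓ => β w.1 w.2) ∈
      (ZXDiagram.sigma G).joinedStabilizers (bondWiring site ℓ) ↔
      ∀ i, (G i).IsStabilizer (legPauli 0 0 β i) := by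
  refine (ZXDiagram.mem_joinedStabilizers _ _ _).trans ((ZXDiagram.isStabilizer_sigma _ _).trans ?_)
  refine forall_congr' fun i => iff_of_eq (congrArg _ (funext fun a => ?_))
  cases a <;> rfl

namespace IsLayoutReduction

/-- `G'` arises from `G` by a layout reduction, as far as stabilizers are concerned. -/
def Reduces (i₀ : I) (V V' : ∀ e, (Fin (m e) ⊕ Fin (ℓ e) → ZMod 2) → ℂ) (G : GadgetLayout site ℓ)
    (G' : GadgetLayout site m) : Prop :=
  ∀ i s s' β', (G' i).IsStabilizer (legPauli s s' β' i) ↔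
    ∃ γ : ∀ e, Fin (ℓ e) → Pauli, (G i).IsStabilizer (legPauli s s' γ i) ∧
      ∀ j, i ≠ j → IsSymm (reduceAt i₀ V V' i s(i, j)) (Sum.elim (β' s(i, j)) (γ s(i, j)))

variable {G : GadgetLayout site ℓ} {G' : GadgetLayout site m}

/-- As `P` vanishes on all bonds but one, the choices in `hγ` amount to adding either nothing or the
stabilizer given by `P`. -/
theorem isStabilizer_toggle (h : IsLayoutReduction i₀ j₀ P c V V')
    (hP : (G i₀).IsStabilizer (legPauli 0 0 P i₀)) {s s' : Q → Pauli}
    {β γ : ∀ e, Fin (ℓ e) → Pauli} (hβ : (G i₀).IsStabilizer (legPauli s s' β i₀))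
    (hγ : ∀ j, i₀ ≠ j → γ s(i₀, j) = β s(i₀, j) ∨ γ s(i₀, j) = β s(i₀, j) + P s(i₀, j)) :
    (G i₀).IsStabilizer (legPauli s s' γ i₀) := by
  have h1 : ∀ j, i₀ ≠ j → j ≠ j₀ → P s(i₀, j) = 0 := fun j _ hj =>
    h.eq_zero _ fun h => hj (Sym2.congr_right.1 h)
  rcases hγ j₀ h.ne with h2 | h2
  · rwa [legPauli_congr s s' (γ := β)]
    intro j hj
    by_cases hj' : j = j₀
    · rw [hj', h2]
    · simpa [h1 j hj hj'] using hγ j hj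
  · have h3 := hβ.add hP
    rw [legPauli_add, add_zero, add_zero] at h3
    rwa [legPauli_congr s s' (γ := β + P)]
    intro j hj
    by_cases hj' : j = j₀
    · rw [hj', h2]; rfl
    · simpa [h1 j hj hj'] using hγ j hj

variable [Fintype Q] [Fintype I]

/-- Two stabilizers of the gadget at `i₀` commute, and `P` lives on a single bond, so they already
commute there. -/
theorem commute (h : IsLayoutReduction i₀ j₀ P c V V') (hG : (G i₀).eval ≠ 0)
    (hP : (G i₀).IsStabilizer (legPauli 0 0 P i₀)) {s s' : Q → Pauli}
    {β : ∀ e, Fin (ℓ e) → Pauli} (hβ : (G i₀).IsStabilizer (legPauli s s' β i₀)) (e : Sym2 I) :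
    pauliSymplectic (β e) (P e) = 0 := by
  by_cases he : e = s(i₀, j₀)
  · subst he
    have h1 := hβ.isSymm.commute hG hP.isSymm
    rw [pauliSymplectic, h.sum_legPauli (fun a r => (legPauli s s' β i₀ a).1 * r.2 +
      (legPauli s s' β i₀ a).2 * r.1) fun a => by simp] at h1
    exact h1
  · rw [h.eq_zero e he, pauliSymplectic_zero_right]

/-- On every bond the web operator commutes with `P` and so has a partner on the reduced bond. At
`i₀` the partner may belong to the operator times `P`, which is harmless since `P` is a stabilizer
there. A trivial operator has a trivial partner, so no new bond is occupied. -/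
theorem hasLocalWeb (h : IsLayoutReduction i₀ j₀ P c V V') (hG : (G i₀).eval ≠ 0)
    (hP : (G i₀).IsStabilizer (legPauli 0 0 P i₀)) (hG' : Reduces i₀ V V' G G')
    {s s' : Q → Pauli} (hs : G.HasLocalWeb s s') : G'.HasLocalWeb s s' := by
  obtain ⟨β, h1, h2⟩ := hs
  choose β' hβ' hδ hβ0 using fun e =>
    (h.bond e).exists_partner (β e) (h.commute hG hP (h1 i₀) e)
  refine ⟨β', fun i => (hG' i s s' β').2 ?_, fun e a he => ?_⟩
  · by_cases hi : i = i₀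
    · subst hi
      have hδ' : ∀ e, ∃ δ, (δ = β e ∨ δ = β e + P e) ∧ IsSymm (V e) (Sum.elim (β' e) δ) := by
        intro e
        rcases hδ e with hd | hd
        · exact ⟨_, Or.inl rfl, hd⟩
        · exact ⟨_, Or.inr rfl, hd⟩
      choose δ hδ1 hδ2 using hδ'
      refine ⟨δ, h.isStabilizer_toggle hP (h1 i) fun j _ => hδ1 _, fun j _ => ?_⟩
      rw [reduceAt, if_pos rfl]
      exact hδ2 _
    · refine ⟨β, h1 i, fun j _ => ?_⟩
      rw [reduceAt, if_neg hi]
      exact hβ' _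
  · have h3 : β e ≠ 0 := fun h0 => he (by rw [hβ0 e h0]; rfl)
    obtain ⟨a', ha'⟩ := Function.ne_iff.1 h3
    exact h2 e a' ha'

/-- A web of the reduced layout lifts separately at both ends of each bond, and both lifts are
matched with the same reduced operator by `V'`. They differ at most by `P`, so the lift at an end
away from `i₀` can be used throughout, after correction at `i₀`. -/
theorem exists_mem_joinedStabilizers (h : IsLayoutReduction i₀ j₀ P c V V')
    (hG : (G i₀).eval ≠ 0) (hP : (G i₀).IsStabilizer (legPauli 0 0 P i₀))
    (hG' : Reduces i₀ V V' G G') {β' : ∀ e, Fin (m e) → Pauli}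
    (hβ' : ∀ i, (G' i).IsStabilizer (legPauli 0 0 β' i)) :
    ∃ β : ∀ e, Fin (ℓ e) → Pauli, (∀ i, (G i).IsStabilizer (legPauli 0 0 β i)) ∧
      ∀ e, ¬ e.IsDiag → IsSymm (V' e) (Sum.elim (β' e) (β e)) := by
  choose γ hγ1 hγ2 using fun i => (hG' i 0 0 β').1 (hβ' i)
  have hV' : ∀ i e, i ∈ e → ¬ e.IsDiag → IsSymm (V' e) (Sum.elim (β' e) (γ i e)) := by
    rintro i e ⟨j, rfl⟩ he
    have h1 := hγ2 i j (by simpa using he)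
    by_cases hi : i = i₀
    · subst hi
      rw [reduceAt, if_pos rfl] at h1
      exact (h.bond _).symm_of_commute _ _ (h.commute hG hP (hγ1 i) _) h1
    · rwa [reduceAt, if_neg hi] at h1
  -- The ambiguity by `P` can be absorbed only at `i₀`, so the lift is read off at the other end.
  have hk : ∀ e : Sym2 I, ∃ k, ¬ e.IsDiag → k ∈ e ∧ k ≠ i₀ := by
    intro e
    induction e using Sym2.ind with
    | _ i j =>
    by_cases hi : i = i₀
    · refine ⟨j, fun he => ⟨Sym2.mem_mk_right _ _, ?_⟩⟩
      rintro rfl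
      exact he hi
    · exact ⟨i, fun _ => ⟨Sym2.mem_mk_left _ _, hi⟩⟩
  choose k hk using hk
  have key : ∀ i e, i ∈ e → ¬ e.IsDiag → γ (k e) e = γ i e ∨ γ (k e) e = γ i e + P e := by
    intro i e hi he
    have h1 := (hV' _ e (hk e he).1 he).add (hV' i e hi he)
    rw [Pauli.elim_add_elim, Pauli.add_self] at h1
    refine ((h.bond e).eq_of_symm _ h1).imp (fun h3 => ?_) fun h3 => ?_
    · rw [Pauli.add_eq_iff.1 h3, add_zero]
    · exact Pauli.add_eq_iff.1 h3
  refine ⟨fun e => γ (k e) e, fun i => ?_, fun e he => hV' _ _ (hk e he).1 he⟩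
  by_cases hi : i = i₀
  · subst hi
    exact h.isStabilizer_toggle hP (hγ1 i) fun j hj =>
      key i _ (Sym2.mem_mk_left _ _) (by simpa using hj)
  · rw [legPauli_congr 0 0 (γ := γ i)]
    · exact hγ1 i
    intro j hj
    have he : ¬ (s(i, j)).IsDiag := by simpa using hj
    by_cases he₀ : s(i, j) = s(i₀, j₀)
    · have h1 : k s(i, j) = j₀ := by
        have := hk _ he
        rw [he₀, Sym2.mem_iff] at this
        rw [he₀]
        exact this.1.resolve_left this.2
      have h2 : i = j₀ := by
        have : i ∈ s(i₀, j₀) := he₀ ▸ Sym2.mem_mk_left _ _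
        exact (Sym2.mem_iff.1 this).resolve_left hi
      rw [h1, h2]
    · have := key i _ (Sym2.mem_mk_left _ _) he
      rwa [h.eq_zero _ he₀, add_zero, or_self] at this

/-- The lift determines the reduced operator by `IsBondReduction.eq_zero`, hence choosing lifts is
injective, and cardinalities over 𝔽₂ compare. The choice need not be linear. -/
theorem finrank_joinedStabilizers_le (h : IsLayoutReduction i₀ j₀ P c V V')
    (hG : (G i₀).eval ≠ 0) (hP : (G i₀).IsStabilizer (legPauli 0 0 P i₀))
    (hG' : Reduces i₀ V V' G G') :
    Module.finrank (ZMod 2) ((ZXDiagram.sigma G').joinedStabilizers (bondWiring site m)) ≤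
      Module.finrank (ZMod 2) ((ZXDiagram.sigma G).joinedStabilizers (bondWiring site ℓ)) := by
  have h1 : ∀ b' : (ZXDiagram.sigma G').joinedStabilizers (bondWiring site m),
      ∃ b : (ZXDiagram.sigma G).joinedStabilizers (bondWiring site ℓ),
      ∀ e : Bond I, IsSymm (V' e) (Sum.elim (fun a => b'.1 ⟨e, a⟩) fun a => b.1 ⟨e, a⟩) := by
    rintro ⟨b', hb'⟩
    obtain ⟨β', rfl⟩ := exists_eq_bondWire b'
    obtain ⟨β, hβ, hV⟩ := h.exists_mem_joinedStabilizers hG hP hG'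
      ((mem_joinedStabilizers_bondWiring G' β').1 hb')
    exact ⟨⟨_, (mem_joinedStabilizers_bondWiring G β).2 hβ⟩, fun e => hV e e.2⟩
  choose F hF using h1
  have hinj : Function.Injective F := by
    intro b b' hb
    refine Subtype.ext (funext fun w => ?_)
    obtain ⟨e, a⟩ := w
    have h2 := (hF b e).add (hF b' e)
    rw [hb] at h2
    rw [Pauli.elim_add_elim, Pauli.add_self] at h2
    have h4 := Pauli.add_eq_iff.1 ((h.bond e).eq_zero _ h2)
    rw [add_zero] at h4
    exact congrFun h4 a
  have h2 := Nat.card_le_card_of_injective F hinj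
  rw [Module.natCard_eq_pow_finrank (K := ZMod 2)
      (V := (ZXDiagram.sigma G').joinedStabilizers (bondWiring site m)),
    Module.natCard_eq_pow_finrank (K := ZMod 2)
      (V := (ZXDiagram.sigma G).joinedStabilizers (bondWiring site ℓ)), Nat.card_zmod] at h2
  exact (Nat.pow_le_pow_iff_right one_lt_two).1 h2

end IsLayoutReduction

end LayoutReduction

end

noncomputable section

open scoped Classical

/-! ### Minimal layouts -/

section Minimal

variable {Q I : Type} [Fintype I] {site : Q → I}

open GadgetLayout

theorem applyBond_smul {ℓ m : Sym2 I → ℕ} {i : I} (k : Sym2 I → ℂ)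
    (V : ∀ e, Matrix (Fin (m e) → ZMod 2) (Fin (ℓ e) → ZMod 2) ℂ)
    (T : (GadgetLeg site ℓ i → ZMod 2) → ℂ) :
    applyBond (fun e => k e • V e) T = (∏ j : {j // i ≠ j}, k s(i, j.1)) • applyBond V T := by
  funext x
  rw [Pi.smul_apply, smul_eq_mul, applyBond, applyBond, Finset.mul_sum]
  refine Finset.sum_congr rfl fun y _ => ?_
  rw [← mul_assoc, ← Finset.prod_mul_distrib]
  rfl

theorem GadgetLayout.BondLocalUnitaryEquiv.refl {ℓ : Sym2 I → ℕ} (G : GadgetLayout site ℓ) :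
    BondLocalUnitaryEquiv G G := by
  refine ⟨fun _ _ => 1, fun _ _ => one_mem _, fun i j _ => ?_, fun i =>
    ⟨⟨1, one_ne_zero, ?_⟩, rfl⟩⟩
  · exact (Matrix.map_one star (star_zero ℂ) (star_one ℂ)).symm
  · rw [one_smul, applyBondMatrices_eq, applyBond_one]
    exact fun e u v => Matrix.one_apply.trans (ite_congr_iff Iff.rfl rfl)

variable [Fintype Q]

theorem IsLayoutReduction.exists_layout {ℓ m : Sym2 I → ℕ} {G : GadgetLayout site ℓ}
    {i₀ j₀ : I} {P : ∀ e, Fin (ℓ e) → Pauli} {c : Sym2 I → ℂ}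
    {V V' : ∀ e, (Fin (m e) ⊕ Fin (ℓ e) → ZMod 2) → ℂ} (h : IsLayoutReduction i₀ j₀ P c V V')
    (hc : c s(i₀, j₀) ≠ 0)
    (hP : pauliAct (legPauli 0 0 P i₀) (G i₀).eval = c s(i₀, j₀) • (G i₀).eval) :
    ∃ G' : GadgetLayout site m, G.diagram.SameMap G'.diagram ∧ Reduces i₀ V V' G G' := by
  have hW : ∀ i e, ∃ W : ZXDiagram (Fin (m e) ⊕ Fin (ℓ e)), ∃ k : ℂ, k ≠ 0 ∧
      W.eval = k • reduceAt i₀ V V' i e ∧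
      ∀ p, W.IsStabilizer p ↔ IsSymm (reduceAt i₀ V V' i e) p := by
    intro i e
    have hcl : IsClifford (reduceAt i₀ V V' i e) := by
      rw [reduceAt]
      split_ifs
      · exact (h.bond e).clifford
      · exact (h.bond e).clifford'
    obtain ⟨W, ⟨k, hk, hW⟩, -⟩ := exists_diagram_of_isClifford hcl
    refine ⟨W, k, hk, hW, fun p => ?_⟩
    rw [ZXDiagram.isStabilizer_iff_isSymm (by rw [hW]; exact smul_ne_zero hk hcl.1), hW,
      isSymm_smul_iff hk]
  choose W k hk hW hWs using hW
  obtain ⟨κ, hκ, hcon⟩ := h.contract_eq (fun i => (G i).eval) hc hP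
  refine ⟨fun i => (G i).attach (W i),
    ⟨(∏ i, ∏ j : {j // i ≠ j}, k i s(i, j.1)) * κ, mul_ne_zero
      (Finset.prod_ne_zero_iff.2 fun i _ => Finset.prod_ne_zero_iff.2 fun j _ => hk _ _) hκ, ?_⟩,
    fun i s s' β' => ?_⟩
  · have h1 : ∀ i, ((G i).attach (W i)).eval = (∏ j : {j // i ≠ j}, k i s(i, j.1)) •
        applyBond (fun e => bondMatrix (reduceAt i₀ V V' i e)) (G i).eval := by
      intro i
      rw [eval_attach, ← applyBond_smul]
      congr 1
      funext e
      rw [hW]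
      rfl
    rw [eval_diagram, funext h1, contract_smul, hcon, eval_diagram, smul_smul]
  · refine (isStabilizer_attach _ _ _ _ _).trans (exists_congr fun γ => and_congr Iff.rfl ?_)
    simp only [hWs]

/-- Reduction along an offending stabilizer removes a wire and keeps the map and the local webs.
Only the number of spacetime stabilizers has to be repaired, by choosing new diagrams for the gadget
tensors. -/
theorem exists_smaller_layout {ℓ : Sym2 I → ℕ} {G : GadgetLayout site ℓ}
    (hG : G.diagram.eval ≠ 0) (hmin : ¬ G.IsMinimal) :
    ∃ (m : Sym2 I → ℕ) (G' : GadgetLayout site m), ∑ e, m e < ∑ e, ℓ e ∧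
      G.diagram.SameMap G'.diagram ∧
      G.diagram.numSpacetimeStabilizers = G'.diagram.numSpacetimeStabilizers ∧
      ∀ s s', G.HasLocalWeb s s' → G'.HasLocalWeb s s' := by
  have hG0 : ∀ i, (G i).eval ≠ 0 := by
    rw [eval_diagram] at hG
    exact ne_zero_of_contract_ne_zero hG
  unfold IsMinimal at hmin
  push Not at hmin
  obtain ⟨i₀, j₀, hij, p, hp, h1, h2, h3, hp0⟩ := hmin
  let q : Fin (ℓ s(i₀, j₀)) → Pauli := fun a => p (.internal j₀ hij a)
  have hpq : legPauli 0 0 (Function.update 0 s(i₀, j₀) q) i₀ = p := by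
    funext a
    cases a with
    | incoming => exact (h1 _ _).symm
    | outgoing => exact (h2 _ _).symm
    | internal j hj a =>
      by_cases hj' : j = j₀
      · subst hj'
        rw [legPauli, Function.update_self]
      · rw [legPauli, Function.update_of_ne fun h => hj' (Sym2.congr_right.1 h), h3 j hj a hj']
        rfl
  have hq : q ≠ 0 := by
    intro hq
    have h0 : (Function.update 0 s(i₀, j₀) 0 : ∀ e, Fin (ℓ e) → Pauli) = 0 :=
      Function.update_eq_self s(i₀, j₀) (0 : ∀ e, Fin (ℓ e) → Pauli)
    rw [hq, h0] at hpq
    refine hp0 (hpq.symm.trans (funext fun a => ?_))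
    cases a <;> rfl
  obtain ⟨c₀, hc₀, hc⟩ := hp.isSymm
  -- A Pauli string in the convention X^x Z^z squares to this sign, so `c₀` is ±1 or ±i.
  have hcc : c₀ * c₀ = sgn (∑ a, (q a).2 * (q a).1) := by
    have h4 := pauliAct_pauliAct p p (G i₀).eval
    rw [hc, pauliAct_smul, hc, smul_smul, Pauli.add_self, pauliAct_zero] at h4
    rw [smul_left_injective ℂ (hG0 i₀) h4]
    refine congrArg sgn (sum_gadgetLeg hij _ (fun _ _ => ?_) (fun _ _ => ?_) fun _ _ _ hk => ?_)
    · rw [h1]; exact mul_zero _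
    · rw [h2]; exact mul_zero _
    · rw [h3 _ _ _ hk]; exact mul_zero _
  obtain ⟨m, hm, hm', V, V', hred⟩ := exists_isLayoutReduction hij hq hcc
  rw [← hpq] at hp
  obtain ⟨G₁, hG₁, hr₁⟩ := hred.exists_layout (by rwa [Function.update_self])
    (by rw [hpq, Function.update_self, hc])
  have hG₁0 : ∀ i, (G₁ i).eval ≠ 0 := by
    obtain ⟨k, hk, h4⟩ := hG₁
    have h5 : G₁.diagram.eval ≠ 0 := h4 ▸ smul_ne_zero hk hG
    rw [eval_diagram] at h5
    exact ne_zero_of_contract_ne_zero h5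
  have hle := hred.finrank_joinedStabilizers_le (hG0 i₀) hp hr₁
  obtain ⟨n, hn⟩ := Nat.exists_eq_add_of_le hle
  -- All gadgets get 0 spacetime stabilizers except that at `i₀`, which receives the former total
  -- together with the number `n` lost on the bonds.
  choose G₂ hG₂ hnum using fun i => ZXDiagram.exists_sameMap_num (hG₁0 i)
    (if i = i₀ then ∑ i, (G i).numSpacetimeStabilizers + n else 0)
  have hstab : ∀ i p, (G₂ i).IsStabilizer p ↔ (G₁ i).IsStabilizer p := by
    intro i p
    obtain ⟨d, hd, h4⟩ := hG₂ i
    rw [ZXDiagram.isStabilizer_iff_isSymm (hG₁0 i), ZXDiagram.isStabilizer_iff_isSymm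
      (by rw [h4]; exact smul_ne_zero hd (hG₁0 i)), h4, isSymm_smul_iff hd]
  have hr₂ : IsLayoutReduction.Reduces i₀ V V' G G₂ := fun i s s' β' => (hstab i _).trans (hr₁ i s s' β')
  have hJ : (ZXDiagram.sigma G₂).joinedStabilizers (bondWiring site m) =
      (ZXDiagram.sigma G₁).joinedStabilizers (bondWiring site m) := by
    ext b
    obtain ⟨β, rfl⟩ := exists_eq_bondWire b
    rw [mem_joinedStabilizers_bondWiring, mem_joinedStabilizers_bondWiring]
    exact forall_congr' fun i => hstab i _
  refine ⟨m, G₂, Finset.sum_lt_sum (fun e _ => hm e) ⟨_, Finset.mem_univ _, hm'⟩,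
    hG₁.trans ?_, ?_, fun s s' => hred.hasLocalWeb (hG0 i₀) hp hr₂⟩
  · choose d hd h4 using hG₂
    refine ⟨∏ i, d i, Finset.prod_ne_zero_iff.2 fun i _ => hd i, ?_⟩
    rw [eval_diagram, eval_diagram, funext h4, contract_smul]
  · rw [numSpacetimeStabilizers_diagram, numSpacetimeStabilizers_diagram, hJ,
      Finset.sum_congr rfl fun i _ => hnum i, Finset.sum_ite_eq' , if_pos (Finset.mem_univ _), hn]
    ring

/-- Strong induction on the total number of internal legs. -/
theorem exists_minimal_layout {S S' : StabilizerCode Q} {D : ZXDiagram (Q ⊕ Q)} (hD : D.eval ≠ 0)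
    (h : IsSLP site S S' D) : ∃ (ℓ : Sym2 I → ℕ) (G : GadgetLayout site ℓ),
      IsLayoutOf S S' G D ∧ IsMinimal G := by
  obtain ⟨ℓ, G, hG⟩ := h
  induction hn : ∑ e, ℓ e using Nat.strong_induction_on generalizing ℓ with
  | _ n ih =>
  by_cases hmin : IsMinimal G
  · exact ⟨ℓ, G, hG, hmin⟩
  obtain ⟨h1, h2, h3⟩ := hG
  rw [ZXDiagram.stabilizerPreservingRewrites_iff] at h1
  have hG0 : G.diagram.eval ≠ 0 := by
    obtain ⟨c, hc, h4⟩ := h1.1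
    exact h4 ▸ smul_ne_zero hc hD
  obtain ⟨m, G', hm, h4, h5, h6⟩ := exists_smaller_layout hG0 hmin
  exact ih _ (hn ▸ hm) m G' ⟨(ZXDiagram.stabilizerPreservingRewrites_iff _ _).2
    ⟨h1.1.trans h4, h1.2.trans h5⟩, fun s hs => h6 _ _ (h2 s hs), fun s hs => h6 _ _ (h3 s hs)⟩ rfl

end Minimal

theorem ZXDiagram.spacetimeEquiv_iff {L : Type} (D D' : ZXDiagram L) :
    D.SpacetimeEquiv D' ↔
      D.SameMap D' ∧ D.numSpacetimeStabilizers = D'.numSpacetimeStabilizers := by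
  rw [SpacetimeEquiv, zxEquiv_iff, stabilizerPreservingRewrites_iff]
  exact and_iff_right_of_imp fun h => h.1

theorem IsDynamicalCode.eval_ne_zero {Q : Type} [Fintype Q] {S S' : StabilizerCode Q}
    {D : ZXDiagram (Q ⊕ Q)} (hD : IsDynamicalCode S S' D) : D.eval ≠ 0 := by
  intro h
  refine hD.ne_zero (funext fun b => funext fun a => ?_)
  rw [ZXDiagram.linearMap, h]
  rfl

end

theorem mainTheorem2 {Q I : Type} [Fintype Q] [Fintype I] (site : Q → I)
    (S S' : StabilizerCode Q) (D₁ D₂ : ZXDiagram (Q ⊕ Q))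
    (hD₁ : IsDynamicalCode S S' D₁) (hD₂ : IsDynamicalCode S S' D₂)
    (hSLP₁ : IsSLP site S S' D₁) (hSLP₂ : IsSLP site S S' D₂) :
    D₁.SpacetimeEquiv D₂ ↔
      ∃ (ℓ : Sym2 I → ℕ) (G₁ G₂ : GadgetLayout site ℓ),
        (GadgetLayout.IsLayoutOf S S' G₁ D₁ ∧ GadgetLayout.IsMinimal G₁) ∧
        (GadgetLayout.IsLayoutOf S S' G₂ D₂ ∧ GadgetLayout.IsMinimal G₂) ∧
        GadgetLayout.BondLocalUnitaryEquiv G₁ G₂ := by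
  rw [ZXDiagram.spacetimeEquiv_iff]
  constructor
  · rintro ⟨h, hn⟩
    -- One minimal layout of the first code is a layout of both codes, and it is equivalent to
    -- itself.
    obtain ⟨ℓ, G, hG, hmin⟩ := exists_minimal_layout hD₁.eval_ne_zero hSLP₁
    obtain ⟨h1, h2⟩ := (ZXDiagram.stabilizerPreservingRewrites_iff _ _).1 hG.1
    exact ⟨ℓ, G, G, ⟨hG, hmin⟩, ⟨⟨(ZXDiagram.stabilizerPreservingRewrites_iff _ _).2
      ⟨h.symm.trans h1, hn.symm.trans h2⟩, hG.2⟩, hmin⟩,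
      GadgetLayout.BondLocalUnitaryEquiv.refl G⟩
  · rintro ⟨ℓ, G₁, G₂, ⟨⟨h₁, -⟩, -⟩, ⟨⟨h₂, -⟩, -⟩, hU⟩
    rw [ZXDiagram.stabilizerPreservingRewrites_iff] at h₁ h₂
    have hG₁ : G₁.diagram.eval ≠ 0 := by
      obtain ⟨c, hc, h⟩ := h₁.1
      exact h ▸ smul_ne_zero hc hD₁.eval_ne_zero
    obtain ⟨h3, h4⟩ := hU.diagram hG₁
    exact ⟨(h₁.1.trans h3).trans h₂.1.symm, (h₁.2.trans h4).trans h₂.2.symm⟩
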